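/- Let $M\subset\mathbb R^3$ be a compact domain with smooth boundary, with a $C^\infty$ Riemannian metric $g$ on $M$ (up to the boundary) such that $(M,g)$ is simple: $\partial M$ is strictly convex (positive definite second fundamental form), and any two points of $M$ are joined by a unique geodesic contained in $M$, depending smoothly on its end points. For a $2$-tensor field $f=(f_{ij})$ put $$\mu f=g^{ij}f_{ij},\qquad \mathcal B f=f-\tfrac13(\mu f)\,g,$$ and for a covector field $v$ put $$\mathrm d^{\mathcal B}v=\mathcal B\,\mathrm d'v,\qquad (\mathrm d'v)_{ij}=\nabla_jv_i=\partial_jv_i-\Gamma^k_{ij}v_k .$$ Let $\partial_+(SM)$ be the set of $(x,\xi)$ with $x\in\partial M$, $|\xi|_g=1$ and $\xi$ pointing strictly into $M$. The mixed ray transform of a $2$-tensor field $f$ is $$Lf(x,\xi,\eta)=\int_0^{\tau(x,\xi)}f_{ij}(\gamma(t))\,\eta(t)^i\,\dot\gamma(t)^j\,\mathrm dt,\qquad (x,\xi)\in\partial_+(SM),\ \eta\in T_xM,\ \eta\perp_g\xi,$$ where $\gamma$ is the geodesic with $\gamma(0)=x$, $\dot\gamma(0)=\xi$, $\tau(x,\xi)$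 is the first positive time at which $\gamma$ hits $\partial M$, and $\eta(t)$ is the parallel translation of $\eta$ along $\gamma$. Let $f$ be a $2$-tensor field, $C^\infty$ on $M$ up to the boundary and trace-free ($\mu f=0$), with $Lf=0$. Then there is a covector field $v$, $C^\infty$ on $M$ up to the boundary, with $v=0$ on $\partial M$, such that all partial derivatives, of every order $m\ge 0$, of $\tilde f=f-\mathrm d^{\mathcal B}v$ vanish on $\partial M$. Moreover, if $\partial M$ is real analytic and $g$ and $f$ are real analytic in a two-sided neighborhood of $\partial M$ (that is, near $\partial M$ they are restrictions to $M$ of real analytic tensor fields on an open set containing $\partial M$), then $v$ can be chosen so that $\tilde f=0$ in a neighborhood of $\partial M$ in $M$. -/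

import Mathlib

open scoped ContDiff

namespace MixedRay

noncomputable section

/-- Three-dimensional space.  Only its topology, vector space and smooth structures are used below;
lengths and angles are always measured by a Riemannian metric `g`. -/
abbrev R3 := Fin 3 → ℝ

/-- A field of `2`-tensors, by its components `f x i j`.  Only the values on the domain `M` under
consideration matter. -/
abbrev TensorField := R3 → Matrix (Fin 3) (Fin 3) ℝ

/-- A field of `1`-tensors (covectors), by its components `v x i`. -/
abbrev CovectorField := R3 → Fin 3 → ℝ

/-- `F` is `C^∞` on the closed set `s` up to the boundary: it is the restriction to `s` of a
smooth function on the whole space. -/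
def SmoothUpTo {X Y : Type*} [NormedAddCommGroup X] [NormedSpace ℝ X] [NormedAddCommGroup Y]
    [NormedSpace ℝ Y] (s : Set X) (F : X → Y) : Prop :=
  ∃ G : X → Y, ContDiff ℝ ∞ G ∧ Set.EqOn F G s

/-- `F`, given on `M`, is real analytic in a two-sided neighbourhood of `∂M`: near `∂M` it is the
restriction to `M` of a function that is analytic in an open set containing `∂M`. -/
def AnalyticNearBoundary (M : Set R3) (F : R3 → ℝ) : Prop :=
  ∃ W : Set R3, IsOpen W ∧ frontier M ⊆ W ∧
    ∃ G : R3 → ℝ, AnalyticOnNhd ℝ G W ∧ Set.EqOn F G (W ∩ M)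

/-- The partial derivative `∂_i F` at `x`, for `F` given on `M` (one-sided at `∂M`). -/
def pd (M : Set R3) (F : R3 → ℝ) (i : Fin 3) (x : R3) : ℝ :=
  fderivWithin ℝ F M x (Pi.single i 1)

/-- `ρ` is a `C^n` defining function of `M` in the open neighbourhood `U` of the point `x ∈ ∂M`,
nonnegative on `M`. -/
structure IsDefiningFunction (n : WithTop ℕ∞) (M : Set R3) (x : R3) (U : Set R3) (ρ : R3 → ℝ) :
    Prop where
  isOpen : IsOpen U
  mem : x ∈ U
  contDiffOn : ContDiffOn ℝ n ρ U
  inter_eq : M ∩ U = {y ∈ U | 0 ≤ ρ y}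
  eq_zero : ρ x = 0
  fderiv_ne : fderiv ℝ ρ x ≠ 0

/-- The boundary of `M` is of class `C^n` (`n = ∞`: smooth, `n = ω`: real analytic), with `M`
locally on one side of it. -/
def HasBoundaryOfClass (n : WithTop ℕ∞) (M : Set R3) : Prop :=
  ∀ x ∈ frontier M, ∃ U ρ, IsDefiningFunction n M x U ρ

/-- The inner product `⟨a, b⟩_g = g_{ij} a^i b^j` at `x`. -/
def innerG (g : TensorField) (x a b : R3) : ℝ := ∑ i, ∑ j, g x i j * a i * b j

/-- The Christoffel symbol `Γ^k_{ij}` of `g` at `x`. -/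
def christoffel (M : Set R3) (g : TensorField) (x : R3) (k i j : Fin 3) : ℝ :=
  (1 / 2) * ∑ l, (g x)⁻¹ k l *
    (pd M (fun y => g y j l) i x + pd M (fun y => g y i l) j x - pd M (fun y => g y i j) l x)

/-- `(γ, w)` is a geodesic of `(M, g)` with its velocity, parametrised by `[0, T]` and contained
in `M`: `γ' = w` and `(w^k)' = - Γ^k_{ij} w^i w^j`. -/
structure IsGeodesic (M : Set R3) (g : TensorField) (T : ℝ) (γ w : ℝ → R3) : Prop where
  mem : ∀ t ∈ Set.Icc 0 T, γ t ∈ M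
  velocity : ∀ t ∈ Set.Icc 0 T, ∀ k,
    HasDerivWithinAt (fun s => γ s k) (w t k) (Set.Icc 0 T) t
  acceleration : ∀ t ∈ Set.Icc 0 T, ∀ k,
    HasDerivWithinAt (fun s => w s k)
      (-∑ i, ∑ j, christoffel M g (γ t) k i j * w t i * w t j) (Set.Icc 0 T) t

/-- `η` is a parallel vector field along the curve `γ` with velocity `w` on `[0, T]`:
`(η^k)' = - Γ^k_{ij} w^i η^j`. -/
def IsParallel (M : Set R3) (g : TensorField) (T : ℝ) (γ w η : ℝ → R3) : Prop :=
  ∀ t ∈ Set.Icc 0 T, ∀ k,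
    HasDerivWithinAt (fun s => η s k)
      (-∑ i, ∑ j, christoffel M g (γ t) k i j * w t i * η t j) (Set.Icc 0 T) t

/-- The boundary of `(M, g)` is strictly convex (its second fundamental form is positive definite):
the covariant Hessian `∂_i ∂_j ρ - Γ^k_{ij} ∂_k ρ` of a defining function, nonnegative on `M`, is
negative on nonzero vectors tangent to `∂M`. -/
def StrictlyConvexBoundary (M : Set R3) (g : TensorField) : Prop :=
  ∀ x ∈ frontier M, ∀ U ρ, IsDefiningFunction ∞ M x U ρ →
    ∀ ξ : R3, ξ ≠ 0 → fderiv ℝ ρ x ξ = 0 →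
      fderiv ℝ (fun y => fderiv ℝ ρ y ξ) x ξ
        - ∑ k, ∑ i, ∑ j, christoffel M g x k i j * ξ i * ξ j * fderiv ℝ ρ x (Pi.single k 1) < 0

/-- `(M, g)` is a simple Riemannian manifold with smooth boundary and smooth metric: `M` is
compact, `∂M` is strictly convex, and any two points of `M` are joined by a unique geodesic
contained in `M`, which depends smoothly on its end points. -/
structure IsSimple (M : Set R3) (g : TensorField) : Prop where
  compact : IsCompact M
  boundary : HasBoundaryOfClass ∞ M
  smooth : ∀ i j, SmoothUpTo M (fun x => g x i j)
  posDef : ∀ x ∈ M, (g x).PosDef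
  convex : StrictlyConvexBoundary M g
  geodesics : ∃ c : R3 → R3 → ℝ → R3,
    SmoothUpTo (M ×ˢ M ×ˢ Set.Icc (0 : ℝ) 1) (fun p : R3 × R3 × ℝ => c p.1 p.2.1 p.2.2) ∧
    ∀ x ∈ M, ∀ y ∈ M,
      (∃ w, IsGeodesic M g 1 (c x y) w) ∧ c x y 0 = x ∧ c x y 1 = y ∧
      ∀ γ w, IsGeodesic M g 1 γ w → γ 0 = x → γ 1 = y → Set.EqOn γ (c x y) (Set.Icc 0 1)

/-- `(x, ξ) ∈ ∂_+(SM)`: a `g`-unit vector `ξ` at a boundary point `x`, pointing strictly inward.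
(The outward normal is a negative multiple of the `g`-gradient of a defining function `ρ` that is
nonnegative on `M`, so `⟨ξ, ν⟩_g < 0` reads `dρ(ξ) > 0`.) -/
def InwardUnit (M : Set R3) (g : TensorField) (x ξ : R3) : Prop :=
  x ∈ frontier M ∧ innerG g x ξ ξ = 1 ∧
    ∃ U ρ, IsDefiningFunction ∞ M x U ρ ∧ 0 < fderiv ℝ ρ x ξ

/-- The geodesic `γ = γ_{x,ξ}` issued from `(x, ξ)`, up to its exit time `τ`, the first positive
time at which it hits `∂M`, with the parallel translation `η(t)` of `η` along it. -/
structure Ray (M : Set R3) (g : TensorField) (x ξ η : R3) where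
  τ : ℝ
  γ : ℝ → R3
  vel : ℝ → R3
  par : ℝ → R3
  τ_pos : 0 < τ
  geodesic : IsGeodesic M g τ γ vel
  parallel : IsParallel M g τ γ vel par
  γ_zero : γ 0 = x
  vel_zero : vel 0 = ξ
  par_zero : par 0 = η
  exit : γ τ ∈ frontier M
  first : ∀ t ∈ Set.Ioo 0 τ, γ t ∉ frontier M

/-- The mixed ray transform `(L f)(x, ξ, η) = ∫_0^τ f_{ij}(γ(t)) η(t)^i γ'(t)^j dt` of a
`1+1` tensor field. -/
def mixedRayTransform {M : Set R3} {g : TensorField} {x ξ η : R3} (f : TensorField)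
    (r : Ray M g x ξ η) : ℝ :=
  ∫ t in (0 : ℝ)..r.τ, ∑ i, ∑ j, f (r.γ t) i j * r.par t i * r.vel t j

/-- `L f = 0`. -/
def MixedRayTransformVanishes (M : Set R3) (g f : TensorField) : Prop :=
  ∀ x ξ η : R3, InwardUnit M g x ξ → innerG g x η ξ = 0 →
    ∀ r : Ray M g x ξ η, mixedRayTransform f r = 0

/-- The trace `μ f = f_{ij} g^{ij}`. -/
def trace (g f : TensorField) (x : R3) : ℝ := ∑ i, ∑ j, f x i j * (g x)⁻¹ i j

/-- The projection `𝓑` onto the trace-free tensors: `𝓑 f = f - (1/3) (μ f) g`. -/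
def traceFreePart (g f : TensorField) : TensorField :=
  fun x i j => f x i j - (1 / 3) * trace g f x * g x i j

/-- The covariant derivative `(d' v)_{ij} = v_{i;j} = ∂_j v_i - Γ^k_{ij} v_k`. -/
def covDeriv (M : Set R3) (g : TensorField) (v : CovectorField) : TensorField :=
  fun x i j => pd M (fun y => v y i) j x - ∑ k, christoffel M g x k i j * v x k

/-- `d^𝓑 v = 𝓑 d' v`. -/
def dB (M : Set R3) (g : TensorField) (v : CovectorField) : TensorField :=
  traceFreePart g (covDeriv M g v)

end

end MixedRay

/-!
The proof has two halves: a choice of gauge at the boundary, which is algebra, and a boundary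
determination, which uses short geodesics.

**Gauge.** Let `ρ` be a defining function of `M` and `∇ρ` its gradient. The operator
`v ↦ (d^𝓑 v)(·, ∇ρ)` is of first order, and at the conormal `dρ` its symbol is
`|dρ|² (1 - n ⊗ n / 3)`, which is invertible (`det_symbol_ne_zero`). Hence the equation
`(f - d^𝓑 v)(·, ∇ρ) = 0`, `v = 0` on `∂M`, has a unique formal solution `v = ∑ ρ^{k+1} a_k`, whose
coefficients are given by a recursion (`gaugeSeq`). Borel summation turns it into a smooth `v`
which solves the equation to infinite order at `∂M` (`exists_gauge`).

**Boundary determination.** Since `v` vanishes on `∂M`, the transform of `d^𝓑 v` is zero: along a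
ray `(d'v)(η, γ')` is the derivative of `v(η)`, and the trace part is killed by `η ⊥ γ'`. So
`f̃ = f - d^𝓑 v` has `L f̃ = 0` as well (`mixedRayTransform_sub_dB`). Suppose that `f̃` vanishes
to order `k` on `∂M` and let `c` be its `k`-th normal derivative at `z ∈ ∂M`. By strict convexity
there are short rays near every tangential direction `ξ` at `z` (`exists_short_ray`), and along
them the integrand is a positive multiple of `c(η, ξ) + o(1)`. Therefore `c(η, ξ) = 0` whenever
`ξ` is tangent and `η ⊥ ξ`. Together with `c(·, ∇ρ) = 0` and the vanishing trace this gives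
`c = 0` (`eq_zero_of_tangential`), so `f̃` vanishes to order `k + 1`. The existence of these short
rays is all that is needed from the geodesic flow: Picard–Lindelöf and continuity in the initial
data, and the concavity of `ρ` along geodesics near tangential directions.

**Analytic case.** The factor `1 / (k + 1)` in the recursion compensates the derivative in it, so
estimates of Cauchy type (`CauchyBound`) show that the formal solution converges near each
boundary point (`exists_analytic_gauge`). It has the same boundary jet as the smooth `v`, because
the gauge condition determines the jet (`vanishesOn_of_normalPart_dB`). So `f - d^𝓑 v` is analytic
near `∂M` and flat on `∂M`, hence zero near `∂M` (`eq_zero_of_vanishesOn`). For the same reason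
the local solutions agree where they meet, and a cut-off extends them to the whole space.
-/

namespace MixedRay

open Set Filter
open scoped Topology

/-- Partial derivatives of functions on the whole space. -/
notation "𝜕" => pd Set.univ

theorem pd_univ (F : R3 → ℝ) (i : Fin 3) (x : R3) : 𝜕 F i x = fderiv ℝ F x (Pi.single i 1) := by
  simp [pd, fderivWithin_univ]

theorem pd_univ_eq_comp (F : R3 → ℝ) (i : Fin 3) :
    𝜕 F i = ContinuousLinearMap.apply ℝ ℝ (Pi.single i 1 : R3) ∘ fderiv ℝ F := by
  ext x; simp [pd_univ]

theorem fderiv_eq_sum (F : R3 → ℝ) (x u : R3) : fderiv ℝ F x u = ∑ i, u i * 𝜕 F i x := by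
  conv_lhs => rw [← Finset.univ_sum_single u]
  rw [map_sum]
  refine Finset.sum_congr rfl fun i _ => ?_
  rw [pd_univ, ← smul_eq_mul, ← map_smul]
  congr 1
  ext j
  by_cases h : j = i
  · subst h; simp
  · simp [h]

theorem contDiffAt_pd {F : R3 → ℝ} {x : R3} (hF : ContDiffAt ℝ ∞ F x) (i : Fin 3) :
    ContDiffAt ℝ ∞ (𝜕 F i) x := by
  rw [pd_univ_eq_comp]
  exact (ContinuousLinearMap.contDiff _).contDiffAt.comp x (hF.fderiv_right (by simp))

theorem eventually_contDiffAt {Y : Type*} [NormedAddCommGroup Y] [NormedSpace ℝ Y]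
    {X : Type*} [NormedAddCommGroup X] [NormedSpace ℝ X] {F : X → Y} {x : X}
    (hF : ContDiffAt ℝ ∞ F x) (n : ℕ) : ∀ᶠ y in 𝓝 x, ContDiffAt ℝ n F y :=
  (hF.of_le (by exact_mod_cast le_top)).eventually (by simp)

theorem eventually_differentiableAt {F : R3 → ℝ} {x : R3}
    (hF : ContDiffAt ℝ ∞ F x) : ∀ᶠ y in 𝓝 x, DifferentiableAt ℝ F y :=
  (eventually_contDiffAt hF 1).mono fun _ h => h.differentiableAt (by simp)

theorem pd_add {F G : R3 → ℝ} {x : R3} (hF : DifferentiableAt ℝ F x) (hG : DifferentiableAt ℝ G x)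
    (i : Fin 3) : 𝜕 (fun y => F y + G y) i x = 𝜕 F i x + 𝜕 G i x := by
  simp [pd_univ, fderiv_fun_add hF hG]

theorem pd_sub {F G : R3 → ℝ} {x : R3} (hF : DifferentiableAt ℝ F x) (hG : DifferentiableAt ℝ G x)
    (i : Fin 3) : 𝜕 (fun y => F y - G y) i x = 𝜕 F i x - 𝜕 G i x := by
  simp [pd_univ, fderiv_fun_sub hF hG]

theorem pd_mul {F G : R3 → ℝ} {x : R3} (hF : DifferentiableAt ℝ F x) (hG : DifferentiableAt ℝ G x)
    (i : Fin 3) : 𝜕 (fun y => F y * G y) i x = 𝜕 F i x * G x + F x * 𝜕 G i x := by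
  simp [pd_univ, fderiv_fun_mul hF hG]; ring

theorem pd_congr {F G : R3 → ℝ} {x : R3} (h : F =ᶠ[𝓝 x] G) (i : Fin 3) : 𝜕 F i x = 𝜕 G i x := by
  simp [pd_univ, h.fderiv_eq]

theorem pd_comm {F : R3 → ℝ} {x : R3} (hF : ContDiffAt ℝ 2 F x) (i j : Fin 3) :
    𝜕 (𝜕 F i) j x = 𝜕 (𝜕 F j) i x := by
  have hs : IsSymmSndFDerivAt ℝ F x := hF.isSymmSndFDerivAt (by simp)
  have hd : DifferentiableAt ℝ (fderiv ℝ F) x :=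
    (hF.fderiv_right (m := 1) (by norm_num)).differentiableAt (by simp)
  have key : ∀ i j : Fin 3, 𝜕 (𝜕 F i) j x
      = fderiv ℝ (fderiv ℝ F) x (Pi.single j 1) (Pi.single i 1) := by
    intro i j
    rw [pd_univ, pd_univ_eq_comp,
      fderiv_comp _ (ContinuousLinearMap.differentiableAt _) hd]
    simp
  rw [key, key, hs.eq]

/-! ### Functions vanishing to finite order along a set -/

/-- All derivatives of `F` of order less than `k` vanish on `S`. -/
def VanishesOn (S : Set R3) (k : ℕ) (F : R3 → ℝ) : Prop :=
  ∀ n < k, ∀ x ∈ S, iteratedFDeriv ℝ n F x = 0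

namespace VanishesOn

variable {S S' : Set R3} {k l : ℕ} {F G : R3 → ℝ}

theorem zero_order : VanishesOn S 0 F := fun n hn => absurd hn (Nat.not_lt_zero n)

theorem mono (h : VanishesOn S k F) (hl : l ≤ k) : VanishesOn S l F :=
  fun n hn x hx => h n (hn.trans_le hl) x hx

theorem mono_set (h : VanishesOn S k F) (hS : S' ⊆ S) : VanishesOn S' k F :=
  fun n hn x hx => h n hn x (hS hx)

theorem congr (h : VanishesOn S k F) (hFG : ∀ x ∈ S, F =ᶠ[𝓝 x] G) : VanishesOn S k G :=
  fun n hn x hx => by rw [← ((hFG x hx).iteratedFDeriv ℝ n).eq_of_nhds]; exact h n hn x hx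

theorem eq_zero (h : VanishesOn S (k + 1) F) {x : R3} (hx : x ∈ S) : F x = 0 := by
  have := congrArg (fun T => T 0) (h 0 (Nat.succ_pos k) x hx)
  simpa using this

theorem const_zero : VanishesOn S k (fun _ => 0) := fun n _ x _ => by
  simp

theorem add (hF : ∀ x ∈ S, ContDiffAt ℝ ∞ F x) (hG : ∀ x ∈ S, ContDiffAt ℝ ∞ G x)
    (h : VanishesOn S k F) (h' : VanishesOn S k G) : VanishesOn S k (fun x => F x + G x) := by
  intro n hn x hx
  have := iteratedFDeriv_add_apply
    (((hF x hx).of_le (by exact_mod_cast le_top)) : ContDiffAt ℝ n F x)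
    (((hG x hx).of_le (by exact_mod_cast le_top)) : ContDiffAt ℝ n G x)
  change iteratedFDeriv ℝ n (F + G) x = 0
  rw [this, h n hn x hx, h' n hn x hx, add_zero]

theorem succ_iff (hF : ∀ x ∈ S, ContDiffAt ℝ ∞ F x) :
    VanishesOn S (k + 1) F ↔ (∀ x ∈ S, F x = 0) ∧ ∀ i, VanishesOn S k (𝜕 F i) := by
  constructor
  · intro h
    refine ⟨fun x hx => h.eq_zero hx, fun i n hn x hx => ?_⟩
    have h1 : ContDiffAt ℝ ∞ (fderiv ℝ F) x := (hF x hx).fderiv_right (by simp)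
    rw [pd_univ_eq_comp, ContinuousLinearMap.iteratedFDeriv_comp_left (n := ∞) _ h1
      (by exact_mod_cast le_top)]
    have h2 : iteratedFDeriv ℝ n (fderiv ℝ F) x = 0 := by
      rw [← norm_eq_zero, norm_iteratedFDeriv_fderiv, norm_eq_zero]
      exact h (n + 1) (by omega) x hx
    rw [h2]; ext; simp
  · rintro ⟨h0, h⟩ n hn x hx
    rcases n with _ | n
    · ext; simpa using h0 x hx
    · rw [← norm_eq_zero, ← norm_iteratedFDeriv_fderiv, norm_eq_zero]
      let L : Fin 3 → ℝ →L[ℝ] (R3 →L[ℝ] ℝ) := fun i =>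
        (ContinuousLinearMap.id ℝ ℝ).smulRight (ContinuousLinearMap.proj (R := ℝ) i)
      have e : fderiv ℝ F = (L 0 ∘ 𝜕 F 0) + (L 1 ∘ 𝜕 F 1) + (L 2 ∘ 𝜕 F 2) := by
        ext y u
        rw [fderiv_eq_sum]
        simp [L, Fin.sum_univ_three, mul_comm]
      have hs : ∀ i, ContDiffAt ℝ n (L i ∘ 𝜕 F i) x := fun i =>
        (L i).contDiff.contDiffAt.comp x ((contDiffAt_pd (hF x hx) i).of_le
          (by exact_mod_cast le_top))
      have hz : ∀ i, iteratedFDeriv ℝ n (L i ∘ 𝜕 F i) x = 0 := by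
        intro i
        rw [ContinuousLinearMap.iteratedFDeriv_comp_left (n := ∞) _ (contDiffAt_pd (hF x hx) i)
          (by exact_mod_cast le_top), h i n (by omega) x hx]
        ext; simp
      rw [e, iteratedFDeriv_add_apply (f := L 0 ∘ 𝜕 F 0 + L 1 ∘ 𝜕 F 1) ((hs 0).add (hs 1)) (hs 2),
        iteratedFDeriv_add_apply (hs 0) (hs 1), hz, hz, hz]
      simp

theorem partial_deriv (hF : ∀ x ∈ S, ContDiffAt ℝ ∞ F x) (h : VanishesOn S (k + 1) F) (i : Fin 3) :
    VanishesOn S k (𝜕 F i) := ((succ_iff hF).1 h).2 i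

theorem mul {c : R3 → ℝ} (hc : ∀ x ∈ S, ContDiffAt ℝ ∞ c x) (hF : ∀ x ∈ S, ContDiffAt ℝ ∞ F x)
    (h : VanishesOn S k F) : VanishesOn S k (fun x => c x * F x) := by
  induction k generalizing c F with
  | zero => exact zero_order
  | succ k ih =>
    refine (succ_iff fun x hx => (hc x hx).mul (hF x hx)).2 ⟨fun x hx => by
      rw [h.eq_zero hx, mul_zero], fun i => ?_⟩
    have h1 : VanishesOn S k (fun x => 𝜕 c i x * F x + c x * 𝜕 F i x) :=
      add (fun x hx => (contDiffAt_pd (hc x hx) i).mul (hF x hx))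
        (fun x hx => (hc x hx).mul (contDiffAt_pd (hF x hx) i))
        (ih (fun x hx => contDiffAt_pd (hc x hx) i) hF (h.mono (Nat.le_succ k)))
        (ih hc (fun x hx => contDiffAt_pd (hF x hx) i) (h.partial_deriv hF i))
    refine h1.congr fun x hx => ?_
    filter_upwards [eventually_differentiableAt (hc x hx), eventually_differentiableAt (hF x hx)]
      with y h1 h2 using (pd_mul h1 h2 i).symm

/-- Multiplication by a function vanishing on `S` gains one order. -/
theorem mul_of_eq_zero {c : R3 → ℝ} (hc : ∀ x ∈ S, ContDiffAt ℝ ∞ c x)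
    (hF : ∀ x ∈ S, ContDiffAt ℝ ∞ F x) (hc0 : ∀ x ∈ S, c x = 0)
    (h : VanishesOn S k F) : VanishesOn S (k + 1) (fun x => c x * F x) := by
  induction k generalizing F with
  | zero =>
    refine (succ_iff fun x hx => (hc x hx).mul (hF x hx)).2 ⟨fun x hx => by
      rw [hc0 x hx, zero_mul], fun i => zero_order⟩
  | succ k ih =>
    refine (succ_iff fun x hx => (hc x hx).mul (hF x hx)).2 ⟨fun x hx => by
      rw [hc0 x hx, zero_mul], fun i => ?_⟩
    have h1 : VanishesOn S (k + 1) (fun x => 𝜕 c i x * F x + c x * 𝜕 F i x) :=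
      add (fun x hx => (contDiffAt_pd (hc x hx) i).mul (hF x hx))
        (fun x hx => (hc x hx).mul (contDiffAt_pd (hF x hx) i))
        (mul (fun x hx => contDiffAt_pd (hc x hx) i) hF h)
        (ih (fun x hx => contDiffAt_pd (hF x hx) i) (h.partial_deriv hF i))
    refine h1.congr fun x hx => ?_
    filter_upwards [eventually_differentiableAt (hc x hx), eventually_differentiableAt (hF x hx)]
      with y h1 h2 using (pd_mul h1 h2 i).symm

theorem pow_mul {c : R3 → ℝ} (hc : ∀ x ∈ S, ContDiffAt ℝ ∞ c x)
    (hF : ∀ x ∈ S, ContDiffAt ℝ ∞ F x) (hc0 : ∀ x ∈ S, c x = 0) (k : ℕ) :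
    VanishesOn S k (fun x => c x ^ k * F x) := by
  induction k with
  | zero => exact zero_order
  | succ k ih =>
    have := mul_of_eq_zero hc (fun x hx => ((hc x hx).pow k).mul (hF x hx)) hc0 ih
    convert this using 2
    ring

theorem neg (hF : ∀ x ∈ S, ContDiffAt ℝ ∞ F x) (h : VanishesOn S k F) :
    VanishesOn S k (fun x => - F x) := by
  simpa using mul (c := fun _ => -1) (fun _ _ => contDiffAt_const) hF h

theorem sub (hF : ∀ x ∈ S, ContDiffAt ℝ ∞ F x) (hG : ∀ x ∈ S, ContDiffAt ℝ ∞ G x)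
    (h : VanishesOn S k F) (h' : VanishesOn S k G) : VanishesOn S k (fun x => F x - G x) := by
  simpa [sub_eq_add_neg] using add hF (fun x hx => (hG x hx).neg) h (h'.neg hG)

theorem sum {ι : Type*} {s : Finset ι} {F : ι → R3 → ℝ}
    (hF : ∀ i ∈ s, ∀ x ∈ S, ContDiffAt ℝ ∞ (F i) x)
    (h : ∀ i ∈ s, VanishesOn S k (F i)) : VanishesOn S k (fun x => ∑ i ∈ s, F i x) := by
  classical
  induction s using Finset.induction with
  | empty => simpa using const_zero
  | insert a s ha ih =>
    simp only [Finset.sum_insert ha]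
    refine add (hF a (Finset.mem_insert_self a s))
      (fun x hx => ContDiffAt.sum fun i hi => hF i (Finset.mem_insert_of_mem hi) x hx)
      (h a (Finset.mem_insert_self a s))
      (ih (fun i hi => hF i (Finset.mem_insert_of_mem hi))
        fun i hi => h i (Finset.mem_insert_of_mem hi))

/-- A function vanishing to order `k` along `S` may be divided by a nonvanishing factor. -/
theorem of_mul {c : R3 → ℝ} (hc : ∀ x ∈ S, ContDiffAt ℝ ∞ c x) (hF : ∀ x ∈ S, ContDiffAt ℝ ∞ F x)
    (hc0 : ∀ x ∈ S, c x ≠ 0) (h : VanishesOn S k (fun x => c x * F x)) : VanishesOn S k F := by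
  have := mul (c := fun x => (c x)⁻¹) (fun x hx => (hc x hx).inv (hc0 x hx))
    (fun x hx => (hc x hx).mul (hF x hx)) h
  refine this.congr fun x hx => ?_
  filter_upwards [(hc x hx).continuousAt.eventually_ne (hc0 x hx)] with y hy
  rw [inv_mul_cancel_left₀ hy]

/-- A function vanishing along the zero set of `ρ` has a differential proportional to `dρ`. -/
theorem exists_fderiv_eq_smul {ρ : R3 → ℝ} {x : R3} (hρ : ContDiffAt ℝ ∞ ρ x)
    (hF : ContDiffAt ℝ ∞ F x) (hρx : ρ x = 0) (hdρ : fderiv ℝ ρ x ≠ 0)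
    (h : ∀ᶠ y in 𝓝 x, ρ y = 0 → F y = 0) : ∃ c : ℝ, fderiv ℝ F x = c • fderiv ℝ ρ x := by
  have hFx : F x = 0 := h.self_of_nhds hρx
  have hext : IsLocalExtrOn F {y | ρ y = ρ x} x := by
    refine Or.inl ?_
    refine (eventually_nhdsWithin_iff.2 ?_ : ∀ᶠ y in 𝓝[{y | ρ y = ρ x}] x, F x ≤ F y)
    filter_upwards [h] with y hy hyρ
    rw [hFx, hy ((hyρ : ρ y = ρ x).trans hρx)]
  obtain ⟨a, b, hab, he⟩ := hext.exists_multipliers_of_hasStrictFDerivAt_1d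
    (hρ.hasStrictFDerivAt (by simp)) (hF.hasStrictFDerivAt (by simp))
  have hb : b ≠ 0 := by
    rintro rfl
    have ha : a ≠ 0 := by rintro rfl; exact hab rfl
    simp only [zero_smul, add_zero, smul_eq_zero] at he
    exact he.elim ha hdρ
  refine ⟨-(b⁻¹ * a), ?_⟩
  have : fderiv ℝ F x = b⁻¹ • (b • fderiv ℝ F x) := by rw [smul_smul, inv_mul_cancel₀ hb, one_smul]
  rw [this, eq_neg_of_add_eq_zero_right he, smul_neg, smul_smul]
  exact (neg_smul _ _).symm

/-- The vector fields `∂_lρ ∂_j - ∂_jρ ∂_l` are tangent to the level sets of `ρ`, so they preserve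
the order of vanishing along `{ρ = 0}`. -/
theorem tangential {ρ : R3 → ℝ} (hρ : ∀ x ∈ S, ContDiffAt ℝ ∞ ρ x)
    (hS : ∀ x ∈ S, ρ x = 0 ∧ fderiv ℝ ρ x ≠ 0 ∧ ∀ᶠ y in 𝓝 x, ρ y = 0 → y ∈ S)
    (hF : ∀ x ∈ S, ContDiffAt ℝ ∞ F x) (h : VanishesOn S k F) (j l : Fin 3) :
    VanishesOn S k (fun x => 𝜕 ρ l x * 𝜕 F j x - 𝜕 ρ j x * 𝜕 F l x) := by
  induction k generalizing F with
  | zero => exact zero_order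
  | succ k ih =>
    have hρ' := fun i x hx => contDiffAt_pd (hρ x hx) i
    have hρ'' := fun i j x hx => contDiffAt_pd (hρ' i x hx) j
    have hF' := fun i x hx => contDiffAt_pd (hF x hx) i
    have hF'' := fun i j x hx => contDiffAt_pd (hF' i x hx) j
    refine (succ_iff fun x hx => ((hρ' l x hx).mul (hF' j x hx)).sub
      ((hρ' j x hx).mul (hF' l x hx))).2 ⟨fun x hx => ?_, fun i => ?_⟩
    · obtain ⟨h0, h1, h2⟩ := hS x hx
      obtain ⟨c, hc⟩ := exists_fderiv_eq_smul (hρ x hx) (hF x hx) h0 h1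
        (h2.mono fun y hy hy0 => h.eq_zero (hy hy0))
      simp only [pd_univ, hc, smul_apply, smul_eq_mul]
      ring
    · have hT := ih (hF' i) (h.partial_deriv hF i)
      have h1 := mul (hρ'' l i) (hF' j) (h.partial_deriv hF j)
      have h2 := mul (hρ'' j i) (hF' l) (h.partial_deriv hF l)
      have s1 := fun x hx => (hρ'' l i x hx).mul (hF' j x hx)
      have s2 := fun x hx => (hρ'' j i x hx).mul (hF' l x hx)
      have s3 := fun x hx => ((hρ' l x hx).mul (hF'' i j x hx)).sub
        ((hρ' j x hx).mul (hF'' i l x hx))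
      refine (add s3 (fun x hx => (s1 x hx).sub (s2 x hx)) hT (sub s1 s2 h1 h2)).congr
        fun x hx => ?_
      have e1 : ∀ {G : R3 → ℝ}, ContDiffAt ℝ ∞ G x → ∀ a b,
          ∀ᶠ y in 𝓝 x, 𝜕 (𝜕 G a) b y = 𝜕 (𝜕 G b) a y := by
        intro G hG a b
        exact (eventually_contDiffAt hG 2).mono fun y hy => pd_comm hy a b
      filter_upwards [eventually_differentiableAt (hρ' l x hx),
        eventually_differentiableAt (hρ' j x hx), eventually_differentiableAt (hF' l x hx),
        eventually_differentiableAt (hF' j x hx), e1 (hF x hx) j i, e1 (hF x hx) l i]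
        with y a1 a2 a3 a4 a5 a6
      rw [pd_sub (a1.fun_mul a4) (a2.fun_mul a3), pd_mul a1 a4, pd_mul a2 a3, a5, a6]
      ring

/-- Along `{ρ = 0}`, the order of vanishing is decided by the derivative along one transversal
vector field `N`: all other first derivatives are tangential up to a multiple of it. -/
theorem succ_of_transversal {ρ : R3 → ℝ} {N : Fin 3 → R3 → ℝ}
    (hρ : ∀ x ∈ S, ContDiffAt ℝ ∞ ρ x)
    (hS : ∀ x ∈ S, ρ x = 0 ∧ fderiv ℝ ρ x ≠ 0 ∧ ∀ᶠ y in 𝓝 x, ρ y = 0 → y ∈ S)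
    (hN : ∀ l, ∀ x ∈ S, ContDiffAt ℝ ∞ (N l) x) (hNρ : ∀ x ∈ S, ∑ l, N l x * 𝜕 ρ l x ≠ 0)
    (hF : ∀ x ∈ S, ContDiffAt ℝ ∞ F x) (h : VanishesOn S (k + 1) F)
    (h' : VanishesOn S (k + 1) (fun x => ∑ l, N l x * 𝜕 F l x)) : VanishesOn S (k + 2) F := by
  have hρ' := fun i x hx => contDiffAt_pd (hρ x hx) i
  have hF' := fun i x hx => contDiffAt_pd (hF x hx) i
  refine (succ_iff hF).2 ⟨fun x hx => h.eq_zero hx, fun j => ?_⟩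
  refine of_mul (c := fun x => ∑ l, N l x * 𝜕 ρ l x)
    (fun x hx => ContDiffAt.sum fun l _ => (hN l x hx).mul (hρ' l x hx)) (hF' j) hNρ ?_
  have hT := fun l => tangential hρ hS hF h j l
  have sT := fun l x hx => ((hρ' l x hx).mul (hF' j x hx)).sub ((hρ' j x hx).mul (hF' l x hx))
  have h1 := sum (s := Finset.univ) (F := fun l x => N l x *
    (𝜕 ρ l x * 𝜕 F j x - 𝜕 ρ j x * 𝜕 F l x)) (fun l _ x hx => (hN l x hx).mul (sT l x hx))
    (fun l _ => mul (hN l) (sT l) (hT l))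
  have s2 := fun x hx => ContDiffAt.sum (s := Finset.univ) (f := fun l x => N l x * 𝜕 F l x)
    (n := ∞) (𝕜 := ℝ) (x := x) fun l _ => (hN l x hx).mul (hF' l x hx)
  have h2 := mul (hρ' j) s2 h'
  have h3 := add (fun x hx => ContDiffAt.sum (s := Finset.univ) fun l _ =>
    (hN l x hx).mul (sT l x hx)) (fun x hx => (hρ' j x hx).mul (s2 x hx)) h1 h2
  convert h3 using 2 with x
  simp only [Fin.sum_univ_three]
  ring

end VanishesOn

/-- Taylor's formula along a segment: if the derivatives of `F` at `y` of order less than `k` in the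
direction `u` vanish, and the `k`-th one is `e`-close to `c` on the segment, then
`F (y + s u)` is `c s ^ k / k!` up to `e s ^ k / k!`. -/
theorem abs_sub_le_of_iteratedFDeriv_segment {F : R3 → ℝ} {y u : R3} {s c e : ℝ} {k : ℕ}
    (hs : 0 ≤ s)
    (hF : ∀ t ∈ Icc 0 s, ContDiffAt ℝ ∞ F (y + t • u))
    (h0 : ∀ j < k, iteratedFDeriv ℝ j F y (fun _ => u) = 0)
    (hk : ∀ t ∈ Icc 0 s, |iteratedFDeriv ℝ k F (y + t • u) (fun _ => u) - c| ≤ e) :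
    |F (y + s • u) - c * s ^ k / k.factorial| ≤ e * s ^ k / k.factorial := by
  have hder : ∀ j : ℕ, ∀ t ∈ Icc 0 s, HasDerivAt
      (fun t : ℝ => iteratedFDeriv ℝ j F (y + t • u) (fun _ => u))
      (iteratedFDeriv ℝ (j + 1) F (y + t • u) (fun _ => u)) t := by
    intro j t ht
    have h1 : DifferentiableAt ℝ (iteratedFDeriv ℝ j F) (y + t • u) :=
      (hF t ht).differentiableAt_iteratedFDeriv (by exact_mod_cast WithTop.coe_lt_top _)
    have h2 : HasDerivAt (fun t : ℝ => y + t • u) u t := by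
      simpa using ((hasDerivAt_id t).smul_const u).const_add y
    have h3 := h1.hasFDerivAt.comp_hasDerivAt t h2
    have h4 := (ContinuousMultilinearMap.apply ℝ (fun _ : Fin j => R3) ℝ
      (fun _ => u)).hasFDerivAt.comp_hasDerivAt t h3
    exact h4
  have key : ∀ m ≤ k, ∀ t ∈ Icc 0 s, ‖iteratedFDeriv ℝ (k - m) F (y + t • u) (fun _ => u)
      - c * t ^ m / m.factorial‖ ≤ e * t ^ m / m.factorial := by
    intro m
    induction m with
    | zero => intro _ t ht; simpa using hk t ht
    | succ m ih =>
      intro hm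
      have hB : ∀ a : ℝ, ∀ t : ℝ, HasDerivAt (fun t : ℝ => a * t ^ (m + 1) / (m + 1).factorial)
          (a * t ^ m / m.factorial) t := by
        intro a t
        have := ((hasDerivAt_pow (m + 1) t).const_mul a).div_const ((m + 1).factorial : ℝ)
        have e : a * t ^ m / (m.factorial : ℝ)
            = a * (((m + 1 : ℕ) : ℝ) * t ^ (m + 1 - 1)) / ((m + 1).factorial : ℝ) := by
          rw [Nat.factorial_succ, Nat.add_sub_cancel]
          push_cast
          field_simp
        rw [e]
        exact this
      have hd : ∀ t ∈ Icc 0 s, HasDerivAt (fun t : ℝ =>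
          iteratedFDeriv ℝ (k - (m + 1)) F (y + t • u) (fun _ => u)
            - c * t ^ (m + 1) / (m + 1).factorial)
          (iteratedFDeriv ℝ (k - m) F (y + t • u) (fun _ => u) - c * t ^ m / m.factorial) t := by
        intro t ht
        have := hder (k - (m + 1)) t ht
        rw [show k - (m + 1) + 1 = k - m by omega] at this
        exact this.sub (hB c t)
      refine image_norm_le_of_norm_deriv_right_le_deriv_boundary
        (fun t ht => (hd t ht).continuousAt.continuousWithinAt)
        (fun t ht => (hd t ⟨ht.1, ht.2.le⟩).hasDerivWithinAt) ?_ (hB e)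
        (fun t ht => ih (by omega) t ⟨ht.1, ht.2.le⟩)
      simp [h0 (k - (m + 1)) (by omega)]
  have := key k le_rfl s ⟨hs, le_rfl⟩
  rw [Nat.sub_self] at this
  simpa using this

namespace VanishesOn

variable {S : Set R3} {k : ℕ} {F : R3 → ℝ}

theorem iteratedFDeriv_mul {z : R3} {c : R3 → ℝ} (hc : ContDiffAt ℝ ∞ c z)
    (hF : ContDiffAt ℝ ∞ F z) (h : VanishesOn {z} k F) :
    iteratedFDeriv ℝ k (fun x => c x * F x) z = c z • iteratedFDeriv ℝ k F z := by
  have hc' : ContDiffAt ℝ ∞ (fun x => c x - c z) z := hc.sub contDiffAt_const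
  have h1 := mul_of_eq_zero (c := fun x => c x - c z) (by simpa using hc') (by simpa using hF)
    (by simp) h
  have e : (fun x => c x * F x) = (fun x => (c x - c z) * F x) + (c z • F) := by
    ext x; simp; ring
  have hk : ((k : ℕ) : WithTop ℕ∞) ≤ ∞ := by exact_mod_cast le_top
  rw [e, iteratedFDeriv_add_apply (g := c z • F) ((hc'.mul hF).of_le hk)
      ((hF.const_smul (c z)).of_le hk),
    h1 k (Nat.lt_succ_self k) z rfl, zero_add, iteratedFDeriv_const_smul_apply (hF.of_le hk)]

/-- If `F` vanishes to order `k` along `{ρ = 0}` and its `k`-th derivative in one constant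
transversal direction vanishes there, then `F` vanishes to order `k + 1`. -/
theorem succ_of_iteratedFDeriv {ρ : R3 → ℝ} {u : R3}
    (hρ : ∀ x ∈ S, ContDiffAt ℝ ∞ ρ x)
    (hS : ∀ x ∈ S, ρ x = 0 ∧ fderiv ℝ ρ x ≠ 0 ∧ ∀ᶠ y in 𝓝 x, ρ y = 0 → y ∈ S)
    (hu : ∀ x ∈ S, fderiv ℝ ρ x u ≠ 0) (hF : ∀ x ∈ S, ContDiffAt ℝ ∞ F x)
    (h : VanishesOn S k F) (h' : ∀ x ∈ S, iteratedFDeriv ℝ k F x (fun _ => u) = 0) :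
    VanishesOn S (k + 1) F := by
  induction k generalizing F with
  | zero =>
    refine (succ_iff hF).2 ⟨fun x hx => by simpa using h' x hx, fun i => zero_order⟩
  | succ k ih =>
    have e : (fun x => ∑ l, u l * 𝜕 F l x) = ContinuousLinearMap.apply ℝ ℝ u ∘ fderiv ℝ F := by
      ext x; simp [fderiv_eq_sum]
    have sG : ∀ x ∈ S, ContDiffAt ℝ ∞ (fun x => ∑ l, u l * 𝜕 F l x) x := fun x hx =>
      ContDiffAt.sum fun l _ => contDiffAt_const.mul (contDiffAt_pd (hF x hx) l)
    refine succ_of_transversal (N := fun l _ => u l) hρ hS (fun l x hx => contDiffAt_const)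
      (fun x hx => by rw [← fderiv_eq_sum]; exact hu x hx) hF h (ih sG ?_ ?_)
    · exact sum (F := fun l x => u l * 𝜕 F l x)
        (fun l _ x hx => contDiffAt_const.mul (contDiffAt_pd (hF x hx) l))
        fun l _ => mul (fun x hx => contDiffAt_const) (fun x hx => contDiffAt_pd (hF x hx) l)
          (h.partial_deriv hF l)
    · intro x hx
      have h1 : ContDiffAt ℝ ∞ (fderiv ℝ F) x := (hF x hx).fderiv_right (by simp)
      rw [e, ContinuousLinearMap.iteratedFDeriv_comp_left (n := ∞) _ h1
        (by exact_mod_cast le_top)]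
      have := h' x hx
      rw [iteratedFDeriv_succ_apply_right] at this
      change iteratedFDeriv ℝ k (fderiv ℝ F) x (fun _ => u) u = 0
      exact this

end VanishesOn

/-- Quasi-analyticity: a function with factorial derivative bounds all of whose derivatives vanish
at a point vanishes near that point. -/
theorem eq_zero_of_vanishesOn {F : R3 → ℝ} {y x : R3} {r C A : ℝ} (hA : 0 ≤ A)
    (hF : ∀ z ∈ Metric.ball y r, ContDiffAt ℝ ∞ F z)
    (hb : ∀ z ∈ Metric.ball y r, ∀ n, ‖iteratedFDeriv ℝ n F z‖ ≤ C * A ^ n * n.factorial)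
    (h : ∀ k, VanishesOn {y} k F) (hx : x ∈ Metric.ball y r) (hAx : A * ‖x - y‖ < 1) : F x = 0 := by
  have hseg : ∀ t ∈ Icc (0 : ℝ) 1, y + t • (x - y) ∈ Metric.ball y r := by
    intro t ht
    rw [mem_ball_iff_norm, add_sub_cancel_left, norm_smul, Real.norm_of_nonneg ht.1]
    rw [mem_ball_iff_norm] at hx
    exact (mul_le_of_le_one_left (norm_nonneg _) ht.2).trans_lt hx
  have key : ∀ k : ℕ, |F x| ≤ C * (A * ‖x - y‖) ^ k := by
    intro k
    have := abs_sub_le_of_iteratedFDeriv_segment (F := F) (y := y) (u := x - y) (s := 1) (c := 0)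
      (e := C * A ^ k * k.factorial * ‖x - y‖ ^ k) (k := k) zero_le_one
      (fun t ht => hF _ (hseg t ht))
      (fun j hj => by rw [h (j + 1) j (Nat.lt_succ_self j) y rfl]; simp) (fun t ht => by
        rw [sub_zero]
        have h5 := (iteratedFDeriv ℝ k F (y + t • (x - y))).le_opNorm (fun _ => x - y)
        simp only [Finset.prod_const, Finset.card_univ, Fintype.card_fin] at h5
        exact h5.trans (mul_le_mul_of_nonneg_right (hb _ (hseg t ht) k) (by positivity)))
    have hk : (k.factorial : ℝ) ≠ 0 := by positivity
    simp only [one_smul, add_sub_cancel, zero_div, sub_zero, one_pow, mul_one] at this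
    calc |F x| ≤ _ := this
      _ = C * (A * ‖x - y‖) ^ k := by rw [mul_pow]; field_simp
  have hlim : Tendsto (fun k : ℕ => C * (A * ‖x - y‖) ^ k) atTop (𝓝 (C * 0)) :=
    (tendsto_pow_atTop_nhds_zero_of_lt_one (by positivity) hAx).const_mul C
  rw [mul_zero] at hlim
  exact abs_nonpos_iff.1 (ge_of_tendsto' hlim key)

/-! ### The domain and its boundary -/

/-- A cut-off function: smooth, compactly supported in a given neighbourhood of a compact set,
and equal to `1` near that set. -/
theorem exists_cutoff {K O : Set R3} (hK : IsCompact K) (hO : IsOpen O) (hKO : K ⊆ O) :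
    ∃ χ : R3 → ℝ, ContDiff ℝ ∞ χ ∧ HasCompactSupport χ ∧ tsupport χ ⊆ O ∧
      ∀ᶠ x in 𝓝ˢ K, χ x = 1 := by
  obtain ⟨L, hL, hKL, hLO⟩ := exists_compact_between hK hO hKO
  obtain ⟨χ, h1, h0, -⟩ := exists_contMDiffMap_one_nhds_of_subset_interior
    (modelWithCornersSelf ℝ R3) (n := ⊤) hK.isClosed hKL
  have hsupp : tsupport χ ⊆ L := closure_minimal (fun x hx => by
    by_contra hxL; exact hx (h0 x hxL)) hL.isClosed
  exact ⟨χ, χ.contMDiff.contDiff, HasCompactSupport.intro hL h0, hsupp.trans hLO, h1⟩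

/-- A function smooth on an open set, multiplied by a cut-off supported there, is smooth. -/
theorem contDiff_cutoff_mul {O : Set R3} {χ F : R3 → ℝ} (hχ : ContDiff ℝ ∞ χ) (hO : tsupport χ ⊆ O)
    (hF : ∀ x ∈ O, ContDiffAt ℝ ∞ F x) : ContDiff ℝ ∞ (fun x => χ x * F x) := by
  refine contDiff_iff_contDiffAt.2 fun x => ?_
  by_cases hx : x ∈ tsupport χ
  · exact hχ.contDiffAt.mul (hF x (hO hx))
  · refine (contDiffAt_const (c := (0 : ℝ))).congr_of_eventuallyEq ?_
    filter_upwards [notMem_tsupport_iff_eventuallyEq.1 hx] with z hz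
    simp [hz]

namespace IsDefiningFunction

variable {M U : Set R3} {x : R3} {ρ : R3 → ℝ} {n : WithTop ℕ∞}

theorem contDiffAt (h : IsDefiningFunction n M x U ρ) {y : R3} (hy : y ∈ U) : ContDiffAt ℝ n ρ y :=
  h.contDiffOn.contDiffAt (h.isOpen.mem_nhds hy)

theorem mem_iff (h : IsDefiningFunction n M x U ρ) {y : R3} (hy : y ∈ U) : y ∈ M ↔ 0 ≤ ρ y := by
  have := h.inter_eq
  constructor
  · intro hM
    exact (this.subset ⟨hM, hy⟩).2
  · intro h0
    exact (this.symm.subset ⟨hy, h0⟩).1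

theorem mem_interior (h : IsDefiningFunction n M x U ρ) {y : R3} (hy : y ∈ U)
    (h0 : 0 < ρ y) : y ∈ interior M := by
  rw [mem_interior_iff_mem_nhds]
  filter_upwards [h.isOpen.mem_nhds hy, (h.contDiffAt hy).continuousAt.eventually_const_lt h0]
    with z hz hz0 using (h.mem_iff hz).2 (le_of_lt hz0)

theorem eq_zero_of_mem_frontier (h : IsDefiningFunction n M x U ρ) (hM : IsClosed M)
    {y : R3} (hy : y ∈ U) (hyM : y ∈ frontier M) : ρ y = 0 := by
  have h0 : 0 ≤ ρ y := (h.mem_iff hy).1 (hM.frontier_subset hyM)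
  by_contra hne
  exact hyM.2 (h.mem_interior hy (lt_of_le_of_ne h0 (Ne.symm hne)))

theorem mem_frontier_of_eq_zero (h : IsDefiningFunction n M x U ρ) {y : R3} (hy : y ∈ U)
    (h0 : ρ y = 0) (hd : fderiv ℝ ρ y ≠ 0) : y ∈ frontier M := by
  refine ⟨subset_closure ((h.mem_iff hy).2 h0.ge), fun hi => hd ?_⟩
  have : IsLocalMin ρ y := by
    filter_upwards [mem_interior_iff_mem_nhds.1 hi, h.isOpen.mem_nhds hy] with z hz hzU
    rw [h0]
    exact (h.mem_iff hzU).1 hz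
  exact this.fderiv_eq_zero

/-- At a boundary point, `M` contains a solid cone. -/
theorem uniqueDiffWithinAt (h : IsDefiningFunction n M x U ρ) (hn : n ≠ 0) :
    UniqueDiffWithinAt ℝ M x := by
  obtain ⟨ξ, hξ⟩ : ∃ ξ, 0 < fderiv ℝ ρ x ξ := by
    obtain ⟨ξ, hξ⟩ : ∃ ξ, fderiv ℝ ρ x ξ ≠ 0 := by
      by_contra! hc
      exact h.fderiv_ne (ContinuousLinearMap.ext hc)
    rcases lt_or_gt_of_ne hξ with h1 | h1
    · exact ⟨-ξ, by simpa using h1⟩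
    · exact ⟨ξ, h1⟩
  have hξ0 : ξ ≠ 0 := by rintro rfl; simp at hξ
  have hξn : 0 < ‖ξ‖ := norm_pos_iff.2 hξ0
  set c := fderiv ℝ ρ x ξ / (2 * ‖ξ‖) with hc
  have hcpos : 0 < c := by positivity
  have hd := ((h.contDiffAt h.mem).differentiableAt hn).hasFDerivAt
  have hlo := hd.isLittleO.def hcpos
  obtain ⟨r, hr, hball⟩ := Metric.mem_nhds_iff.1
    (Filter.inter_mem hlo (h.isOpen.mem_nhds h.mem))
  set s : Set R3 := {y | c * ‖y - x‖ ≤ fderiv ℝ ρ x (y - x)} ∩ Metric.ball x r with hs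
  have hsM : s ⊆ M := by
    rintro y ⟨hy1, hy2⟩
    obtain ⟨hy3, hy4⟩ := hball hy2
    refine (h.mem_iff hy4).2 ?_
    simp only [mem_ofPred_eq, h.eq_zero, sub_zero, Real.norm_eq_abs] at hy3 hy1
    have := (abs_le.1 hy3).1
    linarith
  have hconv : Convex ℝ s := by
    refine Convex.inter ?_ (convex_ball x r)
    intro y hy z hz a b ha hb hab
    simp only [mem_ofPred_eq] at hy hz ⊢
    have e : a • y + b • z - x = a • (y - x) + b • (z - x) := by
      have : x = (a + b) • x := by rw [hab, one_smul]
      nth_rewrite 1 [this]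
      module
    rw [e, map_add, map_smul, map_smul, smul_eq_mul, smul_eq_mul]
    have h1 : ‖a • (y - x) + b • (z - x)‖ ≤ a * ‖y - x‖ + b * ‖z - x‖ := by
      refine (norm_add_le _ _).trans (le_of_eq ?_)
      rw [norm_smul, norm_smul, Real.norm_of_nonneg ha, Real.norm_of_nonneg hb]
    nlinarith [mul_le_mul_of_nonneg_left h1 hcpos.le, mul_le_mul_of_nonneg_left hy ha,
      mul_le_mul_of_nonneg_left hz hb]
  have hint : (interior s).Nonempty := by
    set t := r / (2 * ‖ξ‖) with ht
    have htpos : 0 < t := by positivity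
    refine ⟨x + t • ξ, ?_⟩
    rw [mem_interior_iff_mem_nhds]
    refine Filter.inter_mem ?_ (Metric.isOpen_ball.mem_nhds ?_)
    · have hcont : Continuous fun y => fderiv ℝ ρ x (y - x) - c * ‖y - x‖ := by fun_prop
      have hpos : 0 < fderiv ℝ ρ x (x + t • ξ - x) - c * ‖x + t • ξ - x‖ := by
        rw [add_sub_cancel_left, map_smul, norm_smul, Real.norm_of_nonneg htpos.le, smul_eq_mul]
        have : c * ‖ξ‖ = fderiv ℝ ρ x ξ / 2 := by rw [hc]; field_simp
        have : c * (t * ‖ξ‖) = t * (fderiv ℝ ρ x ξ / 2) := by rw [← this]; ring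
        rw [this]
        nlinarith [mul_pos htpos hξ]
      filter_upwards [hcont.continuousAt.eventually_const_lt hpos] with y hy
      exact (sub_pos.1 hy).le
    · rw [mem_ball_iff_norm, add_sub_cancel_left, norm_smul, Real.norm_of_nonneg htpos.le, ht]
      have : r / (2 * ‖ξ‖) * ‖ξ‖ = r / 2 := by field_simp
      rw [this]; linarith
  have hx : x ∈ s := ⟨by simp, Metric.mem_ball_self hr⟩
  exact (uniqueDiffWithinAt_convex hconv hint (subset_closure hx)).mono hsM

end IsDefiningFunction

theorem uniqueDiffOn_of_boundary {M : Set R3} (h : HasBoundaryOfClass ∞ M) : UniqueDiffOn ℝ M := by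
  intro x hx
  by_cases hi : x ∈ interior M
  · exact uniqueDiffWithinAt_of_mem_nhds (mem_interior_iff_mem_nhds.1 hi)
  · obtain ⟨U, ρ, hρ⟩ := h x ⟨subset_closure hx, hi⟩
    exact hρ.uniqueDiffWithinAt (by simp)

/-- A compact set with smooth boundary has a global smooth defining function: a sum of local ones
with nonnegative weights, whose differentials at a boundary point all point inward. -/
theorem exists_definingFunction {M : Set R3} (hM : IsCompact M) (h : HasBoundaryOfClass ∞ M) :
    ∃ O ρ, ContDiff ℝ ∞ ρ ∧ ∀ x ∈ frontier M, IsDefiningFunction ∞ M x O ρ := by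
  choose! U ρ hρ using h
  have hK : IsCompact (frontier M) := hM.of_isClosed_subset isClosed_frontier
    hM.isClosed.frontier_subset
  set V : R3 → Set R3 := fun x => U x ∩ {y | fderiv ℝ (ρ x) y ≠ 0} with hV
  have hVn : ∀ x ∈ frontier M, V x ∈ 𝓝 x := by
    intro x hx
    refine Filter.inter_mem ((hρ x hx).isOpen.mem_nhds (hρ x hx).mem) ?_
    have : ContDiffAt ℝ ∞ (fderiv ℝ (ρ x)) x :=
      ((hρ x hx).contDiffAt (hρ x hx).mem).fderiv_right (by simp)
    exact this.continuousAt.eventually_ne (hρ x hx).fderiv_ne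
  have hb : ∀ x, ∃ b : R3 → ℝ, x ∈ frontier M → tsupport b ⊆ V x ∧ ContDiff ℝ ∞ b ∧
      (∀ y, 0 ≤ b y) ∧ b x = 1 := by
    intro x
    by_cases hx : x ∈ frontier M
    · obtain ⟨b, h1, -, h2, h3, h4⟩ := exists_contDiff_tsupport_subset (n := ⊤) (hVn x hx)
      exact ⟨b, fun _ => ⟨h1, h2, fun y => (h3 (mem_range_self y)).1, h4⟩⟩
    · exact ⟨0, fun h => absurd h hx⟩
  choose b hb using hb
  obtain ⟨t, ht, hcov⟩ := hK.elim_nhds_subcover (fun x => {y | x ∈ frontier M → 0 < b x y})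
    (fun x hx => by
      have := ((hb x hx).2.1.continuous.continuousAt (x := x)).eventually_const_lt
        (show (0 : ℝ) < b x x by rw [(hb x hx).2.2.2]; exact one_pos)
      exact this.mono fun y hy _ => hy)
  set O : Set R3 := ⋃ x ∈ t, {y | 0 < b x y} with hO
  have hOopen : IsOpen O := isOpen_biUnion fun x hx =>
    isOpen_lt continuous_const (hb x (ht x hx)).2.1.continuous
  have hKO : frontier M ⊆ O := fun y hy => by
    obtain ⟨x, hx, hxy⟩ := mem_iUnion₂.1 (hcov hy)
    exact mem_iUnion₂.2 ⟨x, hx, hxy (ht x hx)⟩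
  have hpos : ∀ x ∈ t, ∀ y, 0 < b x y → y ∈ V x := fun x hx y hy =>
    (hb x (ht x hx)).1 (subset_tsupport _ (Function.mem_support.2 hy.ne'))
  have hsm : ∀ x ∈ t, ContDiff ℝ ∞ fun y => b x y * ρ x y := fun x hx =>
    contDiff_cutoff_mul (hb x (ht x hx)).2.1 (hb x (ht x hx)).1
      fun y hy => (hρ x (ht x hx)).contDiffAt hy.1
  set r : R3 → ℝ := fun y => ∑ x ∈ t, b x y * ρ x y with hr
  have hr0 : ∀ y ∈ frontier M, ∀ x ∈ t, b x y * ρ x y = 0 := by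
    intro y hy x hx
    rcases (hb x (ht x hx)).2.2.1 y |>.eq_or_lt with h0 | h0
    · rw [← h0, zero_mul]
    · rw [(hρ x (ht x hx)).eq_zero_of_mem_frontier hM.isClosed (hpos x hx y h0).1 hy,
        mul_zero]
  refine ⟨O, r, ContDiff.sum fun x hx => hsm x hx, fun y hy => ⟨hOopen, hKO hy,
    (ContDiff.sum fun x hx => hsm x hx).contDiffOn, ?_, Finset.sum_eq_zero (hr0 y hy), ?_⟩⟩
  · ext z
    simp only [mem_inter_iff, mem_ofPred_eq]
    rw [and_comm]
    refine and_congr_right fun hz => ?_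
    constructor
    · intro hzM
      refine Finset.sum_nonneg fun x hx => ?_
      rcases (hb x (ht x hx)).2.2.1 z |>.eq_or_lt with h0 | h0
      · rw [← h0, zero_mul]
      · exact mul_nonneg h0.le (((hρ x (ht x hx)).mem_iff (hpos x hx z h0).1).1 hzM)
    · intro hz0
      by_contra hzM
      obtain ⟨x₀, hx₀, hbx₀⟩ := mem_iUnion₂.1 hz
      refine absurd hz0 (not_le.2 ?_)
      have hneg : ∀ x ∈ t, 0 < b x z → ρ x z < 0 := fun x hx h0 => by
        by_contra hc
        exact hzM (((hρ x (ht x hx)).mem_iff (hpos x hx z h0).1).2 (not_lt.1 hc))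
      refine Finset.sum_neg' (fun x hx => ?_) ⟨x₀, hx₀, mul_neg_of_pos_of_neg hbx₀
        (hneg x₀ hx₀ hbx₀)⟩
      rcases (hb x (ht x hx)).2.2.1 z |>.eq_or_lt with h0 | h0
      · rw [← h0, zero_mul]
      · exact (mul_neg_of_pos_of_neg h0 (hneg x hx h0)).le
  · -- a direction in which one of the local defining functions increases
    obtain ⟨x₀, hx₀, hbx₀⟩ := mem_iUnion₂.1 (hKO hy)
    obtain ⟨ξ, hξ⟩ : ∃ ξ, 0 < fderiv ℝ (ρ x₀) y ξ := by
      obtain ⟨ξ, hξ⟩ : ∃ ξ, fderiv ℝ (ρ x₀) y ξ ≠ 0 := by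
        by_contra! hc
        exact (hpos x₀ hx₀ y hbx₀).2 (ContinuousLinearMap.ext hc)
      rcases lt_or_gt_of_ne hξ with h1 | h1
      · exact ⟨-ξ, by simpa using h1⟩
      · exact ⟨ξ, h1⟩
    have hρy : ∀ x ∈ t, 0 < b x y → ρ x y = 0 := fun x hx h0 =>
      (hρ x (ht x hx)).eq_zero_of_mem_frontier hM.isClosed (hpos x hx y h0).1 hy
    have hline : Tendsto (fun s : ℝ => y + s • ξ) (𝓝 0) (𝓝 y) := by
      have : Continuous fun s : ℝ => y + s • ξ := by fun_prop
      simpa using this.tendsto 0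
    have hlineD : ∀ x ∈ t, 0 < b x y →
        HasDerivAt (fun s : ℝ => ρ x (y + s • ξ)) (fderiv ℝ (ρ x) y ξ) 0 := by
      intro x hx h0
      have h1 : HasFDerivAt (ρ x) (fderiv ℝ (ρ x) y) (y + (0 : ℝ) • ξ) := by
        simpa using (((hρ x (ht x hx)).contDiffAt (hpos x hx y h0).1).differentiableAt
          (by simp)).hasFDerivAt
      have h2 : HasDerivAt (fun s : ℝ => y + s • ξ) ξ 0 := by
        simpa using ((hasDerivAt_id (0 : ℝ)).smul_const ξ).const_add y
      exact h1.comp_hasDerivAt 0 h2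
    have hinM : ∀ᶠ s in 𝓝[>] (0 : ℝ), y + s • ξ ∈ M := by
      have h1 := (hlineD x₀ hx₀ hbx₀).tendsto_slope
      have h2 : ∀ᶠ s in 𝓝[≠] (0 : ℝ), 0 < slope (fun s : ℝ => ρ x₀ (y + s • ξ)) 0 s :=
        h1.eventually_const_lt hξ
      have h3 : ∀ᶠ s in 𝓝 (0 : ℝ), y + s • ξ ∈ U x₀ :=
        hline.eventually ((hρ x₀ (ht x₀ hx₀)).isOpen.mem_nhds (hpos x₀ hx₀ y hbx₀).1)
      filter_upwards [nhdsWithin_mono 0 (fun s hs => ne_of_gt hs) h2,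
        nhdsWithin_le_nhds h3, self_mem_nhdsWithin] with s hs1 hs2 hs3
      refine ((hρ x₀ (ht x₀ hx₀)).mem_iff hs2).2 ?_
      rw [slope_def_field, zero_smul, add_zero, hρy x₀ hx₀ hbx₀, sub_zero, sub_zero] at hs1
      have hs3' : (0 : ℝ) < s := hs3
      exact (div_pos_iff_of_pos_right hs3').1 hs1 |>.le
    have hnn : ∀ x ∈ t, 0 < b x y → 0 ≤ fderiv ℝ (ρ x) y ξ := by
      intro x hx h0
      have h1 := ((hlineD x hx h0).tendsto_slope).mono_left
        (nhdsWithin_mono 0 (fun s (hs : s ∈ Ioi (0 : ℝ)) => ne_of_gt hs))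
      refine ge_of_tendsto h1 ?_
      have h3 : ∀ᶠ s in 𝓝 (0 : ℝ), y + s • ξ ∈ U x :=
        hline.eventually ((hρ x (ht x hx)).isOpen.mem_nhds (hpos x hx y h0).1)
      filter_upwards [hinM, nhdsWithin_le_nhds h3, self_mem_nhdsWithin] with s hs1 hs2 hs3
      rw [slope_def_field, zero_smul, add_zero, hρy x hx h0, sub_zero, sub_zero]
      exact div_nonneg (((hρ x (ht x hx)).mem_iff hs2).1 hs1) (le_of_lt hs3)
    have hterm : ∀ x ∈ t, fderiv ℝ (fun z => b x z * ρ x z) y ξ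
        = b x y * fderiv ℝ (ρ x) y ξ := by
      intro x hx
      rcases (hb x (ht x hx)).2.2.1 y |>.eq_or_lt with h0 | h0
      · rw [← h0, zero_mul]
        by_cases hys : y ∈ tsupport (b x)
        · have hyU : y ∈ U x := ((hb x (ht x hx)).1 hys).1
          rw [fderiv_fun_mul ((hb x (ht x hx)).2.1.differentiable (by simp) y)
            (((hρ x (ht x hx)).contDiffAt hyU).differentiableAt (by simp))]
          simp [← h0, (hρ x (ht x hx)).eq_zero_of_mem_frontier hM.isClosed hyU hy]
        · have : (fun z => b x z * ρ x z) =ᶠ[𝓝 y] fun _ => 0 := by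
            filter_upwards [notMem_tsupport_iff_eventuallyEq.1 hys] with z hz
            simp [hz]
          rw [this.fderiv_eq]
          simp
      · rw [fderiv_fun_mul ((hb x (ht x hx)).2.1.differentiable (by simp) y)
            (((hρ x (ht x hx)).contDiffAt (hpos x hx y h0).1).differentiableAt (by simp))]
        simp [hρy x hx h0]
    have hpos' : 0 < fderiv ℝ r y ξ := by
      have e : fderiv ℝ r y = ∑ x ∈ t, fderiv ℝ (fun z => b x z * ρ x z) y :=
        fderiv_fun_sum fun x hx => (hsm x hx).differentiable (by simp) y
      rw [e, sum_apply]
      refine Finset.sum_pos' (fun x hx => ?_) ⟨x₀, hx₀, ?_⟩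
      · rw [hterm x hx]
        rcases (hb x (ht x hx)).2.2.1 y |>.eq_or_lt with h0 | h0
        · rw [← h0, zero_mul]
        · exact mul_nonneg h0.le (hnn x hx h0)
      · rw [hterm x₀ hx₀]
        exact mul_pos hbx₀ hξ
    intro h0
    rw [h0] at hpos'
    simp at hpos'

/-- A smooth function vanishing on the part of `M` in an open set vanishes there to all orders. -/
theorem vanishesOn_of_eqOn_zero {M O : Set R3} {F : R3 → ℝ} (hM : UniqueDiffOn ℝ M) (hO : IsOpen O)
    (hF : ∀ x ∈ M ∩ O, ContDiffAt ℝ ∞ F x) (h : ∀ x ∈ M ∩ O, F x = 0) (k : ℕ) :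
    VanishesOn (M ∩ O) k F := by
  intro n _ x hx
  rw [← iteratedFDerivWithin_eq_iteratedFDeriv (hM.inter hO)
    ((hF x hx).of_le (by exact_mod_cast le_top)) hx,
    iteratedFDerivWithin_congr (f := fun _ => (0 : ℝ)) h hx]
  simp

/-- On `M`, a partial derivative may be computed with any extension. -/
theorem pd_eq_of_eqOn {M O : Set R3} {F G : R3 → ℝ} {x : R3} (hM : UniqueDiffOn ℝ M) (hO : IsOpen O)
    (hx : x ∈ M ∩ O) (hG : DifferentiableAt ℝ G x) (h : EqOn F G (M ∩ O)) (i : Fin 3) :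
    pd M F i x = 𝜕 G i x := by
  have h1 : fderivWithin ℝ F M x = fderivWithin ℝ G M x := by
    rw [← fderivWithin_inter (hO.mem_nhds hx.2), ← fderivWithin_inter (f := G) (hO.mem_nhds hx.2)]
    exact fderivWithin_congr h (h hx)
  rw [pd_univ, pd, h1, fderivWithin_eq_fderiv (hM x hx.1) hG]

theorem christoffel_eq_of_eqOn {M O : Set R3} {g G : TensorField} {x : R3} (hM : UniqueDiffOn ℝ M)
    (hO : IsOpen O) (hx : x ∈ M ∩ O) (hG : ∀ i j, DifferentiableAt ℝ (fun y => G y i j) x)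
    (h : EqOn g G (M ∩ O)) (k i j : Fin 3) :
    christoffel M g x k i j = christoffel univ G x k i j := by
  have e : ∀ a b c, pd M (fun y => g y a b) c x = 𝜕 (fun y => G y a b) c x := fun a b c =>
    pd_eq_of_eqOn hM hO hx (hG a b) (fun y hy => by simp only [h hy]) c
  simp only [christoffel, e, h hx]

theorem dB_eq_of_eqOn {M O : Set R3} {g G : TensorField} {v w : CovectorField} {x : R3}
    (hM : UniqueDiffOn ℝ M) (hO : IsOpen O) (hx : x ∈ M ∩ O)
    (hG : ∀ i j, DifferentiableAt ℝ (fun y => G y i j) x)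
    (hw : ∀ i, DifferentiableAt ℝ (fun y => w y i) x) (h : EqOn g G (M ∩ O))
    (hv : EqOn v w (M ∩ O)) (i j : Fin 3) : dB M g v x i j = dB univ G w x i j := by
  have e : covDeriv M g v x = covDeriv univ G w x := by
    ext a b
    simp only [covDeriv, christoffel_eq_of_eqOn hM hO hx hG h, hv hx,
      pd_eq_of_eqOn (F := fun y => v y a) hM hO hx (hw a) (fun y hy => by simp only [hv hy])]
  simp only [dB, traceFreePart, trace, e, h hx]

/-! ### First order operators and the symbol of `d^𝓑` -/

theorem contDiffAt_pd' {n : WithTop ℕ∞} (hn : n + 1 ≤ n) {F : R3 → ℝ} {x : R3}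
    (hF : ContDiffAt ℝ n F x) (i : Fin 3) : ContDiffAt ℝ n (𝜕 F i) x := by
  rw [pd_univ_eq_comp]
  exact (ContinuousLinearMap.contDiff _).contDiffAt.comp x (hF.fderiv_right hn)

theorem contDiffAt_matrix_inv {n : WithTop ℕ∞} {A : R3 → Matrix (Fin 3) (Fin 3) ℝ} {x : R3}
    (hA : ∀ i j, ContDiffAt ℝ n (fun y => A y i j) x) (hdet : (A x).det ≠ 0) (i j : Fin 3) :
    ContDiffAt ℝ n (fun y => (A y)⁻¹ i j) x := by
  have hd : ContDiffAt ℝ n (fun y => (A y).det) x := by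
    simp only [Matrix.det_fin_three]
    fun_prop
  have ha : ContDiffAt ℝ n (fun y => (A y).adjugate i j) x := by
    simp only [Matrix.adjugate_fin_three]
    fin_cases i <;> fin_cases j <;> simp <;> fun_prop
  have e : (fun y => (A y)⁻¹ i j) = fun y => ((A y).det)⁻¹ * (A y).adjugate i j := by
    ext y
    rw [Matrix.inv_def, Ring.inverse_eq_inv', Matrix.smul_apply, smul_eq_mul]
  rw [e]
  exact (hd.inv hdet).mul ha

theorem contDiffAt_christoffel {n : WithTop ℕ∞} (hn : n + 1 ≤ n) {g : TensorField} {x : R3}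
    (hg : ∀ i j, ContDiffAt ℝ n (fun y => g y i j) x) (hdet : (g x).det ≠ 0) (k i j : Fin 3) :
    ContDiffAt ℝ n (fun y => christoffel univ g y k i j) x := by
  unfold christoffel
  refine contDiffAt_const.mul (ContDiffAt.sum fun l _ => ?_)
  exact (contDiffAt_matrix_inv hg hdet k l).mul
    (((contDiffAt_pd' hn (hg j l) i).add (contDiffAt_pd' hn (hg i l) j)).sub
      (contDiffAt_pd' hn (hg i j) l))

/-- The first order operator `v ↦ p^{lm} ∂_m v_l + q^l v_l` on covector fields. -/
noncomputable def firstOrderOp (p : Fin 3 → Fin 3 → R3 → ℝ) (q : Fin 3 → R3 → ℝ)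
    (v : CovectorField) : R3 → ℝ :=
  fun x => ∑ l, ∑ m, p l m x * 𝜕 (fun y => v y l) m x + ∑ l, q l x * v x l

section firstOrderOp

variable {p : Fin 3 → Fin 3 → R3 → ℝ} {q : Fin 3 → R3 → ℝ} {v w : CovectorField} {x : R3}

theorem firstOrderOp_sub (hv : ∀ l, DifferentiableAt ℝ (fun y => v y l) x)
    (hw : ∀ l, DifferentiableAt ℝ (fun y => w y l) x) :
    firstOrderOp p q (fun y i => v y i - w y i) x =
      firstOrderOp p q v x - firstOrderOp p q w x := by
  simp only [firstOrderOp, pd_sub (hv _) (hw _), mul_sub, Finset.sum_sub_distrib]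
  ring

theorem firstOrderOp_mul {c : R3 → ℝ} (hc : DifferentiableAt ℝ c x)
    (hv : ∀ l, DifferentiableAt ℝ (fun y => v y l) x) :
    firstOrderOp p q (fun y i => c y * v y i) x = c x * firstOrderOp p q v x
      + ∑ l, (∑ m, p l m x * 𝜕 c m x) * v x l := by
  simp only [firstOrderOp, pd_mul hc (hv _), mul_add, Finset.sum_add_distrib, Finset.mul_sum,
    Finset.sum_mul]
  have : ∀ l m, p l m x * (𝜕 c m x * v x l) = p l m x * 𝜕 c m x * v x l := fun l m => by ring
  simp only [this]
  have h2 : ∀ l m, p l m x * (c x * 𝜕 (fun y => v y l) m x)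
      = c x * (p l m x * 𝜕 (fun y => v y l) m x) := fun l m => by ring
  have h3 : ∀ l, q l x * (c x * v x l) = c x * (q l x * v x l) := fun l => by ring
  simp only [h2, h3]
  ring

theorem firstOrderOp_congr (h : ∀ l, (fun y => v y l) =ᶠ[𝓝 x] fun y => w y l) :
    firstOrderOp p q v x = firstOrderOp p q w x := by
  simp only [firstOrderOp, pd_congr (h _), fun l => (h l).eq_of_nhds]

theorem contDiffAt_firstOrderOp {n : WithTop ℕ∞} (hn : n + 1 ≤ n)
    (hp : ∀ l m, ContDiffAt ℝ n (p l m) x) (hq : ∀ l, ContDiffAt ℝ n (q l) x)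
    (hv : ∀ l, ContDiffAt ℝ n (fun y => v y l) x) : ContDiffAt ℝ n (firstOrderOp p q v) x :=
  (ContDiffAt.sum fun l _ => ContDiffAt.sum fun m _ =>
    (hp l m).mul (contDiffAt_pd' hn (hv l) m)).add
    (ContDiffAt.sum fun l _ => (hq l).mul (hv l))

theorem vanishesOn_firstOrderOp {S : Set R3} {k : ℕ}
    (hp : ∀ l m, ∀ x ∈ S, ContDiffAt ℝ ∞ (p l m) x) (hq : ∀ l, ∀ x ∈ S, ContDiffAt ℝ ∞ (q l) x)
    (hv : ∀ l, ∀ x ∈ S, ContDiffAt ℝ ∞ (fun y => v y l) x)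
    (h : ∀ l, VanishesOn S (k + 1) fun y => v y l) : VanishesOn S k (firstOrderOp p q v) := by
  refine VanishesOn.add ?_ ?_ ?_ ?_
  · exact fun x hx => ContDiffAt.sum fun l _ => ContDiffAt.sum fun m _ =>
      (hp l m x hx).mul (contDiffAt_pd (hv l x hx) m)
  · exact fun x hx => ContDiffAt.sum fun l _ => (hq l x hx).mul (hv l x hx)
  · refine VanishesOn.sum (fun l _ x hx => ContDiffAt.sum fun m _ =>
      (hp l m x hx).mul (contDiffAt_pd (hv l x hx) m)) fun l _ => ?_
    exact VanishesOn.sum (fun m _ x hx => (hp l m x hx).mul (contDiffAt_pd (hv l x hx) m))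
      fun m _ => ((h l).partial_deriv (hv l) m).mul (hp l m)
        (fun x hx => contDiffAt_pd (hv l x hx) m)
  · exact VanishesOn.sum (fun l _ x hx => (hq l x hx).mul (hv l x hx))
      fun l _ => ((h l).mono (Nat.le_succ k)).mul (hq l) (hv l)

end firstOrderOp

/-- The coefficient of `∂_m v_l` in `(d^𝓑 v)_{ij}`. -/
noncomputable def dBCoeff (g : TensorField) (i j l m : Fin 3) : R3 → ℝ := fun x =>
  (if l = i ∧ m = j then 1 else 0) - (1 / 3) * (g x)⁻¹ l m * g x i j

/-- The coefficient of `v_l` in `(d^𝓑 v)_{ij}`. -/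
noncomputable def dBCoeffZero (g : TensorField) (i j l : Fin 3) : R3 → ℝ := fun x =>
  (1 / 3) * (∑ a, ∑ b, christoffel univ g x l a b * (g x)⁻¹ a b) * g x i j
    - christoffel univ g x l i j

theorem dB_eq_firstOrderOp (g : TensorField) (v : CovectorField) (x : R3) (i j : Fin 3) :
    dB univ g v x i j = firstOrderOp (dBCoeff g i j) (dBCoeffZero g i j) v x := by
  have h1 : ∑ l, ∑ m, (if l = i ∧ m = j then (1 : ℝ) else 0) * 𝜕 (fun y => v y l) m x
      = 𝜕 (fun y => v y i) j x := by
    rw [Finset.sum_eq_single i (fun l _ hl => by simp [hl]) (by simp),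
      Finset.sum_eq_single j (fun m _ hm => by simp [hm]) (by simp)]
    simp
  simp only [firstOrderOp, dBCoeff, dBCoeffZero, sub_mul, Finset.sum_sub_distrib, h1]
  simp only [dB, traceFreePart, trace, covDeriv, sub_mul, Finset.sum_sub_distrib]
  simp only [Fin.sum_univ_three]
  ring

/-- The gradient of `ρ` with respect to `g`. -/
noncomputable def grad (g : TensorField) (ρ : R3 → ℝ) : CovectorField :=
  fun x j => ∑ l, (g x)⁻¹ j l * 𝜕 ρ l x

/-- The contraction `A_{ij} ∇^j ρ` of a tensor field with the gradient of `ρ`. -/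
noncomputable def normalPart (g : TensorField) (ρ : R3 → ℝ) (A : TensorField) : CovectorField :=
  fun x i => ∑ j, A x i j * grad g ρ x j

/-- The coefficient of `∂_m v_l` in `(d^𝓑 v)_{ij} ∇^j ρ`. -/
noncomputable def normalCoeff (g : TensorField) (ρ : R3 → ℝ) (i l m : Fin 3) : R3 → ℝ := fun x =>
  ∑ j, dBCoeff g i j l m x * grad g ρ x j

/-- The coefficient of `v_l` in `(d^𝓑 v)_{ij} ∇^j ρ`. -/
noncomputable def normalCoeffZero (g : TensorField) (ρ : R3 → ℝ) (i l : Fin 3) : R3 → ℝ := fun x =>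
  ∑ j, dBCoeffZero g i j l x * grad g ρ x j

theorem normalPart_dB (g : TensorField) (ρ : R3 → ℝ) (v : CovectorField) (x : R3) (i : Fin 3) :
    normalPart g ρ (dB univ g v) x i
      = firstOrderOp (normalCoeff g ρ i) (normalCoeffZero g ρ i) v x := by
  simp only [normalPart, dB_eq_firstOrderOp, firstOrderOp, normalCoeff, normalCoeffZero,
    Fin.sum_univ_three]
  ring

/-- The principal symbol of `v ↦ (d^𝓑 v)(·, ∇ρ)` at the conormal `dρ`. -/
noncomputable def symbol (g : TensorField) (ρ : R3 → ℝ) (x : R3) : Matrix (Fin 3) (Fin 3) ℝ :=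
  Matrix.of fun i l => ∑ m, normalCoeff g ρ i l m x * 𝜕 ρ m x

/-- The squared norm of `dρ` with respect to `g`. -/
noncomputable def normSqGrad (g : TensorField) (ρ : R3 → ℝ) (x : R3) : ℝ :=
  ∑ l, grad g ρ x l * 𝜕 ρ l x

theorem sum_mul_grad {g : TensorField} {ρ : R3 → ℝ} {x : R3} (hdet : (g x).det ≠ 0) (i : Fin 3) :
    ∑ j, g x i j * grad g ρ x j = 𝜕 ρ i x := by
  have h : g x * (g x)⁻¹ = 1 := Matrix.mul_nonsing_inv _ (isUnit_iff_ne_zero.2 hdet)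
  have e : ∀ l, ∑ j, g x i j * (g x)⁻¹ j l = if i = l then 1 else 0 := by
    intro l
    rw [← Matrix.mul_apply, h, Matrix.one_apply]
  simp only [grad, Finset.mul_sum]
  rw [Finset.sum_comm]
  simp only [← mul_assoc, ← Finset.sum_mul, e]
  simp

theorem symbol_apply {g : TensorField} {ρ : R3 → ℝ} {x : R3} (hdet : (g x).det ≠ 0) (i l : Fin 3) :
    symbol g ρ x i l = (if l = i then normSqGrad g ρ x else 0)
      - (1 / 3) * grad g ρ x l * 𝜕 ρ i x := by
  have e : ∀ m, normalCoeff g ρ i l m x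
      = (if l = i then grad g ρ x m else 0) - (1 / 3) * (g x)⁻¹ l m * 𝜕 ρ i x := by
    intro m
    simp only [normalCoeff, dBCoeff, sub_mul, Finset.sum_sub_distrib]
    congr 1
    · by_cases h : l = i <;> simp [h]
    · rw [← sum_mul_grad hdet i, Finset.mul_sum]
      exact Finset.sum_congr rfl fun j _ => by ring
  simp only [symbol, Matrix.of_apply, e, sub_mul, Finset.sum_sub_distrib]
  congr 1
  · by_cases h : l = i <;> simp [h, normSqGrad]
  · simp only [grad, Finset.mul_sum, Finset.sum_mul]
    exact Finset.sum_congr rfl fun j _ => by ring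

/-- The symbol is `|dρ|² (1 - n ⊗ n / 3)` with `n` the unit conormal, so it is invertible: the
surface `{ρ = 0}` is noncharacteristic. -/
theorem det_symbol_ne_zero {g : TensorField} {ρ : R3 → ℝ} {x : R3} (hdet : (g x).det ≠ 0)
    (hσ : normSqGrad g ρ x ≠ 0) : (symbol g ρ x).det ≠ 0 := by
  intro h
  obtain ⟨a, ha, hSa⟩ := Matrix.exists_mulVec_eq_zero_iff.2 h
  have h1 : ∀ i, normSqGrad g ρ x * a i = (1 / 3) * (∑ l, grad g ρ x l * a l) * 𝜕 ρ i x := by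
    intro i
    have := congrFun hSa i
    simp only [Matrix.mulVec, dotProduct, symbol_apply hdet, Pi.zero_apply, sub_mul,
      Finset.sum_sub_distrib] at this
    have e1 : ∑ l, (if l = i then normSqGrad g ρ x else 0) * a l = normSqGrad g ρ x * a i := by
      simp
    rw [e1] at this
    rw [sub_eq_zero.1 this, Finset.mul_sum, Finset.sum_mul]
    exact Finset.sum_congr rfl fun l _ => by ring
  have h2 : normSqGrad g ρ x * (∑ l, grad g ρ x l * a l)
      = (1 / 3) * (∑ l, grad g ρ x l * a l) * normSqGrad g ρ x := by
    conv_rhs => rw [normSqGrad, Finset.mul_sum]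
    rw [Finset.mul_sum]
    exact Finset.sum_congr rfl fun l _ => by linear_combination grad g ρ x l * h1 l
  have h3 : ∑ l, grad g ρ x l * a l = 0 := by
    have : normSqGrad g ρ x * ((2 / 3) * ∑ l, grad g ρ x l * a l) = 0 := by
      linear_combination h2
    rcases mul_eq_zero.1 this with h | h
    · exact absurd h hσ
    · linarith
  refine ha (funext fun i => ?_)
  have := h1 i
  rw [h3] at this
  simpa [hσ] using this

theorem normSqGrad_pos {g : TensorField} {ρ : R3 → ℝ} {x : R3} (hg : (g x).PosDef)
    (hρ : fderiv ℝ ρ x ≠ 0) : 0 < normSqGrad g ρ x := by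
  have hne : (fun l => 𝜕 ρ l x) ≠ 0 := by
    intro h
    refine hρ (ContinuousLinearMap.ext fun u => ?_)
    rw [fderiv_eq_sum]
    simp [fun l => congrFun h l]
  have := hg.inv.dotProduct_mulVec_pos hne
  simp only [dotProduct, Matrix.mulVec, star_trivial] at this
  refine lt_of_lt_of_eq this ?_
  simp only [normSqGrad, grad]
  exact Finset.sum_congr rfl fun l _ => by ring

/-- `O` is an open set on which the metric `g`, the tensor field `f` and the function `ρ` are of
class `C^n`, `g` is nondegenerate and the level sets of `ρ` are noncharacteristic. -/
structure IsGaugeDomain (n : WithTop ℕ∞) (g f : TensorField) (ρ : R3 → ℝ) (O : Set R3) : Prop where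
  isOpen : IsOpen O
  metric : ∀ i j, ∀ x ∈ O, ContDiffAt ℝ n (fun y => g y i j) x
  tensor : ∀ i j, ∀ x ∈ O, ContDiffAt ℝ n (fun y => f y i j) x
  defining : ∀ x ∈ O, ContDiffAt ℝ n ρ x
  det_ne : ∀ x ∈ O, (g x).det ≠ 0
  symbol_ne : ∀ x ∈ O, (symbol g ρ x).det ≠ 0

section coefficients

variable {n : WithTop ℕ∞} {g : TensorField} {ρ : R3 → ℝ} {x : R3}

theorem contDiffAt_dBCoeff (hg : ∀ i j, ContDiffAt ℝ n (fun y => g y i j) x)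
    (hdet : (g x).det ≠ 0) (i j l m : Fin 3) : ContDiffAt ℝ n (dBCoeff g i j l m) x :=
  contDiffAt_const.sub ((contDiffAt_const.mul (contDiffAt_matrix_inv hg hdet l m)).mul (hg i j))

theorem contDiffAt_dBCoeffZero (hn : n + 1 ≤ n) (hg : ∀ i j, ContDiffAt ℝ n (fun y => g y i j) x)
    (hdet : (g x).det ≠ 0) (i j l : Fin 3) : ContDiffAt ℝ n (dBCoeffZero g i j l) x :=
  ((contDiffAt_const.mul (ContDiffAt.sum fun a _ => ContDiffAt.sum fun b _ =>
    (contDiffAt_christoffel hn hg hdet l a b).mul (contDiffAt_matrix_inv hg hdet a b))).mul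
      (hg i j)).sub (contDiffAt_christoffel hn hg hdet l i j)

theorem contDiffAt_grad (hn : n + 1 ≤ n) (hg : ∀ i j, ContDiffAt ℝ n (fun y => g y i j) x)
    (hdet : (g x).det ≠ 0) (hρ : ContDiffAt ℝ n ρ x) (j : Fin 3) :
    ContDiffAt ℝ n (fun y => grad g ρ y j) x :=
  ContDiffAt.sum fun l _ => (contDiffAt_matrix_inv hg hdet j l).mul (contDiffAt_pd' hn hρ l)

theorem contDiffAt_normalPart {A : TensorField} (hn : n + 1 ≤ n)
    (hg : ∀ i j, ContDiffAt ℝ n (fun y => g y i j) x)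
    (hA : ∀ i j, ContDiffAt ℝ n (fun y => A y i j) x)
    (hdet : (g x).det ≠ 0) (hρ : ContDiffAt ℝ n ρ x) (i : Fin 3) :
    ContDiffAt ℝ n (fun y => normalPart g ρ A y i) x :=
  ContDiffAt.sum fun j _ => (hA i j).mul (contDiffAt_grad hn hg hdet hρ j)

theorem contDiffAt_normalCoeff (hn : n + 1 ≤ n) (hg : ∀ i j, ContDiffAt ℝ n (fun y => g y i j) x)
    (hdet : (g x).det ≠ 0) (hρ : ContDiffAt ℝ n ρ x) (i l m : Fin 3) :
    ContDiffAt ℝ n (normalCoeff g ρ i l m) x :=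
  ContDiffAt.sum fun j _ => (contDiffAt_dBCoeff hg hdet i j l m).mul
    (contDiffAt_grad hn hg hdet hρ j)

theorem contDiffAt_normalCoeffZero (hn : n + 1 ≤ n)
    (hg : ∀ i j, ContDiffAt ℝ n (fun y => g y i j) x)
    (hdet : (g x).det ≠ 0) (hρ : ContDiffAt ℝ n ρ x) (i l : Fin 3) :
    ContDiffAt ℝ n (normalCoeffZero g ρ i l) x :=
  ContDiffAt.sum fun j _ => (contDiffAt_dBCoeffZero hn hg hdet i j l).mul
    (contDiffAt_grad hn hg hdet hρ j)

theorem contDiffAt_symbol (hn : n + 1 ≤ n) (hg : ∀ i j, ContDiffAt ℝ n (fun y => g y i j) x)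
    (hdet : (g x).det ≠ 0) (hρ : ContDiffAt ℝ n ρ x) (i l : Fin 3) :
    ContDiffAt ℝ n (fun y => symbol g ρ y i l) x := by
  simp only [symbol, Matrix.of_apply]
  exact ContDiffAt.sum fun m _ => (contDiffAt_normalCoeff hn hg hdet hρ i l m).mul
    (contDiffAt_pd' hn hρ m)

theorem contDiffAt_dB {v : CovectorField} (hn : n + 1 ≤ n)
    (hg : ∀ i j, ContDiffAt ℝ n (fun y => g y i j) x) (hdet : (g x).det ≠ 0)
    (hv : ∀ i, ContDiffAt ℝ n (fun y => v y i) x) (i j : Fin 3) :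
    ContDiffAt ℝ n (fun y => dB univ g v y i j) x := by
  simp only [dB_eq_firstOrderOp]
  exact contDiffAt_firstOrderOp hn (contDiffAt_dBCoeff hg hdet i j)
    (contDiffAt_dBCoeffZero hn hg hdet i j) hv

end coefficients

/-- Near a boundary point there is a gauge domain. -/
theorem exists_isGaugeDomain {n : WithTop ℕ∞} (hn : n + 1 ≤ n) {g f : TensorField}
    {ρ : R3 → ℝ} {W : Set R3} (hW : IsOpen W)
    (hg : ∀ i j, ∀ x ∈ W, ContDiffAt ℝ n (fun y => g y i j) x)
    (hf : ∀ i j, ∀ x ∈ W, ContDiffAt ℝ n (fun y => f y i j) x)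
    (hρ : ∀ x ∈ W, ContDiffAt ℝ n ρ x) :
    ∃ O ⊆ W, IsGaugeDomain n g f ρ O ∧ ∀ x ∈ W, (g x).PosDef → fderiv ℝ ρ x ≠ 0 → x ∈ O := by
  have hdetc : ∀ (A : R3 → Matrix (Fin 3) (Fin 3) ℝ) (x : R3),
      (∀ i j, ContDiffAt ℝ n (fun y => A y i j) x) → ContinuousAt (fun y => (A y).det) x := by
    intro A x hA
    have : ContDiffAt ℝ n (fun y => (A y).det) x := by
      simp only [Matrix.det_fin_three]
      fun_prop
    exact this.continuousAt
  refine ⟨{x ∈ W | (g x).det ≠ 0 ∧ (symbol g ρ x).det ≠ 0}, fun x hx => hx.1,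
    ⟨?_, fun i j x hx => hg i j x hx.1, fun i j x hx => hf i j x hx.1, fun x hx => hρ x hx.1,
      fun x hx => hx.2.1, fun x hx => hx.2.2⟩, fun x hx hpos hd => ⟨hx, hpos.det_pos.ne',
        det_symbol_ne_zero hpos.det_pos.ne' (normSqGrad_pos hpos hd).ne'⟩⟩
  rw [isOpen_iff_mem_nhds]
  rintro x ⟨hx, h1, h2⟩
  filter_upwards [hW.mem_nhds hx, (hdetc g x fun i j => hg i j x hx).eventually_ne h1,
    (hdetc _ x fun i j =>
      contDiffAt_symbol hn (fun i j => hg i j x hx) h1 (hρ x hx) i j).eventually_ne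
      h2] with y h3 h4 h5 using ⟨h3, h4, h5⟩

/-- The coefficients `a_k` of the formal solution `v = ∑ ρ^{k+1} a_k` of
`(f - d^𝓑 v)(·, ∇ρ) = 0`. -/
noncomputable def gaugeSeq (g : TensorField) (ρ : R3 → ℝ) (f : TensorField) : ℕ → CovectorField
  | 0 => fun x => (symbol g ρ x)⁻¹.mulVec (normalPart g ρ f x)
  | k + 1 => fun x => (-(1 / ((k : ℝ) + 2))) •
      (symbol g ρ x)⁻¹.mulVec (normalPart g ρ (dB univ g (gaugeSeq g ρ f k)) x)

/-- The factor `h_K` in the remainder `ρ^K h_K` left by the `K`-th partial sum of the formal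
solution. -/
noncomputable def gaugeRem (g : TensorField) (ρ : R3 → ℝ) (f : TensorField) : ℕ → CovectorField
  | 0 => normalPart g ρ f
  | k + 1 => fun x => - normalPart g ρ (dB univ g (gaugeSeq g ρ f k)) x

section gaugeSeq

variable {n : WithTop ℕ∞} {g f : TensorField} {ρ : R3 → ℝ} {O : Set R3}

theorem gaugeSeq_eq (k : ℕ) (x : R3) : gaugeSeq g ρ f k x
    = (1 / ((k : ℝ) + 1)) • (symbol g ρ x)⁻¹.mulVec (gaugeRem g ρ f k x) := by
  rcases k with _ | k
  · simp [gaugeSeq, gaugeRem]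
  · simp only [gaugeSeq, gaugeRem, Matrix.mulVec_neg, smul_neg, neg_smul]
    push_cast
    congr 3
    ring

theorem symbol_mulVec_gaugeSeq (h : IsGaugeDomain n g f ρ O) (k : ℕ) {x : R3} (hx : x ∈ O) :
    ((k : ℝ) + 1) • (symbol g ρ x).mulVec (gaugeSeq g ρ f k x) = gaugeRem g ρ f k x := by
  have hk : (k : ℝ) + 1 ≠ 0 := by positivity
  rw [gaugeSeq_eq, Matrix.mulVec_smul, Matrix.mulVec_mulVec,
    Matrix.mul_nonsing_inv _ (isUnit_iff_ne_zero.2 (h.symbol_ne x hx)), Matrix.one_mulVec,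
    smul_smul]
  rw [mul_one_div_cancel hk, one_smul]

theorem contDiffAt_gauge (h : IsGaugeDomain n g f ρ O) (hn : n + 1 ≤ n) (k : ℕ) {x : R3}
    (hx : x ∈ O) : (∀ i, ContDiffAt ℝ n (fun y => gaugeSeq g ρ f k y i) x) ∧
      ∀ i, ContDiffAt ℝ n (fun y => gaugeRem g ρ f k y i) x := by
  have hg := fun i j => h.metric i j x hx
  have hρ := h.defining x hx
  have hdet := h.det_ne x hx
  have step : ∀ k, (∀ i, ContDiffAt ℝ n (fun y => gaugeRem g ρ f k y i) x) →
      ∀ i, ContDiffAt ℝ n (fun y => gaugeSeq g ρ f k y i) x := by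
    intro k hk i
    simp only [gaugeSeq_eq, Matrix.mulVec, dotProduct, Pi.smul_apply, smul_eq_mul]
    exact contDiffAt_const.mul (ContDiffAt.sum fun l _ =>
      (contDiffAt_matrix_inv (contDiffAt_symbol hn hg hdet hρ) (h.symbol_ne x hx) i l).mul (hk l))
  induction k with
  | zero =>
    have h0 : ∀ i, ContDiffAt ℝ n (fun y => gaugeRem g ρ f 0 y i) x :=
      contDiffAt_normalPart hn hg (fun i j => h.tensor i j x hx) hdet hρ
    exact ⟨step 0 h0, h0⟩
  | succ k ih =>
    have h1 : ∀ i, ContDiffAt ℝ n (fun y => gaugeRem g ρ f (k + 1) y i) x := fun i =>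
      (contDiffAt_normalPart hn hg (contDiffAt_dB hn hg hdet ih.1) hdet hρ i).neg
    exact ⟨step _ h1, h1⟩

/-- One step of the recursion: `ρ^{k+1} a_k` replaces the remainder `ρ^k h_k` by
`ρ^{k+1} h_{k+1}`. -/
theorem normalPart_dB_pow_mul_gaugeSeq (h : IsGaugeDomain n g f ρ O) (hn : n + 1 ≤ n) (hn0 : n ≠ 0)
    (k : ℕ) {x : R3} (hx : x ∈ O) (i : Fin 3) :
    normalPart g ρ (dB univ g fun y i => ρ y ^ (k + 1) * gaugeSeq g ρ f k y i) x i
      = ρ x ^ k * gaugeRem g ρ f k x i - ρ x ^ (k + 1) * gaugeRem g ρ f (k + 1) x i := by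
  have ha := (contDiffAt_gauge h hn k hx).1
  have hρ : DifferentiableAt ℝ ρ x := (h.defining x hx).differentiableAt hn0
  have hpow : ∀ m, 𝜕 (fun y => ρ y ^ (k + 1)) m x = ((k : ℝ) + 1) * ρ x ^ k * 𝜕 ρ m x := by
    intro m
    rw [pd_univ, pd_univ, fderiv_fun_pow _ hρ]
    simp
  rw [normalPart_dB, firstOrderOp_mul (c := fun y => ρ y ^ (k + 1)) (hρ.fun_pow _)
      fun l => (ha l).differentiableAt hn0,
    ← normalPart_dB]
  have e1 : gaugeRem g ρ f (k + 1) x i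
      = - normalPart g ρ (dB univ g (gaugeSeq g ρ f k)) x i := rfl
  have e2 : gaugeRem g ρ f k x i
      = ((k : ℝ) + 1) * ∑ l, symbol g ρ x i l * gaugeSeq g ρ f k x l := by
    rw [← symbol_mulVec_gaugeSeq h k hx]
    simp [Matrix.mulVec, dotProduct]
  rw [e1, e2]
  simp only [hpow, symbol, Matrix.of_apply, Fin.sum_univ_three]
  ring

end gaugeSeq

/-! ### Borel summation along the boundary -/

theorem exists_bound_iteratedFDeriv {X : Type*} [NormedAddCommGroup X] [NormedSpace ℝ X]
    {K : Set X} {f : X → ℝ} (hf : ContDiff ℝ ∞ f) (hK : IsCompact K) (k : ℕ) :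
    ∃ C, 1 ≤ C ∧ ∀ n ≤ k, ∀ x ∈ K, ‖iteratedFDeriv ℝ n f x‖ ≤ C := by
  have h : ∀ n : ℕ, ∃ C, ∀ x ∈ K, ‖iteratedFDeriv ℝ n f x‖ ≤ C := fun n =>
    hK.exists_bound_of_continuousOn
      (hf.continuous_iteratedFDeriv (m := n) (by exact_mod_cast le_top)).continuousOn
  choose C hC using h
  refine ⟨1 + ∑ n ∈ Finset.range (k + 1), |C n|, by
    have : 0 ≤ ∑ n ∈ Finset.range (k + 1), |C n| := Finset.sum_nonneg fun _ _ => abs_nonneg _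
    linarith, fun n hn x hx => ?_⟩
  calc ‖iteratedFDeriv ℝ n f x‖ ≤ C n := hC n x hx
    _ ≤ |C n| := le_abs_self _
    _ ≤ ∑ n ∈ Finset.range (k + 1), |C n| :=
      Finset.single_le_sum (f := fun n => |C n|) (fun _ _ => abs_nonneg _)
        (Finset.mem_range.2 (Nat.lt_succ_of_le hn))
    _ ≤ 1 + ∑ n ∈ Finset.range (k + 1), |C n| := by linarith

theorem exists_bound_iteratedFDeriv_of_compactSupport {X : Type*} [NormedAddCommGroup X]
    [NormedSpace ℝ X] {f : X → ℝ} (hf : ContDiff ℝ ∞ f) (hc : HasCompactSupport f) (k : ℕ) :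
    ∃ C, 1 ≤ C ∧ ∀ n ≤ k, ∀ x, ‖iteratedFDeriv ℝ n f x‖ ≤ C := by
  obtain ⟨C, h1, hC⟩ := exists_bound_iteratedFDeriv hf hc k
  refine ⟨C, h1, fun n hn x => ?_⟩
  by_cases hx : x ∈ tsupport f
  · exact hC n hn x hx
  · have : iteratedFDeriv ℝ n f x = 0 := by
      rw [((notMem_tsupport_iff_eventuallyEq.1 hx).iteratedFDeriv ℝ n).eq_of_nhds]
      simp
    rw [this, norm_zero]
    linarith

/-- Since `ρ^{k+1} χ(ρ/ε) = ε^{k+1} ψ(ρ/ε)` with `ψ(s) = s^{k+1} χ(s)`, the derivatives of order at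
most `k` of the localised term are `O(ε)`. -/
theorem exists_bound_borel_term {χ : ℝ → ℝ} {ρ a : R3 → ℝ} (hχ : ContDiff ℝ ∞ χ)
    (hχc : HasCompactSupport χ) (hρ : ContDiff ℝ ∞ ρ) (ha : ContDiff ℝ ∞ a)
    (hac : HasCompactSupport a) (k : ℕ) :
    ∃ C, 1 ≤ C ∧ ∀ ε : ℝ, 0 < ε → ε ≤ 1 → ∀ n ≤ k, ∀ x,
      ‖iteratedFDeriv ℝ n (fun y => ρ y ^ (k + 1) * (χ (ρ y / ε) * a y)) x‖ ≤ C * ε := by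
  set ψ : ℝ → ℝ := fun s => s ^ (k + 1) * χ s with hψ
  have hψs : ContDiff ℝ ∞ ψ := (contDiff_id.pow _).mul hχ
  have hψc : HasCompactSupport ψ := hχc.mul_left
  obtain ⟨Cψ, hCψ1, hCψ⟩ := exists_bound_iteratedFDeriv_of_compactSupport hψs hψc k
  obtain ⟨Ca, hCa1, hCa⟩ := exists_bound_iteratedFDeriv_of_compactSupport ha hac k
  obtain ⟨R, hR1, hR⟩ := exists_bound_iteratedFDeriv hρ hac k
  have hB : 1 ≤ Cψ * Ca * (k.factorial : ℝ) * 2 ^ k * R ^ k := by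
    have h1 : (1 : ℝ) ≤ k.factorial := by exact_mod_cast k.factorial_pos
    have h2 : (1 : ℝ) ≤ 2 ^ k := one_le_pow₀ (by norm_num)
    have h3 : (1 : ℝ) ≤ R ^ k := one_le_pow₀ hR1
    exact one_le_mul_of_one_le_of_one_le (one_le_mul_of_one_le_of_one_le
      (one_le_mul_of_one_le_of_one_le (one_le_mul_of_one_le_of_one_le hCψ1 hCa1) h1) h2) h3
  refine ⟨Cψ * Ca * (k.factorial : ℝ) * 2 ^ k * R ^ k, hB, fun ε hε hε1 n hn x => ?_⟩
  by_cases hx : x ∈ tsupport a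
  swap
  · have : (fun y => ρ y ^ (k + 1) * (χ (ρ y / ε) * a y)) =ᶠ[𝓝 x] fun _ => 0 := by
      filter_upwards [notMem_tsupport_iff_eventuallyEq.1 hx] with y hy
      simp [hy]
    rw [(this.iteratedFDeriv ℝ n).eq_of_nhds]
    have h0 : iteratedFDeriv ℝ n (fun _ : R3 => (0 : ℝ)) x = 0 := by simp
    rw [h0, norm_zero]
    have : 0 < Cψ * Ca * (k.factorial : ℝ) * 2 ^ k * R ^ k := lt_of_lt_of_le one_pos hB
    positivity
  have e : (fun y => ρ y ^ (k + 1) * (χ (ρ y / ε) * a y))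
      = ε ^ (k + 1) • fun y => (ψ ∘ (ε⁻¹ • ρ)) y * a y := by
    ext y
    simp only [hψ, Pi.smul_apply, smul_eq_mul, Function.comp_apply]
    rw [show ρ y / ε = ε⁻¹ * ρ y by rw [div_eq_inv_mul], mul_pow, inv_pow]
    field_simp
  have hρε : ContDiff ℝ ∞ (ε⁻¹ • ρ) := hρ.const_smul ε⁻¹
  have hcomp : ContDiff ℝ ∞ (ψ ∘ (ε⁻¹ • ρ)) := hψs.comp hρε
  have hle : ∀ m : ℕ, ((m : ℕ) : WithTop ℕ∞) ≤ ∞ := fun m => by exact_mod_cast le_top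
  have hRε : 1 ≤ R / ε := by rw [le_div_iff₀ hε]; linarith
  have h1 : ∀ i ≤ n, ‖iteratedFDeriv ℝ i (ψ ∘ (ε⁻¹ • ρ)) x‖
      ≤ k.factorial * Cψ * (R / ε) ^ k := by
    intro i hi
    have := norm_iteratedFDeriv_comp_le hψs hρε (hle i) x (C := Cψ) (D := R / ε)
      (fun j hj => hCψ j (by omega) _) (fun j hj1 hj2 => by
        rw [iteratedFDeriv_const_smul_apply (hρ.contDiffAt.of_le (hle j)), norm_smul,
          Real.norm_of_nonneg (inv_nonneg.2 hε.le)]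
        calc ε⁻¹ * ‖iteratedFDeriv ℝ j ρ x‖ ≤ ε⁻¹ * R :=
              mul_le_mul_of_nonneg_left (hR j (by omega) x hx) (inv_nonneg.2 hε.le)
          _ = (R / ε) ^ 1 := by rw [pow_one, div_eq_inv_mul]
          _ ≤ (R / ε) ^ j := pow_le_pow_right₀ hRε hj1)
    refine this.trans ?_
    have hik : i ≤ k := hi.trans hn
    gcongr
  rw [e, iteratedFDeriv_const_smul_apply ((hcomp.mul ha).contDiffAt.of_le (hle n)), norm_smul,
    Real.norm_of_nonneg (pow_nonneg hε.le _)]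
  have h2 : ‖iteratedFDeriv ℝ n (fun y => (ψ ∘ (ε⁻¹ • ρ)) y * a y) x‖
      ≤ 2 ^ k * (k.factorial * Cψ * (R / ε) ^ k * Ca) := by
    refine (norm_iteratedFDeriv_mul_le hcomp ha x (hle n)).trans ?_
    calc ∑ i ∈ Finset.range (n + 1), (n.choose i : ℝ) *
          ‖iteratedFDeriv ℝ i (ψ ∘ (ε⁻¹ • ρ)) x‖ * ‖iteratedFDeriv ℝ (n - i) a x‖
        ≤ ∑ i ∈ Finset.range (n + 1), (n.choose i : ℝ) *
          (k.factorial * Cψ * (R / ε) ^ k * Ca) := by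
          refine Finset.sum_le_sum fun i hi => ?_
          rw [mul_assoc]
          have hi' : i ≤ n := Nat.lt_succ_iff.1 (Finset.mem_range.1 hi)
          refine mul_le_mul_of_nonneg_left (mul_le_mul (h1 i hi') (hCa _ (by omega) x)
            (norm_nonneg _) ?_) (by positivity)
          positivity
      _ = 2 ^ n * (k.factorial * Cψ * (R / ε) ^ k * Ca) := by
          rw [← Finset.sum_mul]
          congr 1
          exact_mod_cast Nat.sum_range_choose n
      _ ≤ 2 ^ k * (k.factorial * Cψ * (R / ε) ^ k * Ca) := by
          gcongr
          norm_num
  calc ε ^ (k + 1) * ‖iteratedFDeriv ℝ n (fun y => (ψ ∘ (ε⁻¹ • ρ)) y * a y) x‖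
      ≤ ε ^ (k + 1) * (2 ^ k * (k.factorial * Cψ * (R / ε) ^ k * Ca)) := by gcongr
    _ = Cψ * Ca * (k.factorial : ℝ) * 2 ^ k * R ^ k * ε := by
      rw [div_pow, pow_succ]
      field_simp

/-- **Borel's lemma** along the zero set of `ρ`: every formal series `∑ ρ^{k+1} a_k` is the
expansion of a smooth function. -/
theorem exists_borel_sum {ρ : R3 → ℝ} {a : ℕ → R3 → ℝ} (hρ : ContDiff ℝ ∞ ρ)
    (ha : ∀ k, ContDiff ℝ ∞ (a k)) (hac : ∀ k, HasCompactSupport (a k)) :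
    ∃ v : R3 → ℝ, ContDiff ℝ ∞ v ∧ ∀ m, VanishesOn {x | ρ x = 0} (m + 1)
      (fun x => v x - ∑ k ∈ Finset.range m, ρ x ^ (k + 1) * a k x) := by
  let χ : ContDiffBump (0 : ℝ) := ⟨1, 2, one_pos, one_lt_two⟩
  have hχ : ContDiff ℝ ∞ χ := χ.contDiff
  choose C hC1 hC using fun k => exists_bound_borel_term hχ χ.hasCompactSupport hρ (ha k) (hac k) k
  -- this width makes the derivatives of order at most `k` of the `k`-th term at most `2⁻ᵏ`
  set ε : ℕ → ℝ := fun k => (1 / 2) ^ k / C k with hε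
  have hCpos : ∀ k, 0 < C k := fun k => lt_of_lt_of_le one_pos (hC1 k)
  have hεpos : ∀ k, 0 < ε k := fun k => div_pos (by positivity) (hCpos k)
  have hε1 : ∀ k, ε k ≤ 1 := fun k => by
    rw [hε]
    simp only
    rw [div_le_one (hCpos k)]
    exact (pow_le_one₀ (by norm_num) (by norm_num)).trans (hC1 k)
  set b : ℕ → R3 → ℝ := fun k y => ρ y ^ (k + 1) * (χ (ρ y / ε k) * a k y) with hb
  have hcut : ∀ k, ContDiff ℝ ∞ fun y => χ (ρ y / ε k) * a k y := fun k =>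
    (hχ.comp (hρ.div_const (ε k))).mul (ha k)
  have hbs : ∀ k, ContDiff ℝ ∞ (b k) := fun k => (hρ.pow _).mul (hcut k)
  have hbb : ∀ k, ∀ n ≤ k, ∀ x, ‖iteratedFDeriv ℝ n (b k) x‖ ≤ (1 / 2) ^ k := fun k n hn x => by
    have := hC k (ε k) (hεpos k) (hε1 k) n hn x
    refine this.trans (le_of_eq ?_)
    rw [hε]
    field_simp [(hCpos k).ne']
  have hgeo : Summable fun k : ℕ => (1 / 2 : ℝ) ^ k := summable_geometric_two
  have hle : ∀ m : ℕ, ((m : ℕ) : WithTop ℕ∞) ≤ ∞ := fun m => by exact_mod_cast le_top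
  refine ⟨fun x => ∑' k, b k x, ?_, fun m => ?_⟩
  · refine contDiff_tsum_of_eventually (N := ⊤) (v := fun _ k => (1 / 2 : ℝ) ^ k) hbs
      (fun _ _ => hgeo) fun n _ => ?_
    rw [Nat.cofinite_eq_atTop]
    filter_upwards [eventually_ge_atTop n] with k hk x using hbb k n hk x
  · have hsum : ∀ x, Summable fun k => b k x := fun x => by
      refine Summable.of_norm_bounded hgeo fun k => ?_
      have := hbb k 0 (Nat.zero_le k) x
      rwa [norm_iteratedFDeriv_zero] at this
    have hS : ∀ k, VanishesOn {x | ρ x = 0} (k + 1) (b k) := fun k =>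
      VanishesOn.pow_mul (fun x _ => hρ.contDiffAt) (fun x _ => (hcut k).contDiffAt)
        (fun x hx => hx) (k + 1)
    -- the head of the series: each term agrees with `ρ^{k+1} a_k` near `{ρ = 0}`
    have h1 : VanishesOn {x | ρ x = 0} (m + 1)
        (fun x => ∑ k ∈ Finset.range m, (b k x - ρ x ^ (k + 1) * a k x)) := by
      refine VanishesOn.sum (F := fun k x => b k x - ρ x ^ (k + 1) * a k x)
        (fun k _ x _ => (hbs k).contDiffAt.sub ((hρ.pow _).mul (ha k)).contDiffAt)
        fun k _ => VanishesOn.const_zero.congr fun x hx => ?_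
      have hx0 : Tendsto (fun y => ρ y / ε k) (𝓝 x) (𝓝 0) := by
        have := (hρ.continuous.div_const (ε k)).tendsto x
        rwa [show ρ x = 0 from hx, zero_div] at this
      filter_upwards [hx0.eventually (Metric.closedBall_mem_nhds (0 : ℝ) one_pos)] with y hy
      have : χ (ρ y / ε k) = 1 := χ.one_of_mem_closedBall hy
      simp [hb, this]
    have hle' : ∀ j i : ℕ, ((j : ℕ) : ℕ∞) ≤ ((m : ℕ) : ℕ∞) → j ≤ i + m := fun j i h => by
      have : j ≤ m := by exact_mod_cast h
      omega
    have h2 : VanishesOn {x | ρ x = 0} (m + 1) (fun x => ∑' k, b (k + m) x) := by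
      intro n hn x hx
      rw [iteratedFDeriv_tsum_apply (N := (m : ℕ∞)) (v := fun _ k => (1 / 2 : ℝ) ^ (k + m))
        (fun k => (hbs (k + m)).of_le (by exact_mod_cast le_top))
        (fun _ _ => (summable_nat_add_iff m).2 hgeo)
        (fun j i x hj => hbb (i + m) j (hle' j i hj) x)
        (by exact_mod_cast Nat.lt_succ_iff.1 hn)]
      have : ∀ k, iteratedFDeriv ℝ n (b (k + m)) x = 0 := fun k =>
        hS (k + m) n (by omega) x hx
      simp [this]
    have hs2 : ContDiff ℝ ∞ (fun x => ∑' k, b (k + m) x) := by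
      refine contDiff_tsum_of_eventually (N := ⊤) (v := fun _ k => (1 / 2 : ℝ) ^ (k + m))
        (fun k => hbs (k + m)) (fun _ _ => (summable_nat_add_iff m).2 hgeo) fun n _ => ?_
      rw [Nat.cofinite_eq_atTop]
      filter_upwards [eventually_ge_atTop n] with k hk x using hbb (k + m) n (by omega) x
    have h3 := VanishesOn.add (fun x _ => ContDiffAt.sum fun k _ => (hbs k).contDiffAt.sub
      ((hρ.pow (k + 1)).mul (ha k)).contDiffAt) (fun x _ => hs2.contDiffAt) h1 h2
    convert h3 using 2 with x
    rw [Finset.sum_sub_distrib]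
    linarith [(hsum x).sum_add_tsum_nat_add m]

theorem firstOrderOp_add {p : Fin 3 → Fin 3 → R3 → ℝ} {q : Fin 3 → R3 → ℝ} {v w : CovectorField}
    {x : R3} (hv : ∀ l, DifferentiableAt ℝ (fun y => v y l) x)
    (hw : ∀ l, DifferentiableAt ℝ (fun y => w y l) x) :
    firstOrderOp p q (fun y i => v y i + w y i) x =
      firstOrderOp p q v x + firstOrderOp p q w x := by
  simp only [firstOrderOp, pd_add (hv _) (hw _), mul_add, Finset.sum_add_distrib]
  ring

theorem normalPart_sub (g A B : TensorField) (ρ : R3 → ℝ) (x : R3) (i : Fin 3) :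
    normalPart g ρ (fun y i j => A y i j - B y i j) x i
      = normalPart g ρ A x i - normalPart g ρ B x i := by
  simp only [normalPart, sub_mul, Finset.sum_sub_distrib]

/-- The partial sums of the formal solution leave the remainder `ρ^K h_K`. -/
theorem normalPart_dB_partialSum {n : WithTop ℕ∞} {g f : TensorField} {ρ : R3 → ℝ} {O : Set R3}
    (h : IsGaugeDomain n g f ρ O) (hn : n + 1 ≤ n) (hn0 : n ≠ 0) (K : ℕ) {x : R3} (hx : x ∈ O)
    (i : Fin 3) :
    normalPart g ρ (dB univ g fun y i => ∑ k ∈ Finset.range K, ρ y ^ (k + 1) * gaugeSeq g ρ f k y i)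
      x i = normalPart g ρ f x i - ρ x ^ K * gaugeRem g ρ f K x i := by
  have ha : ∀ k l,
      DifferentiableAt ℝ (fun y => ρ y ^ (k + 1) * gaugeSeq g ρ f k y l) x := fun k l =>
    (((h.defining x hx).pow _).mul ((contDiffAt_gauge h hn k hx).1 l)).differentiableAt hn0
  induction K with
  | zero =>
    simp [normalPart_dB, firstOrderOp, gaugeRem, pd_univ]
  | succ K ih =>
    simp only [Finset.sum_range_succ]
    rw [normalPart_dB, firstOrderOp_add
      (fun l => DifferentiableAt.fun_sum fun k _ => ha k l) (ha K),
      ← normalPart_dB, ← normalPart_dB, ih, normalPart_dB_pow_mul_gaugeSeq h hn hn0 K hx]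
    ring

/-- The gauge condition `(f - d^𝓑 v)(·, ∇ρ) = 0` with `v = 0` on the boundary has a smooth
solution up to errors vanishing to infinite order at the boundary. -/
theorem exists_gauge {M O : Set R3} {g f : TensorField} {ρ : R3 → ℝ} (hM : IsCompact M)
    (hg : ∀ i j, ContDiff ℝ ∞ fun x => g x i j) (hf : ∀ i j, ContDiff ℝ ∞ fun x => f x i j)
    (hpos : ∀ x ∈ frontier M, (g x).PosDef) (hρs : ContDiff ℝ ∞ ρ)
    (hρ : ∀ x ∈ frontier M, IsDefiningFunction ∞ M x O ρ) :
    ∃ v : CovectorField, (∀ i, ContDiff ℝ ∞ fun x => v x i) ∧ (∀ x ∈ frontier M, v x = 0) ∧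
      ∀ k i, VanishesOn (frontier M) k
        (fun x => normalPart g ρ (fun y i j => f y i j - dB univ g v y i j) x i) := by
  obtain ⟨D, -, hD, hDM⟩ := exists_isGaugeDomain (n := ∞) (by simp) isOpen_univ
    (fun i j x _ => (hg i j).contDiffAt) (fun i j x _ => (hf i j).contDiffAt)
    (fun x _ => hρs.contDiffAt)
  have hMD : frontier M ⊆ D := fun x hx => hDM x (mem_univ x) (hpos x hx) (hρ x hx).fderiv_ne
  have hK : IsCompact (frontier M) := hM.of_isClosed_subset isClosed_frontier
    hM.isClosed.frontier_subset
  obtain ⟨χ, hχs, hχc, hχD, hχ1⟩ := exists_cutoff hK hD.isOpen hMD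
  have hgs := fun k x (hx : x ∈ D) => contDiffAt_gauge hD (by simp) k hx
  set a : ℕ → Fin 3 → R3 → ℝ := fun k i x => χ x * gaugeSeq g ρ f k x i with ha
  have has : ∀ k i, ContDiff ℝ ∞ (a k i) := fun k i =>
    contDiff_cutoff_mul hχs hχD fun x hx => (hgs k x hx).1 i
  have hB := fun i => exists_borel_sum (a := fun k => a k i) hρs (fun k => has k i)
    fun k => hχc.mul_right
  choose v hvs hv using hB
  have hρ0 : frontier M ⊆ {x | ρ x = 0} := fun x hx => (hρ x hx).eq_zero
  refine ⟨fun x i => v i x, hvs, fun x hx => funext fun i => ?_, fun K i => ?_⟩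
  · have := (hv i 0).eq_zero (hρ0 hx)
    simpa using this
  set V : CovectorField := fun x i => ∑ k ∈ Finset.range K, ρ x ^ (k + 1) * a k i x with hV
  have hVs : ∀ i, ContDiff ℝ ∞ fun x => V x i := fun i =>
    ContDiff.sum fun k _ => (hρs.pow _).mul (has k i)
  have hcoeff : ∀ i l m, ∀ x ∈ frontier M, ContDiffAt ℝ ∞ (normalCoeff g ρ i l m) x :=
    fun i l m x hx => contDiffAt_normalCoeff (by simp) (fun i j => (hg i j).contDiffAt)
      (hD.det_ne x (hMD hx)) hρs.contDiffAt i l m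
  have hcoeff0 : ∀ i l, ∀ x ∈ frontier M, ContDiffAt ℝ ∞ (normalCoeffZero g ρ i l) x :=
    fun i l x hx => contDiffAt_normalCoeffZero (by simp) (fun i j => (hg i j).contDiffAt)
      (hD.det_ne x (hMD hx)) hρs.contDiffAt i l
  -- the tail of the expansion
  have h1 : VanishesOn (frontier M) K
      (firstOrderOp (normalCoeff g ρ i) (normalCoeffZero g ρ i) fun x l => v l x - V x l) :=
    vanishesOn_firstOrderOp (hcoeff i) (hcoeff0 i)
      (fun l x _ => ((hvs l).sub (hVs l)).contDiffAt) fun l => (hv l K).mono_set hρ0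
  -- the remainder of the partial sum
  have h2 : VanishesOn (frontier M) K fun x => ρ x ^ K * gaugeRem g ρ f K x i :=
    VanishesOn.pow_mul (fun x _ => hρs.contDiffAt) (fun x hx => (hgs K x (hMD hx)).2 i)
      (fun x hx => hρ0 hx) K
  refine (VanishesOn.sub (fun x hx => (hρs.contDiffAt.pow K).mul ((hgs K x (hMD hx)).2 i))
    (fun x hx => contDiffAt_firstOrderOp (by simp) (fun l m => hcoeff i l m x hx)
      (fun l => hcoeff0 i l x hx) fun l => ((hvs l).sub (hVs l)).contDiffAt) h2 h1).congr
    fun x hx => ?_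
  have hχx : ∀ᶠ y in 𝓝 x, χ y = 1 := hχ1.filter_mono (nhds_le_nhdsSet hx)
  filter_upwards [hχx.eventually_nhds, hD.isOpen.mem_nhds (hMD hx)] with y hy hyD
  have e1 : normalPart g ρ (dB univ g V) y i
      = normalPart g ρ f y i - ρ y ^ K * gaugeRem g ρ f K y i := by
    rw [← normalPart_dB_partialSum hD (by simp) (by simp) K hyD i, normalPart_dB, normalPart_dB]
    refine firstOrderOp_congr fun l => ?_
    filter_upwards [hy] with z hz
    simp [hV, ha, hz]
  rw [normalPart_sub, firstOrderOp_sub (v := fun x l => v l x)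
    (fun l => (hvs l).differentiable (by simp) y) (fun l => (hVs l).differentiable (by simp) y),
    ← normalPart_dB, ← normalPart_dB, e1]
  ring

/-! ### Linear algebra at a boundary point -/

open Matrix in
theorem sum_mul_inv_entries {g : Matrix (Fin 3) (Fin 3) ℝ} (hg : g.PosDef) :
    ∑ i, ∑ j, g i j * g⁻¹ i j = 3 := by
  have hsym : gᵀ = g := by
    have := hg.isHermitian
    rwa [Matrix.IsHermitian, Matrix.conjTranspose_eq_transpose_of_trivial] at this
  have h3 : ∀ i, ∑ j, g i j * g⁻¹ i j = (g * g⁻¹) i i := by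
    intro i
    rw [Matrix.mul_apply]
    refine Finset.sum_congr rfl fun j _ => ?_
    have : g⁻¹ᵀ = g⁻¹ := by rw [transpose_nonsing_inv, hsym]
    rw [← this, transpose_apply, this]
  simp only [h3, mul_nonsing_inv _ (isUnit_iff_ne_zero.2 hg.det_pos.ne')]
  simp

open Matrix in
/-- A trace-free bilinear form `c` with `c(·, N) = 0`, where `N = g⁻¹ n`, and `c(η, ξ) = 0` for `ξ`
tangent and `η` orthogonal to `ξ`, vanishes: on the tangent plane it is a multiple of `g`, and the
trace kills the multiple. -/
theorem eq_zero_of_tangential {g c : Matrix (Fin 3) (Fin 3) ℝ} {n : R3} (hg : g.PosDef) (hn : n ≠ 0)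
    (hN : c *ᵥ (g⁻¹ *ᵥ n) = 0)
    (ht : ∀ ξ η : R3, n ⬝ᵥ ξ = 0 → η ⬝ᵥ g *ᵥ ξ = 0 → η ⬝ᵥ c *ᵥ ξ = 0)
    (htr : ∑ i, ∑ j, c i j * g⁻¹ i j = 0) : c = 0 := by
  have hdet : IsUnit g.det := isUnit_iff_ne_zero.2 hg.det_pos.ne'
  have hsym : gᵀ = g := by
    have := hg.isHermitian
    rwa [Matrix.IsHermitian, Matrix.conjTranspose_eq_transpose_of_trivial] at this
  have hcomm : ∀ a b : R3, a ⬝ᵥ g *ᵥ b = b ⬝ᵥ g *ᵥ a := by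
    intro a b
    rw [dotProduct_mulVec, ← mulVec_transpose, hsym, dotProduct_comm]
  have hpos : ∀ a : R3, a ≠ 0 → 0 < a ⬝ᵥ g *ᵥ a := by
    intro a ha
    simpa using hg.dotProduct_mulVec_pos ha
  set N : R3 := g⁻¹ *ᵥ n with hNdef
  have hgN : g *ᵥ N = n := by
    rw [hNdef, mulVec_mulVec, mul_nonsing_inv _ hdet, one_mulVec]
  have hN0 : N ≠ 0 := by
    intro h; rw [h, mulVec_zero] at hgN; exact hn hgN.symm
  -- two independent equations in three unknowns
  have hker : ∀ a b : R3, ∃ u : R3, u ≠ 0 ∧ a ⬝ᵥ u = 0 ∧ b ⬝ᵥ u = 0 := by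
    intro a b
    have hd : (Matrix.of ![a, b, 0]).det = 0 := by simp [det_fin_three]
    obtain ⟨u, hu, h⟩ := exists_mulVec_eq_zero_iff.2 hd
    exact ⟨u, hu, by simpa [mulVec] using congrFun h 0, by simpa [mulVec] using congrFun h 1⟩
  obtain ⟨ξ₁, h1, hn1, -⟩ := hker n 0
  obtain ⟨ξ₂, h2, hn2, h12⟩ := hker n (g *ᵥ ξ₁)
  have h21 : ξ₂ ⬝ᵥ g *ᵥ ξ₁ = 0 := by rw [dotProduct_comm]; exact h12
  have h12' : ξ₁ ⬝ᵥ g *ᵥ ξ₂ = 0 := by rw [hcomm]; exact h21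
  set α := ξ₁ ⬝ᵥ g *ᵥ ξ₁ with hα
  set β := ξ₂ ⬝ᵥ g *ᵥ ξ₂ with hβ
  set σ := N ⬝ᵥ g *ᵥ N with hσ
  have hαp : 0 < α := hpos _ h1
  have hβp : 0 < β := hpos _ h2
  have hσp : 0 < σ := hpos _ hN0
  have hnN : n ⬝ᵥ N = σ := by rw [hσ, hgN, dotProduct_comm]
  have hNg1 : N ⬝ᵥ g *ᵥ ξ₁ = 0 := by rw [hcomm, hgN, dotProduct_comm]; exact hn1
  have hNg2 : N ⬝ᵥ g *ᵥ ξ₂ = 0 := by rw [hcomm, hgN, dotProduct_comm]; exact hn2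
  have hgN1 : ξ₁ ⬝ᵥ g *ᵥ N = 0 := by rw [hcomm]; exact hNg1
  have hgN2 : ξ₂ ⬝ᵥ g *ᵥ N = 0 := by rw [hcomm]; exact hNg2
  have c12 : ξ₁ ⬝ᵥ c *ᵥ ξ₂ = 0 := ht _ _ hn2 h12'
  have c21 : ξ₂ ⬝ᵥ c *ᵥ ξ₁ = 0 := ht _ _ hn1 h21
  have cN1 : N ⬝ᵥ c *ᵥ ξ₁ = 0 := ht _ _ hn1 hNg1
  have cN2 : N ⬝ᵥ c *ᵥ ξ₂ = 0 := ht _ _ hn2 hNg2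
  have cdiag : ξ₁ ⬝ᵥ c *ᵥ ξ₁ * β = ξ₂ ⬝ᵥ c *ᵥ ξ₂ * α := by
    have := ht (β • ξ₁ - α • ξ₂) (ξ₁ + ξ₂)
      (by rw [dotProduct_sub, dotProduct_smul, dotProduct_smul, hn1, hn2]; simp)
      (by
        simp only [mulVec_sub, mulVec_smul, add_dotProduct, dotProduct_sub, dotProduct_smul,
          smul_eq_mul, h21, h12', ← hα, ← hβ]
        ring)
    simp only [mulVec_sub, mulVec_smul, add_dotProduct, dotProduct_sub, dotProduct_smul,
      smul_eq_mul, c12, c21] at this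
    linarith
  set l := ξ₁ ⬝ᵥ c *ᵥ ξ₁ / α with hl
  have c11 : ξ₁ ⬝ᵥ c *ᵥ ξ₁ = l * α := by rw [hl]; field_simp
  have c22 : ξ₂ ⬝ᵥ c *ᵥ ξ₂ = l * β := by
    rw [hl, div_mul_eq_mul_div, cdiag]; field_simp
  -- in the basis `ξ₁, ξ₂, N` one reads off `c = l (g - n ⊗ n / σ)`
  set e : Matrix (Fin 3) (Fin 3) ℝ := c - l • g + (l / σ) • vecMulVec n n with he
  have hee : ∀ a b : R3, a ⬝ᵥ e *ᵥ b
      = a ⬝ᵥ c *ᵥ b - l * (a ⬝ᵥ g *ᵥ b) + (l / σ) * ((n ⬝ᵥ a) * (n ⬝ᵥ b)) := by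
    intro a b
    rw [he, add_mulVec, sub_mulVec, smul_mulVec, smul_mulVec, vecMulVec_mulVec]
    simp only [dotProduct_add, dotProduct_sub, dotProduct_smul, smul_eq_mul, dotProduct_comm a n,
      MulOpposite.smul_eq_mul_unop, MulOpposite.unop_op]
  set Q : Matrix (Fin 3) (Fin 3) ℝ := Matrix.of ![ξ₁, ξ₂, N] with hQ
  have q0 : Q 0 = ξ₁ := rfl
  have q1 : Q 1 = ξ₂ := rfl
  have q2 : Q 2 = N := rfl
  have hQent : ∀ (A : Matrix (Fin 3) (Fin 3) ℝ) i j,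
      (Q * A * Qᵀ) i j = Q i ⬝ᵥ A *ᵥ Q j := by
    intro A i j
    rw [Matrix.mul_assoc, Matrix.mul_apply_eq_vecMul, vecMul_eq_sum] 
    simp [dotProduct, Matrix.mulVec, Matrix.mul_apply, Finset.sum_apply, Matrix.transpose_apply]
  have hQg : Q * g * Qᵀ = Matrix.diagonal ![α, β, σ] := by
    ext i j
    rw [hQent]
    fin_cases i <;> fin_cases j <;>
      simp [q0, q1, q2, h12', h21, hNg1, hNg2, hgN1, hgN2, ← hα, ← hβ, ← hσ]
  have hQe : Q * e * Qᵀ = 0 := by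
    ext i j
    rw [hQent, hee]
    fin_cases i <;> fin_cases j <;>
      simp [q0, q1, q2, h12', h21, hNg1, hNg2, hgN1, hgN2, ← hα, ← hβ, ← hσ, c11, c22, c12, c21,
        cN1, cN2, hn1, hn2, hnN, hN]
    field_simp
    ring
  have hQdet : IsUnit Q.det := by
    rw [isUnit_iff_ne_zero]
    intro h0
    have := congrArg Matrix.det hQg
    rw [det_mul, det_mul, h0, zero_mul, zero_mul, det_diagonal, Fin.prod_univ_three] at this
    simp at this
    rcases this with (h | h) | h
    · exact hαp.ne' h
    · exact hβp.ne' h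
    · exact hσp.ne' h
  have hQdet' : IsUnit Qᵀ.det := by rwa [det_transpose]
  have he0 : e = 0 := by
    have h3 : Q⁻¹ * (Q * e * Qᵀ) * Qᵀ⁻¹ = e := by
      rw [Matrix.mul_assoc Q, nonsing_inv_mul_cancel_left _ _ hQdet,
        mul_nonsing_inv_cancel_right _ _ hQdet']
    rw [← h3, hQe, Matrix.mul_zero, Matrix.zero_mul]
  have hc : c = l • g - (l / σ) • vecMulVec n n := by
    have : c - l • g + (l / σ) • vecMulVec n n = 0 := he0
    rw [← sub_eq_zero, ← this]
    abel
  have hgg := sum_mul_inv_entries hg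
  have hnn : ∑ i, ∑ j, vecMulVec n n i j * g⁻¹ i j = σ := by
    rw [← hnN, hNdef]
    simp only [dotProduct, mulVec, vecMulVec_apply, Finset.mul_sum]
    exact Finset.sum_congr rfl fun i _ => Finset.sum_congr rfl fun j _ => by ring
  have hl0 : l = 0 := by
    have h4 : ∑ i, ∑ j, c i j * g⁻¹ i j = l * 3 - (l / σ) * σ := by
      have hcij : ∀ i j, c i j * g⁻¹ i j
          = l * (g i j * g⁻¹ i j) - (l / σ) * (vecMulVec n n i j * g⁻¹ i j) := by
        intro i j
        have : c i j = l * g i j - (l / σ) * vecMulVec n n i j := by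
          conv_lhs => rw [hc]
          simp
        rw [this]; ring
      simp only [hcij, Finset.sum_sub_distrib, ← Finset.mul_sum]
      rw [hgg, hnn]
    rw [htr, div_mul_cancel₀ _ hσp.ne'] at h4
    linarith
  rw [hc, hl0]
  simp

/-! ### Covectors vanishing on the boundary have zero mixed ray transform -/

section curves

variable {G : TensorField} {T : ℝ} {γ w a b : ℝ → R3} {v : CovectorField}

theorem christoffel_symm (hs : ∀ x i j, G x i j = G x j i) (x : R3) (k i j : Fin 3) :
    christoffel univ G x k i j = christoffel univ G x k j i := by
  have e : (fun y => G y j i) = fun y => G y i j := funext fun y => hs y j i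
  simp only [christoffel, e]
  congr 1
  exact Finset.sum_congr rfl fun l _ => by ring

/-- The Christoffel symbols with the upper index lowered. -/
theorem sum_mul_christoffel {x : R3} (hdet : (G x).det ≠ 0) (l i j : Fin 3) :
    ∑ k, G x l k * christoffel univ G x k i j = 1 / 2 *
      (𝜕 (fun y => G y j l) i x + 𝜕 (fun y => G y i l) j x - 𝜕 (fun y => G y i j) l x) := by
  set B : R3 := fun l =>
    𝜕 (fun y => G y j l) i x + 𝜕 (fun y => G y i l) j x - 𝜕 (fun y => G y i j) l x with hB
  have h1 : ∀ k, christoffel univ G x k i j = 1 / 2 * ((G x)⁻¹.mulVec B) k := fun k => rfl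
  have h2 : (G x).mulVec ((G x)⁻¹.mulVec B) = B := by
    rw [Matrix.mulVec_mulVec, Matrix.mul_nonsing_inv _ (isUnit_iff_ne_zero.2 hdet),
      Matrix.one_mulVec]
  have h3 := congrFun h2 l
  rw [Matrix.mulVec, dotProduct] at h3
  change _ = 1 / 2 * B l
  rw [← h3, Finset.mul_sum]
  exact Finset.sum_congr rfl fun k _ => by rw [h1]; ring

theorem hasDerivWithinAt_comp_curve {F : R3 → ℝ} {s : Set ℝ} {t : ℝ} {u : R3}
    (hF : DifferentiableAt ℝ F (γ t))
    (hγ : ∀ k, HasDerivWithinAt (fun s => γ s k) (u k) s t) :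
    HasDerivWithinAt (fun s => F (γ s)) (∑ l, 𝜕 F l (γ t) * u l) s t := by
  have h := hF.hasFDerivAt.comp_hasDerivWithinAt t (hasDerivWithinAt_pi.2 hγ)
  exact h.congr_deriv (by
    rw [fderiv_eq_sum]
    exact Finset.sum_congr rfl fun _ _ => mul_comm _ _)

/-- Parallel translation preserves the inner product. -/
theorem hasDerivWithinAt_innerG (hG : ∀ i j x, DifferentiableAt ℝ (fun y => G y i j) x)
    (hs : ∀ x i j, G x i j = G x j i) {t : ℝ} (ht : t ∈ Icc 0 T) (hdet : (G (γ t)).det ≠ 0)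
    (hγ : ∀ k, HasDerivWithinAt (fun s => γ s k) (w t k) (Icc 0 T) t)
    (ha : IsParallel univ G T γ w a) (hb : IsParallel univ G T γ w b) :
    HasDerivWithinAt (fun s => innerG G (γ s) (a s) (b s)) 0 (Icc 0 T) t := by
  set Γ : Fin 3 → Fin 3 → Fin 3 → ℝ := christoffel univ G (γ t) with hΓ
  set D : Fin 3 → Fin 3 → Fin 3 → ℝ := fun l i j => 𝜕 (fun y => G y i j) l (γ t) with hD
  have hDs : ∀ l i j, D l i j = D l j i := fun l i j => by
    have e : (fun y => G y i j) = fun y => G y j i := funext fun y => hs y i j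
    simp only [hD, e]
  have hlow : ∀ l i j, ∑ k, G (γ t) l k * Γ k i j = 1 / 2 * (D i j l + D j i l - D l i j) :=
    fun l i j => sum_mul_christoffel hdet l i j
  have h : HasDerivWithinAt (fun s => innerG G (γ s) (a s) (b s))
      (∑ i, ∑ j, (((∑ l, D l i j * w t l) * a t i
        + G (γ t) i j * (-∑ p, ∑ q, Γ i p q * w t p * a t q)) * b t j
        + G (γ t) i j * a t i * (-∑ p, ∑ q, Γ j p q * w t p * b t q))) (Icc 0 T) t := by
    unfold innerG
    refine HasDerivWithinAt.fun_sum fun i _ => HasDerivWithinAt.fun_sum fun j _ => ?_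
    exact ((hasDerivWithinAt_comp_curve (hG i j (γ t)) hγ).mul (ha t ht i)).mul (hb t ht j)
  have e1 : ∀ c d : R3, ∑ i, ∑ j, G (γ t) i j * (-∑ p, ∑ q, Γ i p q * w t p * c q) * d j
      = -∑ j, ∑ p, ∑ q, (1 / 2 * (D p q j + D q p j - D j p q)) * (w t p * c q * d j) := by
    intro c d
    simp only [← hlow]
    simp only [hs (γ t) 1 0, hs (γ t) 2 0, hs (γ t) 2 1, Fin.sum_univ_three]
    ring
  have e2 : ∑ i, ∑ j, G (γ t) i j * a t i * (-∑ p, ∑ q, Γ j p q * w t p * b t q)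
      = ∑ i, ∑ j, G (γ t) i j * (-∑ p, ∑ q, Γ i p q * w t p * b t q) * a t j := by
    rw [Finset.sum_comm]
    refine Finset.sum_congr rfl fun i _ => Finset.sum_congr rfl fun j _ => ?_
    rw [hs (γ t) j i]; ring
  convert h using 1
  simp only [add_mul, Finset.sum_add_distrib, e2, e1]
  simp only [Fin.sum_univ_three]
  simp only [hDs _ 1 0, hDs _ 2 0, hDs _ 2 1]
  ring

/-- Along a curve, the derivative of `v(η)` for a parallel `η` is `(d' v)(η, γ')`. -/
theorem hasDerivWithinAt_pairing (hs : ∀ x i j, G x i j = G x j i)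
    (hv : ∀ i x, DifferentiableAt ℝ (fun y => v y i) x) {t : ℝ} (ht : t ∈ Icc 0 T)
    (hγ : ∀ k, HasDerivWithinAt (fun s => γ s k) (w t k) (Icc 0 T) t)
    (ha : IsParallel univ G T γ w a) :
    HasDerivWithinAt (fun s => ∑ i, v (γ s) i * a s i)
      (∑ i, ∑ j, covDeriv univ G v (γ t) i j * a t i * w t j) (Icc 0 T) t := by
  have h : HasDerivWithinAt (fun s => ∑ i, v (γ s) i * a s i)
      (∑ i, ((∑ l, 𝜕 (fun y => v y i) l (γ t) * w t l) * a t i + v (γ t) i *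
        (-∑ p, ∑ q, christoffel univ G (γ t) i p q * w t p * a t q))) (Icc 0 T) t :=
    HasDerivWithinAt.fun_sum fun i _ =>
      (hasDerivWithinAt_comp_curve (hv i (γ t)) hγ).mul (ha t ht i)
  convert h using 1
  have e : ∀ k p q, christoffel univ G (γ t) k p q = christoffel univ G (γ t) k q p :=
    christoffel_symm hs (γ t)
  simp only [covDeriv, Fin.sum_univ_three]
  simp only [e _ 1 0, e _ 2 0, e _ 2 1]
  ring

theorem continuousOn_of_isParallel (ha : IsParallel univ G T γ w a) : ContinuousOn a (Icc 0 T) :=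
  continuousOn_pi.2 fun k t ht => (ha t ht k).continuousWithinAt

theorem isParallel_congr {M : Set R3} {g : TensorField} (hM : UniqueDiffOn ℝ M)
    (hG : ∀ i j x, DifferentiableAt ℝ (fun y => G y i j) x) (h : EqOn g G M)
    (hγ : ∀ t ∈ Icc 0 T, γ t ∈ M) :
    IsParallel M g T γ w a ↔ IsParallel univ G T γ w a := by
  have e : ∀ t ∈ Icc 0 T, ∀ k i j, christoffel M g (γ t) k i j = christoffel univ G (γ t) k i j :=
    fun t ht k i j => christoffel_eq_of_eqOn hM isOpen_univ ⟨hγ t ht, mem_univ _⟩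
      (fun i j => hG i j _) (by simpa using h) k i j
  refine forall₂_congr fun t ht => forall_congr' fun k => ?_
  simp only [e t ht]

end curves

/-- The mixed ray transform of `d^𝓑 v` is zero when `v` vanishes on the boundary: the integrand is
the derivative of `v(η)` along the ray, the trace part being killed by `η ⊥ γ'`. -/
theorem mixedRayTransform_sub_dB {M : Set R3} {g f G F : TensorField} {v : CovectorField}
    (hM : UniqueDiffOn ℝ M) (hMc : IsClosed M) (hG : ∀ i j, ContDiff ℝ ∞ fun x => G x i j)
    (hs : ∀ x i j, G x i j = G x j i) (hdet : ∀ x ∈ M, (G x).det ≠ 0) (hgG : EqOn g G M)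
    (hF : ∀ i j, ContDiff ℝ ∞ fun x => F x i j) (hfF : EqOn f F M)
    (hv : ∀ i, ContDiff ℝ ∞ fun x => v x i) (hv0 : ∀ x ∈ frontier M, v x = 0)
    (hLf : MixedRayTransformVanishes M g f) :
    MixedRayTransformVanishes M g (fun x i j => F x i j - dB univ G v x i j) := by
  intro x ξ η hx hηξ r
  have hGd : ∀ i j x, DifferentiableAt ℝ (fun y => G y i j) x := fun i j x =>
    (hG i j).contDiffAt.differentiableAt (by simp)
  have hvd : ∀ i x, DifferentiableAt ℝ (fun y => v y i) x := fun i x =>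
    (hv i).contDiffAt.differentiableAt (by simp)
  have hmem := r.geodesic.mem
  have hpar : IsParallel univ G r.τ r.γ r.vel r.par :=
    (isParallel_congr hM hGd hgG hmem).1 r.parallel
  have hvel : IsParallel univ G r.τ r.γ r.vel r.vel :=
    (isParallel_congr hM hGd hgG hmem).1 r.geodesic.acceleration
  have cγ : ContinuousOn r.γ (Icc 0 r.τ) :=
    continuousOn_pi.2 fun k t ht => (r.geodesic.velocity t ht k).continuousWithinAt
  have cp := continuousOn_of_isParallel hpar
  have cv := continuousOn_of_isParallel hvel
  have h0 : (0 : ℝ) ∈ Icc 0 r.τ := ⟨le_rfl, r.τ_pos.le⟩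
  have h1 : r.τ ∈ Icc 0 r.τ := ⟨r.τ_pos.le, le_rfl⟩
  have hIci : ∀ t ∈ Ico 0 r.τ, Icc 0 r.τ ∈ 𝓝[≥] t := fun t ht =>
    mem_of_superset (Icc_mem_nhdsGE ht.2) (Icc_subset_Icc_left ht.1)
  -- `η` stays orthogonal to the velocity
  have horth : ∀ t ∈ Icc 0 r.τ, innerG G (r.γ t) (r.par t) (r.vel t) = 0 := by
    have hd : ∀ t ∈ Icc 0 r.τ, HasDerivWithinAt
        (fun s => innerG G (r.γ s) (r.par s) (r.vel s)) 0 (Icc 0 r.τ) t := fun t ht =>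
      hasDerivWithinAt_innerG hGd hs ht (hdet _ (hmem t ht)) (r.geodesic.velocity t ht) hpar hvel
    intro t ht
    rw [constant_of_has_deriv_right_zero (fun t ht => (hd t ht).continuousWithinAt)
      (fun t ht => (hd t (Ico_subset_Icc_self ht)).mono_of_mem_nhdsWithin (hIci t ht)) t ht]
    rw [r.γ_zero, r.par_zero, r.vel_zero, ← hηξ]
    simp only [innerG, hgG (hMc.frontier_subset hx.1)]
  have hcont : ∀ B : TensorField, (∀ y ∈ M, ∀ i j, ContinuousAt (fun y => B y i j) y) →
      ContinuousOn (fun t => ∑ i, ∑ j, B (r.γ t) i j * r.par t i * r.vel t j) (Icc 0 r.τ) := by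
    intro B hB
    refine continuousOn_finsetSum _ fun i _ => continuousOn_finsetSum _ fun j _ => ?_
    refine ContinuousOn.mul (ContinuousOn.mul (fun t ht => ?_) ?_) ?_
    · exact (hB _ (hmem t ht) i j).comp_continuousWithinAt (cγ t ht)
    · exact (continuous_apply i).comp_continuousOn cp
    · exact (continuous_apply j).comp_continuousOn cv
  have hII : ∀ B : TensorField, (∀ y ∈ M, ∀ i j, ContinuousAt (fun y => B y i j) y) →
      IntervalIntegrable (fun t => ∑ i, ∑ j, B (r.γ t) i j * r.par t i * r.vel t j)
        MeasureTheory.volume 0 r.τ := fun B hB =>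
    ContinuousOn.intervalIntegrable (by rw [uIcc_of_le r.τ_pos.le]; exact hcont B hB)
  have hdBc : ∀ y ∈ M, ∀ i j, ContinuousAt (fun y => dB univ G v y i j) y := fun y hy i j =>
    (contDiffAt_dB (n := ∞) (by simp) (fun i j => (hG i j).contDiffAt) (hdet y hy)
      (fun i => (hv i).contDiffAt) i j).continuousAt
  have hFc : ∀ y ∈ M, ∀ i j, ContinuousAt (fun y => F y i j) y := fun y _ i j =>
    (hF i j).continuous.continuousAt
  have hdB : ∫ t in (0 : ℝ)..r.τ, ∑ i, ∑ j, dB univ G v (r.γ t) i j * r.par t i * r.vel t j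
      = 0 := by
    have hd : ∀ t ∈ Icc 0 r.τ, HasDerivWithinAt (fun s => ∑ i, v (r.γ s) i * r.par s i)
        (∑ i, ∑ j, dB univ G v (r.γ t) i j * r.par t i * r.vel t j) (Icc 0 r.τ) t := by
      intro t ht
      convert hasDerivWithinAt_pairing hs hvd ht (r.geodesic.velocity t ht) hpar using 1
      have h := horth t ht
      simp only [innerG] at h
      simp only [dB, traceFreePart, sub_mul, Finset.sum_sub_distrib]
      rw [sub_eq_self]
      have : ∀ i j, 1 / 3 * trace G (covDeriv univ G v) (r.γ t) * G (r.γ t) i j * r.par t i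
          * r.vel t j = 1 / 3 * trace G (covDeriv univ G v) (r.γ t)
            * (G (r.γ t) i j * r.par t i * r.vel t j) := fun i j => by ring
      simp only [this, ← Finset.mul_sum, h, mul_zero]
    rw [intervalIntegral.integral_eq_sub_of_hasDeriv_right_of_le
      (f := fun s => ∑ i, v (r.γ s) i * r.par s i) r.τ_pos.le
      (fun t ht => (hd t ht).continuousWithinAt)
      (fun t ht => ((hd t (Ioo_subset_Icc_self ht)).mono_of_mem_nhdsWithin
        (hIci t ⟨ht.1.le, ht.2⟩)).Ioi_of_Ici) (hII _ hdBc)]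
    simp [r.γ_zero, hv0 _ r.exit, hv0 _ hx.1]
  have hF0 : ∫ t in (0 : ℝ)..r.τ, ∑ i, ∑ j, F (r.γ t) i j * r.par t i * r.vel t j = 0 := by
    refine Eq.trans ?_ (hLf x ξ η hx hηξ r)
    unfold mixedRayTransform
    refine intervalIntegral.integral_congr fun t ht => ?_
    rw [uIcc_of_le r.τ_pos.le] at ht
    simp only [hfF (hmem t ht)]
  simp only [mixedRayTransform, sub_mul, Finset.sum_sub_distrib]
  rw [intervalIntegral.integral_sub (hII _ hFc) (hII _ hdBc), hF0, hdB, sub_zero]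

/-! ### Short geodesics near a tangential direction -/

section exit_time

variable {φ ψ θ : ℝ → ℝ} {d : ℝ}

theorem strictAntiOn_of_hasDerivAt (hφ : ∀ t ∈ Icc 0 d, HasDerivAt φ (ψ t) t)
    (hneg : ∀ t ∈ Ioo 0 d, ψ t < 0) : StrictAntiOn φ (Icc 0 d) := by
  refine strictAntiOn_of_deriv_neg (convex_Icc 0 d)
    (fun t ht => (hφ t ht).continuousAt.continuousWithinAt) fun t ht => ?_
  rw [interior_Icc] at ht
  rw [(hφ t (Ioo_subset_Icc_self ht)).deriv]
  exact hneg t ht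

theorem neg_of_deriv_eq_zero (hd : 0 < d) (hφ : ∀ t ∈ Icc 0 d, HasDerivAt φ (ψ t) t)
    (hψ : ∀ t ∈ Icc 0 d, HasDerivAt ψ (θ t) t) (hθ : ∀ t ∈ Icc 0 d, θ t < 0) (h0 : φ 0 = 0)
    (h1 : ψ 0 = 0) : φ d < 0 := by
  have hm : (0 : ℝ) ∈ Icc 0 d := ⟨le_rfl, hd.le⟩
  have ha := strictAntiOn_of_hasDerivAt hψ fun t ht => hθ t (Ioo_subset_Icc_self ht)
  have hb := strictAntiOn_of_hasDerivAt hφ fun t ht => by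
    have := ha hm (Ioo_subset_Icc_self ht) ht.1
    rwa [h1] at this
  have := hb hm ⟨hd.le, le_rfl⟩ hd
  rwa [h0] at this

/-- A strictly concave function which leaves `0` upwards and is negative at `d` is positive up to
a time in between, at which it returns to `0`. -/
theorem exists_exit_time (hd : 0 < d) (hφ : ∀ t ∈ Icc 0 d, HasDerivAt φ (ψ t) t)
    (hψ : ∀ t ∈ Icc 0 d, HasDerivAt ψ (θ t) t) (hθ : ∀ t ∈ Icc 0 d, θ t < 0) (h0 : φ 0 = 0)
    (h1 : 0 < ψ 0) (h2 : φ d < 0) : ∃ τ ∈ Ioo 0 d, φ τ = 0 ∧ ∀ t ∈ Ioo 0 τ, 0 < φ t := by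
  have hm : (0 : ℝ) ∈ Icc 0 d := ⟨le_rfl, hd.le⟩
  have hc : ContinuousOn φ (Icc 0 d) := fun t ht => (hφ t ht).continuousAt.continuousWithinAt
  obtain ⟨t₁, ht₁, hpos⟩ : ∃ t₁ ∈ Ioo 0 d, 0 < φ t₁ := by
    have hev : ∀ᶠ t in 𝓝[>] (0 : ℝ), SignType.sign (φ t) = SignType.sign (t - 0) :=
      (eventually_nhdsWithin_sign_eq_of_deriv_pos (by rwa [(hφ 0 hm).deriv]) h0).filter_mono
        nhdsWithin_le_nhds
    obtain ⟨t, ht, hs⟩ := (hev.and (Ioo_mem_nhdsGT hd)).exists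
    refine ⟨t, hs, ?_⟩
    rwa [sub_zero, sign_pos hs.1, sign_eq_one_iff] at ht
  obtain ⟨τ, hτ, hτ0⟩ : (0 : ℝ) ∈ φ '' Icc t₁ d :=
    intermediate_value_Icc' ht₁.2.le (hc.mono (Icc_subset_Icc_left ht₁.1.le)) ⟨h2.le, hpos.le⟩
  have hτ1 : t₁ < τ := lt_of_le_of_ne hτ.1 fun h => by rw [h, hτ0] at hpos; exact hpos.false
  have hτ2 : τ < d := lt_of_le_of_ne hτ.2 fun h => by rw [← h, hτ0] at h2; exact h2.false
  have hτp : 0 < τ := ht₁.1.trans hτ1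
  refine ⟨τ, ⟨hτp, hτ2⟩, hτ0, fun t ht => ?_⟩
  have hsc : StrictConcaveOn ℝ (Icc 0 d) φ := by
    refine strictConcaveOn_of_deriv2_neg (convex_Icc 0 d) hc fun t ht => ?_
    rw [interior_Icc] at ht
    have he : deriv φ =ᶠ[𝓝 t] ψ := by
      filter_upwards [isOpen_Ioo.mem_nhds ht] with s hs
      exact (hφ s (Ioo_subset_Icc_self hs)).deriv
    rw [Function.iterate_succ, Function.iterate_one, Function.comp_apply, he.deriv_eq,
      (hψ t (Ioo_subset_Icc_self ht)).deriv]
    exact hθ t (Ioo_subset_Icc_self ht)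
  have := hsc.lt_on_openSegment hm ⟨hτp.le, hτ2.le⟩ hτp.ne (z := t)
    (by rw [openSegment_eq_Ioo hτp]; exact ht)
  simpa [h0, hτ0] using this

end exit_time

/-- The generator of the geodesic flow together with parallel translation, acting on triples
(point, velocity, vector). -/
noncomputable def geodesicField (G : TensorField) (p : R3 × R3 × R3) : R3 × R3 × R3 :=
  (p.2.1, fun k => -∑ i, ∑ j, christoffel univ G p.1 k i j * p.2.1 i * p.2.1 j,
    fun k => -∑ i, ∑ j, christoffel univ G p.1 k i j * p.2.1 i * p.2.2 j)

/-- The second derivative of `ρ` along the geodesic through `x` with velocity `w`. -/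
noncomputable def covHessian (G : TensorField) (ρ : R3 → ℝ) (x w : R3) : ℝ :=
  ∑ l, ((∑ m, 𝜕 (𝜕 ρ l) m x * w m) * w l
    + 𝜕 ρ l x * (-∑ i, ∑ j, christoffel univ G x l i j * w i * w j))

section flow

variable {G : TensorField}

theorem contDiffAt_christoffel_fst (hG : ∀ i j, ContDiff ℝ ∞ fun x => G x i j)
    {Y : Type*} [NormedAddCommGroup Y] [NormedSpace ℝ Y] {p : R3 × Y}
    (hdet : (G p.1).det ≠ 0) (k i j : Fin 3) :
    ContDiffAt ℝ 1 (fun p : R3 × Y => christoffel univ G p.1 k i j) p := by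
  have h : ContDiffAt ℝ ∞ (fun x => christoffel univ G x k i j) p.1 :=
    contDiffAt_christoffel (by simp) (fun i j => (hG i j).contDiffAt) hdet k i j
  have h1 : ContDiffAt ℝ 1 (fun x => christoffel univ G x k i j) p.1 :=
    h.of_le (by exact_mod_cast le_top)
  exact h1.fun_comp p contDiffAt_fst

theorem contDiffAt_geodesicField (hG : ∀ i j, ContDiff ℝ ∞ fun x => G x i j)
    {p : R3 × R3 × R3} (hdet : (G p.1).det ≠ 0) : ContDiffAt ℝ 1 (geodesicField G) p := by
  have h21 : ∀ i, ContDiffAt ℝ 1 (fun p : R3 × R3 × R3 => p.2.1 i) p := fun i => by fun_prop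
  have h22 : ∀ i, ContDiffAt ℝ 1 (fun p : R3 × R3 × R3 => p.2.2 i) p := fun i => by fun_prop
  have hΓ := contDiffAt_christoffel_fst hG hdet
  refine ContDiffAt.prodMk (by fun_prop) (ContDiffAt.prodMk ?_ ?_)
  · exact contDiffAt_pi.2 fun k => (ContDiffAt.sum fun i _ => ContDiffAt.sum fun j _ =>
      ((hΓ k i j).mul (h21 i)).mul (h21 j)).neg
  · exact contDiffAt_pi.2 fun k => (ContDiffAt.sum fun i _ => ContDiffAt.sum fun j _ =>
      ((hΓ k i j).mul (h21 i)).mul (h22 j)).neg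

theorem continuousAt_covHessian (hG : ∀ i j, ContDiff ℝ ∞ fun x => G x i j) {ρ : R3 → ℝ}
    (hρ : ContDiff ℝ ∞ ρ) {p : R3 × R3 × R3} (hdet : (G p.1).det ≠ 0) :
    ContinuousAt (fun p : R3 × R3 × R3 => covHessian G ρ p.1 p.2.1) p := by
  have h21 : ∀ i, ContinuousAt (fun p : R3 × R3 × R3 => p.2.1 i) p := fun i => by fun_prop
  have hΓ : ∀ k i j, ContinuousAt (fun p : R3 × R3 × R3 => christoffel univ G p.1 k i j) p :=
    fun k i j => (contDiffAt_christoffel_fst hG hdet k i j).continuousAt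
  have h1 : ∀ l, ContinuousAt (fun p : R3 × R3 × R3 => 𝜕 ρ l p.1) p := fun l =>
    (contDiffAt_pd hρ.contDiffAt l).continuousAt.comp continuousAt_fst
  have h2 : ∀ l m, ContinuousAt (fun p : R3 × R3 × R3 => 𝜕 (𝜕 ρ l) m p.1) p := fun l m =>
    (contDiffAt_pd (contDiffAt_pd hρ.contDiffAt l) m).continuousAt.comp continuousAt_fst
  unfold covHessian
  fun_prop

/-- The local flow of the geodesic field, jointly continuous in time and initial data. -/
theorem exists_geodesic_flow (hG : ∀ i j, ContDiff ℝ ∞ fun x => G x i j)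
    {p₀ : R3 × R3 × R3} (hdet : (G p₀.1).det ≠ 0) {𝒩 : Set (R3 × R3 × R3)} (h𝒩 : 𝒩 ∈ 𝓝 p₀) :
    ∃ (α : (R3 × R3 × R3) × ℝ → R3 × R3 × R3) (P : Set (R3 × R3 × R3)) (d : ℝ), P ∈ 𝓝 p₀ ∧ 0 < d ∧
      ContinuousOn α (P ×ˢ Icc 0 d) ∧ ∀ p ∈ P, α (p, 0) = p ∧ ∀ t ∈ Icc 0 d, α (p, t) ∈ 𝒩 ∧
        HasDerivAt (fun s => α (p, s)) (geodesicField G (α (p, t))) t := by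
  obtain ⟨ε, hε, a, r, L, K, hr, h⟩ :=
    IsPicardLindelof.of_contDiffAt_one (contDiffAt_geodesicField hG hdet)
  obtain ⟨α, hα, hc⟩ :=
    (h 0).exists_forall_mem_closedBall_eq_hasDerivWithinAt_continuousOn
  simp only [zero_sub, zero_add] at hα hc
  have hr' : (0 : ℝ) < r := by exact_mod_cast hr
  have hp₀ : p₀ ∈ Metric.closedBall p₀ (r : ℝ) := Metric.mem_closedBall_self hr'.le
  have hcat : ContinuousAt α (p₀, 0) := by
    refine hc.continuousAt (prod_mem_nhds (Metric.closedBall_mem_nhds p₀ hr') ?_)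
    exact Icc_mem_nhds (by linarith) hε
  have hev : ∀ᶠ q in 𝓝 p₀ ×ˢ 𝓝 (0 : ℝ), α q ∈ 𝒩 := by
    rw [← nhds_prod_eq]
    exact hcat.preimage_mem_nhds (by rw [(hα p₀ hp₀).1]; exact h𝒩)
  obtain ⟨P, hP, hP'⟩ := (hev.and (prod_mem_prod (Metric.closedBall_mem_nhds p₀ hr')
    (Icc_mem_nhds (a := -ε / 2) (b := ε / 2) (by linarith) (by linarith)))).exists_mem
  obtain ⟨P₁, hP₁, T, hT, hPT⟩ := mem_prod_iff.1 hP
  obtain ⟨d, hd, hdT⟩ := Metric.nhds_basis_closedBall.mem_iff.1 hT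
  have hIcc : ∀ t ∈ Icc 0 d, t ∈ T := fun t ht => hdT (by
    rw [Metric.mem_closedBall, Real.dist_eq, sub_zero, abs_of_nonneg ht.1]; exact ht.2)
  have key : ∀ p ∈ P₁, ∀ t ∈ Icc 0 d, α (p, t) ∈ 𝒩 ∧ p ∈ Metric.closedBall p₀ (r : ℝ) ∧
      t ∈ Icc (-ε / 2) (ε / 2) := fun p hp t ht => by
    have := hP' (p, t) (hPT ⟨hp, hIcc t ht⟩)
    exact ⟨this.1, this.2.1, this.2.2⟩
  refine ⟨α, P₁, d, hP₁, hd, hc.mono ?_, fun p hp => ?_⟩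
  · rintro ⟨p, t⟩ ⟨hp, ht⟩
    obtain ⟨-, h1, h2⟩ := key p hp t ht
    exact ⟨h1, by linarith [h2.1], by linarith [h2.2]⟩
  · have hpr := (key p hp 0 ⟨le_rfl, hd.le⟩).2.1
    refine ⟨(hα p hpr).1, fun t ht => ?_⟩
    obtain ⟨h0, h1, h2⟩ := key p hp t ht
    exact ⟨h0, ((hα p h1).2 t ⟨by linarith [h2.1], by linarith [h2.2]⟩).hasDerivAt
      (Icc_mem_nhds (by linarith [h2.1]) (by linarith [h2.2]))⟩

end flow

theorem innerG_self_pos {G : TensorField} {x a : R3} (h : (G x).PosDef) (ha : a ≠ 0) :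
    0 < innerG G x a a := by
  have := h.dotProduct_mulVec_pos ha
  simp only [star_trivial, dotProduct, Matrix.mulVec, Finset.mul_sum] at this
  simp only [innerG]
  refine lt_of_lt_of_eq this (Finset.sum_congr rfl fun i _ => Finset.sum_congr rfl fun j _ => ?_)
  ring

/-- Unit vectors `ξ'` pointing into `ρ > 0` and vectors `η' ⊥ ξ'` approximating a tangential
unit vector `ξ` and `η ⊥ ξ`. -/
theorem exists_inward_perturbation {G : TensorField} {z ξ η : R3} {l : R3 →L[ℝ] ℝ}
    (hl : l ≠ 0) (hlξ : l ξ = 0)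
    (hξ : innerG G z ξ ξ = 1) (hηξ : innerG G z η ξ = 0) {𝒩 : Set (R3 × R3)} (h𝒩 : 𝒩 ∈ 𝓝 (ξ, η)) :
    ∃ ξ' η', (ξ', η') ∈ 𝒩 ∧ 0 < l ξ' ∧ innerG G z ξ' ξ' = 1 ∧ innerG G z η' ξ' = 0 := by
  obtain ⟨N, hN⟩ : ∃ N, 0 < l N := by
    obtain ⟨N, hN⟩ : ∃ N, l N ≠ 0 := by
      by_contra! h
      exact hl (ContinuousLinearMap.ext h)
    rcases lt_or_gt_of_ne hN with h | h
    · exact ⟨-N, by simpa using h⟩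
    · exact ⟨N, h⟩
  set Q : ℝ → ℝ := fun s => innerG G z (ξ + s • N) (ξ + s • N) with hQ
  have hQc : Continuous Q := by unfold Q innerG; fun_prop
  have hQ0 : Q 0 = 1 := by simp [hQ, hξ]
  set a : ℝ → R3 := fun s => (√(Q s))⁻¹ • (ξ + s • N) with ha
  have ha0 : a 0 = ξ := by simp [ha, hQ0]
  have hac : ContinuousAt a 0 := by
    refine ContinuousAt.smul (ContinuousAt.inv₀ hQc.continuousAt.sqrt ?_) (by fun_prop)
    simp [hQ0]
  set b : ℝ → R3 := fun s => η - innerG G z η (a s) • a s with hb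
  have hb0 : b 0 = η := by simp [hb, ha0, hηξ]
  have hbc : ContinuousAt b 0 := by
    refine continuousAt_const.sub (ContinuousAt.fun_smul ?_ hac)
    have : Continuous fun c => innerG G z η c := by unfold innerG; fun_prop
    exact this.continuousAt.comp hac
  have hev : ∀ᶠ s in 𝓝[>] (0 : ℝ), (a s, b s) ∈ 𝒩 :=
    ((hac.prodMk hbc).eventually_mem (by simpa only [ha0, hb0] using h𝒩)).filter_mono
      nhdsWithin_le_nhds
  have hQev : ∀ᶠ s in 𝓝[>] (0 : ℝ), 0 < Q s :=
    (hQc.continuousAt.eventually_const_lt (by rw [hQ0]; exact one_pos)).filter_mono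
      nhdsWithin_le_nhds
  obtain ⟨s, h1, h2, h3⟩ := (hev.and (hQev.and self_mem_nhdsWithin)).exists
  have haa : innerG G z (a s) (a s) = 1 := by
    have e : innerG G z (a s) (a s) = (√(Q s))⁻¹ * (√(Q s))⁻¹ * Q s := by
      simp only [ha, hQ, innerG, Fin.sum_univ_three, Pi.smul_apply, smul_eq_mul]
      ring
    rw [e, ← mul_inv, Real.mul_self_sqrt h2.le, inv_mul_cancel₀ h2.ne']
  refine ⟨a s, b s, h1, ?_, haa, ?_⟩
  · simp only [ha, map_smul, map_add, hlξ, zero_add, smul_eq_mul]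
    exact mul_pos (inv_pos.2 (Real.sqrt_pos.2 h2)) (mul_pos h3 hN)
  · have e : innerG G z (b s) (a s)
        = innerG G z η (a s) - innerG G z η (a s) * innerG G z (a s) (a s) := by
      simp only [hb, innerG, Fin.sum_univ_three, Pi.sub_apply, Pi.smul_apply, smul_eq_mul]
      ring
    rw [e, haa, mul_one, sub_self]

/-- Strict convexity: near a unit vector `ξ` tangent to the boundary at `z` there are short rays,
which stay as close to `(z, ξ, η)` as desired. -/
theorem exists_short_ray {M O : Set R3} {g G : TensorField} {ρ : R3 → ℝ} {z ξ η : R3}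
    (hM : UniqueDiffOn ℝ M) (hMc : IsClosed M) (hG : ∀ i j, ContDiff ℝ ∞ fun x => G x i j)
    (hgG : EqOn g G M) (hdet : (G z).det ≠ 0) (hρs : ContDiff ℝ ∞ ρ)
    (hρ : IsDefiningFunction ∞ M z O ρ) (hz : z ∈ frontier M)
    (hξ : innerG G z ξ ξ = 1) (hηξ : innerG G z η ξ = 0) (hρξ : fderiv ℝ ρ z ξ = 0)
    (hconv : covHessian G ρ z ξ < 0) {𝒩 : Set (R3 × R3 × R3)} (h𝒩 : 𝒩 ∈ 𝓝 (z, ξ, η)) :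
    ∃ ξ' η', InwardUnit M g z ξ' ∧ innerG g z η' ξ' = 0 ∧ ∃ r : Ray M g z ξ' η',
      (∀ t ∈ Icc 0 r.τ, (r.γ t, r.vel t, r.par t) ∈ 𝒩) ∧ ∀ t ∈ Ioo 0 r.τ, 0 < ρ (r.γ t) := by
  have hzM : z ∈ M := hMc.frontier_subset hz
  have hgz : g z = G z := hgG hzM
  have hGd : ∀ i j x, DifferentiableAt ℝ (fun y => G y i j) x := fun i j x =>
    (hG i j).contDiffAt.differentiableAt (by simp)
  have hρd : ∀ x, DifferentiableAt ℝ ρ x := fun x => hρs.contDiffAt.differentiableAt (by simp)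
  have hρdd : ∀ l x, DifferentiableAt ℝ (𝜕 ρ l) x := fun l x =>
    (contDiffAt_pd hρs.contDiffAt l).differentiableAt (by simp)
  have hfd : Continuous (fderiv ℝ ρ) := hρs.continuous_fderiv (by simp)
  set p₀ : R3 × R3 × R3 := (z, ξ, η) with hp₀
  -- along integral curves staying in this set, `ρ` is strictly concave and locally defines `M`
  have h𝒩' : 𝒩 ∩ ({p | covHessian G ρ p.1 p.2.1 < 0} ∩
      {p : R3 × R3 × R3 | p.1 ∈ O ∧ fderiv ℝ ρ p.1 ≠ 0}) ∈ 𝓝 p₀ := by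
    refine inter_mem h𝒩 (inter_mem ?_ ?_)
    · exact (continuousAt_covHessian (p := p₀) hG hρs hdet).eventually_lt_const hconv
    · refine (continuous_fst.continuousAt (x := p₀)).eventually
        (p := fun x => x ∈ O ∧ fderiv ℝ ρ x ≠ 0) ?_
      exact Filter.Eventually.and (hρ.isOpen.mem_nhds hρ.mem)
        (hfd.continuousAt.eventually_ne hρ.fderiv_ne)
  obtain ⟨α, P, d, hP, hd, hαc, hα⟩ := exists_geodesic_flow hG (p₀ := p₀) hdet h𝒩'
  -- the defining function along an integral curve, with its first two derivatives
  set φ : R3 × R3 × R3 → ℝ → ℝ := fun p t => ρ (α (p, t)).1 with hφ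
  set ψ : R3 × R3 × R3 → ℝ → ℝ := fun p t => ∑ l, 𝜕 ρ l (α (p, t)).1 * (α (p, t)).2.1 l with hψ
  set θ : R3 × R3 × R3 → ℝ → ℝ := fun p t => covHessian G ρ (α (p, t)).1 (α (p, t)).2.1 with hθ
  have hγd : ∀ p ∈ P, ∀ t ∈ Icc 0 d, ∀ k, HasDerivAt (fun s => (α (p, s)).1 k)
      ((α (p, t)).2.1 k) t := fun p hp t ht =>
    hasDerivAt_pi.1 ((ContinuousLinearMap.fst ℝ R3 (R3 × R3)).hasFDerivAt.comp_hasDerivAt t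
      ((hα p hp).2 t ht).2)
  have hwd : ∀ p ∈ P, ∀ t ∈ Icc 0 d, ∀ k, HasDerivAt (fun s => (α (p, s)).2.1 k)
      (-∑ i, ∑ j, christoffel univ G (α (p, t)).1 k i j * (α (p, t)).2.1 i * (α (p, t)).2.1 j)
      t := fun p hp t ht =>
    hasDerivAt_pi.1 (((ContinuousLinearMap.fst ℝ R3 R3).comp
      (ContinuousLinearMap.snd ℝ R3 (R3 × R3))).hasFDerivAt.comp_hasDerivAt t
      ((hα p hp).2 t ht).2)
  have hed : ∀ p ∈ P, ∀ t ∈ Icc 0 d, ∀ k, HasDerivAt (fun s => (α (p, s)).2.2 k)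
      (-∑ i, ∑ j, christoffel univ G (α (p, t)).1 k i j * (α (p, t)).2.1 i * (α (p, t)).2.2 j)
      t := fun p hp t ht =>
    hasDerivAt_pi.1 (((ContinuousLinearMap.snd ℝ R3 R3).comp
      (ContinuousLinearMap.snd ℝ R3 (R3 × R3))).hasFDerivAt.comp_hasDerivAt t
      ((hα p hp).2 t ht).2)
  have hφd : ∀ p ∈ P, ∀ t ∈ Icc 0 d, HasDerivAt (φ p) (ψ p t) t := fun p hp t ht =>
    hasDerivWithinAt_univ.1 (hasDerivWithinAt_comp_curve (hρd _)
      fun k => (hγd p hp t ht k).hasDerivWithinAt)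
  have hψd : ∀ p ∈ P, ∀ t ∈ Icc 0 d, HasDerivAt (ψ p) (θ p t) t := fun p hp t ht =>
    HasDerivAt.fun_sum fun l _ => (hasDerivWithinAt_univ.1 (hasDerivWithinAt_comp_curve (hρdd l _)
      fun k => (hγd p hp t ht k).hasDerivWithinAt)).mul (hwd p hp t ht l)
  have hθn : ∀ p ∈ P, ∀ t ∈ Icc 0 d, θ p t < 0 := fun p hp t ht => ((hα p hp).2 t ht).1.2.1
  have hp₀P : p₀ ∈ P := mem_of_mem_nhds hP
  -- the tangential geodesic leaves `M` at once, hence nearby ones have left `M` by the time `d`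
  have hφ0 : φ p₀ d < 0 := by
    refine neg_of_deriv_eq_zero hd (hφd p₀ hp₀P) (hψd p₀ hp₀P) (hθn p₀ hp₀P) ?_ ?_
    · simp only [hφ, (hα p₀ hp₀P).1]; exact hρ.eq_zero
    · simp only [hψ, hp₀]
      rw [fderiv_eq_sum] at hρξ
      have hα0 : α ((z, ξ, η), 0) = (z, ξ, η) := (hα p₀ hp₀P).1
      simpa only [hα0, mul_comm] using hρξ
  have hφev : ∀ᶠ p in 𝓝 p₀, φ p d < 0 := by
    have h1 : ContinuousOn (fun p => α (p, d)) P :=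
      hαc.comp (by fun_prop) fun p hp => ⟨hp, hd.le, le_rfl⟩
    have h2 : ContinuousAt (fun p => φ p d) p₀ :=
      hρs.continuous.continuousAt.comp (continuousAt_fst.comp (h1.continuousAt hP))
    exact h2.eventually_lt_const hφ0
  obtain ⟨ξ', η', hmem, hl, hu, ho⟩ := exists_inward_perturbation hρ.fderiv_ne hρξ hξ hηξ
    (𝒩 := {q | (z, q) ∈ P ∧ φ (z, q) d < 0})
    (((Continuous.prodMk_right z).continuousAt (x := (ξ, η))).eventually
      (Filter.Eventually.and hP hφev))
  obtain ⟨hpP, hpd⟩ := hmem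
  set p : R3 × R3 × R3 := (z, ξ', η') with hp
  have hα0 : α (p, 0) = p := (hα p hpP).1
  obtain ⟨τ, hτ, hτ0, hτpos⟩ := exists_exit_time hd (hφd p hpP) (hψd p hpP) (hθn p hpP)
    (by simp only [hφ, hα0]; exact hρ.eq_zero)
    (by
      rw [fderiv_eq_sum] at hl
      simp only [hψ, hα0]
      simpa only [mul_comm] using hl) hpd
  have hsub : Icc 0 τ ⊆ Icc 0 d := Icc_subset_Icc_right hτ.2.le
  have hnn : ∀ t ∈ Icc 0 τ, 0 ≤ φ p t := by
    intro t ht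
    rcases eq_or_lt_of_le ht.1 with rfl | h0
    · simp only [hφ, hα0]; exact hρ.eq_zero.ge
    · rcases eq_or_lt_of_le ht.2 with rfl | h1
      · exact hτ0.ge
      · exact (hτpos t ⟨h0, h1⟩).le
  have hO : ∀ t ∈ Icc 0 τ, (α (p, t)).1 ∈ O := fun t ht => ((hα p hpP).2 t (hsub ht)).1.2.2.1
  have hmemM : ∀ t ∈ Icc 0 τ, (α (p, t)).1 ∈ M := fun t ht => (hρ.mem_iff (hO t ht)).2 (hnn t ht)
  have hpc : ∀ a : ℝ → R3, IsParallel univ G τ (fun t => (α (p, t)).1) (fun t => (α (p, t)).2.1) a →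
      IsParallel M g τ (fun t => (α (p, t)).1) (fun t => (α (p, t)).2.1) a := fun a ha =>
    (isParallel_congr hM hGd hgG hmemM).2 ha
  have hτm : τ ∈ Icc 0 τ := ⟨hτ.1.le, le_rfl⟩
  refine ⟨ξ', η', ⟨hz, ?_, O, ρ, hρ, hl⟩, ?_, ⟨τ, fun t => (α (p, t)).1, fun t => (α (p, t)).2.1,
    fun t => (α (p, t)).2.2, hτ.1, ⟨hmemM, fun t ht k => ?_, ?_⟩, ?_, ?_, ?_, ?_, ?_, ?_⟩, ?_, ?_⟩
  · simpa only [innerG, hgz] using hu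
  · simpa only [innerG, hgz] using ho
  · exact (hγd p hpP t (hsub ht) k).hasDerivWithinAt
  · exact hpc _ fun t ht k => (hwd p hpP t (hsub ht) k).hasDerivWithinAt
  · exact hpc _ fun t ht k => (hed p hpP t (hsub ht) k).hasDerivWithinAt
  · rw [hα0]
  · rw [hα0]
  · rw [hα0]
  · exact hρ.mem_frontier_of_eq_zero (hO τ hτm) hτ0 ((hα p hpP).2 τ (hsub hτm)).1.2.2.2
  · intro t ht hfr
    exact hfr.2 (hρ.mem_interior (hO t (Ioo_subset_Icc_self ht)) (hτpos t ht))
  · exact fun t ht => ((hα p hpP).2 t (hsub ht)).1.1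
  · exact hτpos

/-! ### Boundary determination -/

/-- The covariant Hessian of the strict convexity condition is the second derivative of `ρ` along
geodesics. -/
theorem covHessian_neg {M O : Set R3} {g G : TensorField} {ρ : R3 → ℝ} {z ξ : R3}
    (hM : UniqueDiffOn ℝ M) (hMc : IsClosed M) (hG : ∀ i j, ContDiff ℝ ∞ fun x => G x i j)
    (hgG : EqOn g G M) (hρs : ContDiff ℝ ∞ ρ) (hconv : StrictlyConvexBoundary M g)
    (hρ : IsDefiningFunction ∞ M z O ρ) (hz : z ∈ frontier M) (hξ : ξ ≠ 0)
    (hρξ : fderiv ℝ ρ z ξ = 0) : covHessian G ρ z ξ < 0 := by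
  have h := hconv z hz O ρ hρ ξ hξ hρξ
  have e : ∀ k i j, christoffel M g z k i j = christoffel univ G z k i j := fun k i j =>
    christoffel_eq_of_eqOn hM isOpen_univ ⟨hMc.frontier_subset hz, mem_univ _⟩
      (fun i j => (hG i j).contDiffAt.differentiableAt (by simp)) (by simpa using hgG) k i j
  have h1 : fderiv ℝ (fun y => fderiv ℝ ρ y ξ) z ξ = ∑ l, (∑ m, 𝜕 (𝜕 ρ l) m z * ξ m) * ξ l := by
    have : (fun y => fderiv ℝ ρ y ξ) = fun y => ∑ l, ξ l * 𝜕 ρ l y :=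
      funext fun y => fderiv_eq_sum ρ y ξ
    rw [this, fderiv_fun_sum fun l _ => ((contDiffAt_pd hρs.contDiffAt l).differentiableAt
      (by simp)).const_mul _, sum_apply]
    refine Finset.sum_congr rfl fun l _ => ?_
    rw [fderiv_const_mul ((contDiffAt_pd hρs.contDiffAt l).differentiableAt (by simp)), smul_apply,
      fderiv_eq_sum, smul_eq_mul, mul_comm]
    simp only [mul_comm]
  rw [h1] at h
  simp only [e] at h
  refine lt_of_eq_of_lt ?_ h
  simp only [← pd_univ, covHessian, Finset.sum_add_distrib, sub_eq_add_neg]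
  congr 1
  rw [← Finset.sum_neg_distrib]
  refine Finset.sum_congr rfl fun l _ => ?_
  simp only [mul_neg, Finset.mul_sum]
  congr 1
  exact Finset.sum_congr rfl fun i _ => Finset.sum_congr rfl fun j _ => by ring

/-- A point near `z` with `ρ > 0` lies above a zero of `ρ`, in the direction `N`. -/
theorem eventually_exists_zero_below {ρ : R3 → ℝ} {z N : R3} (hρ : Continuous ρ)
    (hd : DifferentiableAt ℝ ρ z) (hz : ρ z = 0) (hN : 0 < fderiv ℝ ρ z N) {V : Set R3}
    (hV : V ∈ 𝓝 z) : ∀ᶠ x in 𝓝 z, 0 < ρ x →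
      ∃ s : ℝ, 0 < s ∧ ρ (x - s • N) = 0 ∧ ∀ t ∈ Icc 0 s, x - s • N + t • N ∈ V := by
  obtain ⟨r, hr, hrV⟩ := Metric.mem_nhds_iff.1 hV
  have hN0 : 0 < ‖N‖ := norm_pos_iff.2 fun h => by simp [h] at hN
  obtain ⟨s₀, hs₀, hs₀r, hneg⟩ : ∃ s₀ > 0, s₀ * ‖N‖ < r / 2 ∧ ρ (z - s₀ • N) < 0 := by
    have h1 : HasDerivAt (fun s : ℝ => ρ (z + s • N)) (fderiv ℝ ρ z N) 0 := by
      have h2 : HasDerivAt (fun s : ℝ => z + s • N) N 0 := by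
        simpa using ((hasDerivAt_id (0 : ℝ)).smul_const N).const_add z
      have h3 : HasFDerivAt ρ (fderiv ℝ ρ z) (z + (0 : ℝ) • N) := by simpa using hd.hasFDerivAt
      exact h3.comp_hasDerivAt 0 h2
    have hev : ∀ᶠ s in 𝓝[<] (0 : ℝ),
        SignType.sign (ρ (z + s • N)) = SignType.sign (s - 0) ∧ -(r / 2 / ‖N‖) < s :=
      ((eventually_nhdsWithin_sign_eq_of_deriv_pos (f := fun s : ℝ => ρ (z + s • N))
        (by rwa [h1.deriv]) (by simpa using hz)).filter_mono nhdsWithin_le_nhds).and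
        ((eventually_gt_nhds (by have : 0 < r / 2 / ‖N‖ := by positivity
                                 linarith)).filter_mono nhdsWithin_le_nhds)
    obtain ⟨s, ⟨h2, h3⟩, h4⟩ := (hev.and self_mem_nhdsWithin).exists
    refine ⟨-s, neg_pos.2 h4, ?_, ?_⟩
    · have := (lt_div_iff₀ hN0).1 (neg_lt.1 h3)
      linarith
    · rw [sub_zero, sign_neg h4, sign_eq_neg_one_iff] at h2
      simpa [sub_eq_add_neg] using h2
  have hev1 : ∀ᶠ x in 𝓝 z, ρ (x - s₀ • N) < 0 :=
    (Continuous.continuousAt (by fun_prop)).eventually_lt_const hneg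
  filter_upwards [hev1, Metric.ball_mem_nhds z (half_pos hr)] with x hx hxr hpos
  have hcont : ContinuousOn (fun s : ℝ => ρ (x - s • N)) (Icc 0 s₀) := by fun_prop
  obtain ⟨s, hs, hs0⟩ : (0 : ℝ) ∈ (fun s : ℝ => ρ (x - s • N)) '' Icc 0 s₀ :=
    intermediate_value_Icc' hs₀.le hcont ⟨hx.le, by simpa using hpos.le⟩
  have hspos : 0 < s := lt_of_le_of_ne hs.1 fun h => by
    rw [← h] at hs0; simp at hs0; exact hpos.ne' hs0
  refine ⟨s, hspos, hs0, fun t ht => hrV ?_⟩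
  rw [mem_ball_iff_norm] at hxr ⊢
  have e : x - s • N + t • N - z = (x - z) - (s - t) • N := by rw [sub_smul]; abel
  rw [e]
  have h5 : ‖(s - t) • N‖ ≤ s₀ * ‖N‖ := by
    rw [norm_smul, Real.norm_of_nonneg (by linarith [ht.2])]
    exact mul_le_mul_of_nonneg_right (by linarith [ht.1, hs.2]) (norm_nonneg _)
  linarith [norm_sub_le (x - z) ((s - t) • N)]

/-- Leading term of a smooth function vanishing to order `k` on the boundary: at a nearby interior
point `x` it equals `(c + o(1)) s^k / k!`, where `c` is its `k`-th derivative in the direction `N`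
and `s` is the height of `x` above the boundary in this direction. The height is the same for all
members of the family `A`. -/
theorem eventually_leading_term {ι : Type*} [Finite ι] {S W : Set R3} {A : ι → R3 → ℝ} {ρ : R3 → ℝ}
    {z N : R3} {k : ℕ} {e : ℝ} (he : 0 < e) (hW : IsOpen W) (hzW : z ∈ W)
    (hA : ∀ i, ∀ x ∈ W, ContDiffAt ℝ ∞ (A i) x)
    (hρs : Continuous ρ) (hd : DifferentiableAt ℝ ρ z) (hz : ρ z = 0)
    (hS : ∀ᶠ x in 𝓝 z, ρ x = 0 → x ∈ S)
    (hN : 0 < fderiv ℝ ρ z N) (hk : ∀ i, VanishesOn S k (A i)) :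
    ∀ᶠ x in 𝓝 z, 0 < ρ x → ∃ s : ℝ, 0 < s ∧ ∀ i, |A i x
      - iteratedFDeriv ℝ k (A i) z (fun _ => N) * s ^ k / k.factorial|
        ≤ e * s ^ k / k.factorial := by
  have hcl : ∀ i, ∀ᶠ x in 𝓝 z, |iteratedFDeriv ℝ k (A i) x (fun _ => N)
      - iteratedFDeriv ℝ k (A i) z (fun _ => N)| < e := by
    intro i
    have h1 : ContinuousAt (iteratedFDeriv ℝ k (A i)) z :=
      ((hA i z hzW).differentiableAt_iteratedFDeriv
        (by exact_mod_cast WithTop.coe_lt_top _)).continuousAt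
    have h2 : ContinuousAt (fun x => iteratedFDeriv ℝ k (A i) x (fun _ => N)) z :=
      (ContinuousMultilinearMap.apply ℝ (fun _ : Fin k => R3) ℝ
        (fun _ => N)).continuous.continuousAt.comp h1
    simpa [Real.dist_eq] using Metric.continuousAt_iff'.1 h2 e he
  have hV := (eventually_all.2 hcl).and (Filter.Eventually.and (hW.mem_nhds hzW) hS)
  filter_upwards [eventually_exists_zero_below hρs hd hz hN hV] with x hx hpos
  obtain ⟨s, hs, hs0, hseg⟩ := hx hpos
  refine ⟨s, hs, fun i => ?_⟩
  have e1 : x - s • N + s • N = x := by simp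
  have hy := hseg 0 ⟨le_rfl, hs.le⟩
  rw [zero_smul, add_zero] at hy
  have := abs_sub_le_of_iteratedFDeriv_segment (F := A i) (y := x - s • N) (u := N) (k := k)
    (c := iteratedFDeriv ℝ k (A i) z (fun _ => N)) (e := e) hs.le
    (fun t ht => hA i _ (hseg t ht).2.1)
    (fun j hj => by rw [hk i j hj _ (hy.2.2 hs0)]; rfl)
    (fun t ht => ((hseg t ht).1 i).le)
  rwa [e1] at this

/-- If the leading term of `A` at `z` is positive on `(η, ξ)`, then `A` is positive at nearby
interior points on nearby vectors. -/
theorem eventually_pos_of_leading_term {S W : Set R3} {A : TensorField} {ρ : R3 → ℝ}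
    {z N ξ η : R3} {k : ℕ} (hW : IsOpen W) (hzW : z ∈ W)
    (hA : ∀ i j, ∀ x ∈ W, ContDiffAt ℝ ∞ (fun x => A x i j) x)
    (hρs : Continuous ρ) (hd : DifferentiableAt ℝ ρ z) (hz : ρ z = 0)
    (hS : ∀ᶠ x in 𝓝 z, ρ x = 0 → x ∈ S)
    (hN : 0 < fderiv ℝ ρ z N) (hk : ∀ i j, VanishesOn S k (fun x => A x i j))
    (hpos : 0 < ∑ i, ∑ j, iteratedFDeriv ℝ k (fun x => A x i j) z (fun _ => N) * η i * ξ j) :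
    ∀ᶠ p : R3 × R3 × R3 in 𝓝 (z, ξ, η), 0 < ρ p.1 →
      0 < ∑ i, ∑ j, A p.1 i j * p.2.2 i * p.2.1 j := by
  set c : Fin 3 → Fin 3 → ℝ := fun i j => iteratedFDeriv ℝ k (fun x => A x i j) z (fun _ => N)
    with hc
  set κ := ∑ i, ∑ j, c i j * η i * ξ j with hκ
  set B := ∑ i, ∑ j, |η i| * |ξ j| with hB
  have hB0 : 0 ≤ B := Finset.sum_nonneg fun i _ => Finset.sum_nonneg fun j _ => by positivity
  set e := κ / (1 + B) with he
  have hepos : 0 < e := by positivity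
  have h1 : ∀ᶠ p : R3 × R3 × R3 in 𝓝 (z, ξ, η),
      0 < ∑ i, ∑ j, c i j * p.2.2 i * p.2.1 j - e * ∑ i, ∑ j, |p.2.2 i| * |p.2.1 j| := by
    refine (Continuous.continuousAt (by fun_prop)).eventually_const_lt ?_
    change 0 < κ - e * B
    have : e * (1 + B) = κ := div_mul_cancel₀ _ (by positivity)
    linarith
  have h2 := (continuous_fst.continuousAt (x := (z, ξ, η))).eventually
    (eventually_leading_term (ι := Fin 3 × Fin 3) (A := fun q x => A x q.1 q.2) hepos hW hzW
      (fun q => hA q.1 q.2) hρs hd hz hS hN fun q => hk q.1 q.2)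
  filter_upwards [h1, h2] with p hp1 hp2 hρp
  obtain ⟨s, hs, hs'⟩ := hp2 hρp
  set m := s ^ k / (k.factorial : ℝ) with hm
  have hmpos : 0 < m := by positivity
  have h3 : ∀ i j, m * (c i j * p.2.2 i * p.2.1 j - e * (|p.2.2 i| * |p.2.1 j|))
      ≤ A p.1 i j * p.2.2 i * p.2.1 j := by
    intro i j
    have h4 : |A p.1 i j - c i j * m| ≤ e * m := by
      have := hs' (i, j)
      simp only [mul_div_assoc] at this
      exact this
    have h5 : |(A p.1 i j - c i j * m) * (p.2.2 i * p.2.1 j)| ≤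
        e * m * (|p.2.2 i| * |p.2.1 j|) := by
      rw [abs_mul, abs_mul]
      exact mul_le_mul_of_nonneg_right h4 (by positivity)
    have := neg_le_of_abs_le h5
    linarith
  calc 0 < m * (∑ i, ∑ j, c i j * p.2.2 i * p.2.1 j - e * ∑ i, ∑ j, |p.2.2 i| * |p.2.1 j|) :=
        mul_pos hmpos hp1
    _ = ∑ i, ∑ j, m * (c i j * p.2.2 i * p.2.1 j - e * (|p.2.2 i| * |p.2.1 j|)) := by
        simp only [Finset.mul_sum, mul_sub, Finset.sum_sub_distrib]
    _ ≤ _ := Finset.sum_le_sum fun i _ => Finset.sum_le_sum fun j _ => h3 i j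

theorem iteratedFDeriv_sum_mul {ι : Type*} [Fintype ι] {c F : ι → R3 → ℝ} {z : R3} {k : ℕ}
    (hc : ∀ i, ContDiffAt ℝ ∞ (c i) z) (hF : ∀ i, ContDiffAt ℝ ∞ (F i) z)
    (h : ∀ i, VanishesOn {z} k (F i)) (u : Fin k → R3) :
    iteratedFDeriv ℝ k (fun x => ∑ i, c i x * F i x) z u
      = ∑ i, c i z * iteratedFDeriv ℝ k (F i) z u := by
  have hk : ((k : ℕ) : WithTop ℕ∞) ≤ ∞ := by exact_mod_cast le_top
  rw [iteratedFDeriv_fun_sum_apply fun i _ => ((hc i).mul (hF i)).of_le hk,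
    sum_apply]
  refine Finset.sum_congr rfl fun i _ => ?_
  rw [VanishesOn.iteratedFDeriv_mul (hc i) (hF i) (h i)]
  rfl

section determination

variable {M O W : Set R3} {g G A : TensorField} {ρ : R3 → ℝ}

/-- The leading term of a tensor field with zero mixed ray transform is not positive on a
tangential unit vector `ξ` and `η ⊥ ξ`: otherwise the integrand would be positive along a short
ray. -/
theorem leading_term_nonpos {z N ξ η : R3} {k : ℕ} (hM : UniqueDiffOn ℝ M) (hMc : IsClosed M)
    (hG : ∀ i j, ContDiff ℝ ∞ fun x => G x i j) (hgG : EqOn g G M) (hdet : (G z).det ≠ 0)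
    (hρs : ContDiff ℝ ∞ ρ) (hρ : ∀ x ∈ frontier M, IsDefiningFunction ∞ M x O ρ)
    (hconv : StrictlyConvexBoundary M g) (hW : IsOpen W) (hMW : M ⊆ W)
    (hA : ∀ i j, ∀ x ∈ W, ContDiffAt ℝ ∞ (fun x => A x i j) x)
    (hLA : MixedRayTransformVanishes M g A) (hk : ∀ i j, VanishesOn (frontier M) k fun x => A x i j)
    (hz : z ∈ frontier M) (hN : 0 < fderiv ℝ ρ z N)
    (hξ : innerG G z ξ ξ = 1) (hηξ : innerG G z η ξ = 0) (hρξ : fderiv ℝ ρ z ξ = 0) :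
    ∑ i, ∑ j, iteratedFDeriv ℝ k (fun x => A x i j) z (fun _ => N) * η i * ξ j ≤ 0 := by
  by_contra! hpos
  have hzM := hMc.frontier_subset hz
  have hξ0 : ξ ≠ 0 := by
    rintro rfl
    simp [innerG] at hξ
  have hS : ∀ᶠ x in 𝓝 z, ρ x = 0 → x ∈ frontier M := by
    filter_upwards [(hρ z hz).isOpen.mem_nhds (hρ z hz).mem,
      (hρs.continuous_fderiv (by simp)).continuousAt.eventually_ne (hρ z hz).fderiv_ne]
      with x h1 h2 h3
    exact (hρ z hz).mem_frontier_of_eq_zero h1 h3 h2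
  obtain ⟨ξ', η', hx, ho, r, hr, hrpos⟩ := exists_short_ray hM hMc hG hgG hdet hρs (hρ z hz) hz hξ
    hηξ hρξ (covHessian_neg hM hMc hG hgG hρs hconv (hρ z hz) hz hξ0 hρξ)
    (eventually_pos_of_leading_term hW (hMW hzM) hA hρs.continuous
      (hρs.contDiffAt.differentiableAt (by simp)) (hρ z hz).eq_zero hS hN hk hpos)
  have hcγ : ContinuousOn r.γ (Icc 0 r.τ) :=
    continuousOn_pi.2 fun k t ht => (r.geodesic.velocity t ht k).continuousWithinAt
  have hcv : ContinuousOn r.vel (Icc 0 r.τ) :=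
    continuousOn_pi.2 fun k t ht => (r.geodesic.acceleration t ht k).continuousWithinAt
  have hcp : ContinuousOn r.par (Icc 0 r.τ) :=
    continuousOn_pi.2 fun k t ht => (r.parallel t ht k).continuousWithinAt
  have hc : ContinuousOn (fun t => ∑ i, ∑ j, A (r.γ t) i j * r.par t i * r.vel t j)
      (Icc 0 r.τ) := by
    refine continuousOn_finsetSum _ fun i _ => continuousOn_finsetSum _ fun j _ =>
      ContinuousOn.mul (ContinuousOn.mul (fun t ht => ?_)
        ((continuous_apply i).comp_continuousOn hcp)) ((continuous_apply j).comp_continuousOn hcv)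
    exact (hA i j _ (hMW (r.geodesic.mem t ht))).continuousAt.comp_continuousWithinAt (hcγ t ht)
  have hI : 0 < mixedRayTransform A r := by
    refine intervalIntegral.intervalIntegral_pos_of_pos_on ?_ (fun t ht => ?_) r.τ_pos
    · exact ContinuousOn.intervalIntegrable (by rwa [uIcc_of_le r.τ_pos.le])
    · exact hr t (Ioo_subset_Icc_self ht) (hrpos t ht)
  exact hI.ne' (hLA z ξ' η' hx ho r)

/-- The leading term of a trace-free tensor field whose mixed ray transform is zero and whose
contraction with the normal is flat vanishes. -/
theorem leading_term_eq_zero {z N : R3} {k : ℕ} (hM : UniqueDiffOn ℝ M) (hMc : IsClosed M)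
    (hG : ∀ i j, ContDiff ℝ ∞ fun x => G x i j) (hgG : EqOn g G M)
    (hpos : ∀ x ∈ M, (G x).PosDef)
    (hρs : ContDiff ℝ ∞ ρ) (hρ : ∀ x ∈ frontier M, IsDefiningFunction ∞ M x O ρ)
    (hconv : StrictlyConvexBoundary M g) (hW : IsOpen W) (hMW : M ⊆ W)
    (hA : ∀ i j, ∀ x ∈ W, ContDiffAt ℝ ∞ (fun x => A x i j) x)
    (hLA : MixedRayTransformVanishes M g A)
    (htr : ∀ x ∈ M, trace G A x = 0)
    (hAn : ∀ k i, VanishesOn (frontier M) k fun x => normalPart G ρ A x i)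
    (hk : ∀ i j, VanishesOn (frontier M) k fun x => A x i j)
    (hz : z ∈ frontier M) (hN : 0 < fderiv ℝ ρ z N) (i j : Fin 3) :
    iteratedFDeriv ℝ k (fun x => A x i j) z (fun _ => N) = 0 := by
  have hzM := hMc.frontier_subset hz
  have hzW := hMW hzM
  have hdet : (G z).det ≠ 0 := (hpos z hzM).det_pos.ne'
  have hGz : ∀ i j, ContDiffAt ℝ ∞ (fun x => G x i j) z := fun i j => (hG i j).contDiffAt
  have hkz : ∀ i j, VanishesOn {z} k fun x => A x i j := fun i j =>
    (hk i j).mono_set (singleton_subset_iff.2 hz)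
  set c : Matrix (Fin 3) (Fin 3) ℝ := Matrix.of fun i j =>
    iteratedFDeriv ℝ k (fun x => A x i j) z (fun _ => N) with hc
  set n : R3 := fun i => 𝜕 ρ i z with hn
  have hgrad : (G z)⁻¹.mulVec n = grad G ρ z := rfl
  have hn0 : n ≠ 0 := by
    intro h
    rw [fderiv_eq_sum] at hN
    have : ∀ i, 𝜕 ρ i z = 0 := congrFun h
    simp [this] at hN
  -- to leading order, the contraction with the gradient and the trace see only `c`
  have h1 : c.mulVec ((G z)⁻¹.mulVec n) = 0 := by
    ext i
    have h2 := hAn (k + 1) i k (Nat.lt_succ_self k) z hz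
    have h3 := iteratedFDeriv_sum_mul (c := fun j x => grad G ρ x j) (F := fun j x => A x i j)
      (fun j => contDiffAt_grad (n := ∞) (by simp) hGz hdet hρs.contDiffAt j)
      (fun j => hA i j z hzW) (hkz i) (fun _ => N)
    have e : (fun x => ∑ j, grad G ρ x j * A x i j) = fun x => normalPart G ρ A x i :=
      funext fun x => Finset.sum_congr rfl fun j _ => mul_comm _ _
    rw [e, h2] at h3
    rw [hgrad]
    simp only [Matrix.mulVec, dotProduct, hc, Matrix.of_apply, Pi.zero_apply,
      mul_comm _ (grad _ _ _ _)]
    rw [← h3]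
    rfl
  have h2 : ∑ i, ∑ j, c i j * (G z)⁻¹ i j = 0 := by
    have hi : ∀ i j, ContDiffAt ℝ ∞ (fun y => (G y)⁻¹ i j) z := contDiffAt_matrix_inv hGz hdet
    have h3 := iteratedFDeriv_sum_mul (c := fun (q : Fin 3 × Fin 3) x => (G x)⁻¹ q.1 q.2)
      (F := fun q x => A x q.1 q.2) (fun q => hi q.1 q.2) (fun q => hA q.1 q.2 z hzW)
      (fun q => hkz q.1 q.2) (fun _ => N)
    have e : (fun x => ∑ q : Fin 3 × Fin 3, (G x)⁻¹ q.1 q.2 * A x q.1 q.2) = trace G A := by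
      ext x
      rw [Fintype.sum_prod_type]
      exact Finset.sum_congr rfl fun i _ => Finset.sum_congr rfl fun j _ => mul_comm _ _
    have htrs : ∀ x ∈ M, ContDiffAt ℝ ∞ (trace G A) x := fun x hx =>
      ContDiffAt.sum fun i _ => ContDiffAt.sum fun j _ => (hA i j x (hMW hx)).mul
        (contDiffAt_matrix_inv (fun i j => (hG i j).contDiffAt) (hpos x hx).det_pos.ne' i j)
    have h4 := vanishesOn_of_eqOn_zero hM isOpen_univ (fun x hx => htrs x hx.1)
      (fun x hx => htr x hx.1) (k + 1) k (Nat.lt_succ_self k) z ⟨hzM, mem_univ _⟩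
    rw [e, h4, Fintype.sum_prod_type] at h3
    simp only [hc, Matrix.of_apply, mul_comm _ ((G z)⁻¹ _ _)]
    rw [← h3]
    rfl
  -- the sign of `η` may be reversed
  have hcont : ∀ ξ η : R3, innerG G z ξ ξ = 1 → innerG G z η ξ = 0 → fderiv ℝ ρ z ξ = 0 →
      ∑ i, ∑ j, c i j * η i * ξ j = 0 := by
    intro ξ η hξ hηξ hρξ
    have ha := leading_term_nonpos hM hMc hG hgG hdet hρs hρ hconv hW hMW hA hLA hk hz hN hξ hηξ hρξ
    have hb := leading_term_nonpos (η := -η) hM hMc hG hgG hdet hρs hρ hconv hW hMW hA hLA hk hz hN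
      hξ (by simpa [innerG] using hηξ) hρξ
    refine le_antisymm ha ?_
    simpa [hc] using hb
  have hc0 : c = 0 := by
    refine eq_zero_of_tangential (hpos z hzM) hn0 h1 (fun ξ η hξn hηξ => ?_) h2
    rcases eq_or_ne ξ 0 with rfl | hξ0
    · simp
    have hq := innerG_self_pos (hpos z hzM) hξ0
    set q := innerG G z ξ ξ with hqdef
    have hsq : (√q)⁻¹ * (√q)⁻¹ * q = 1 := by
      rw [← mul_inv, Real.mul_self_sqrt hq.le, inv_mul_cancel₀ hq.ne']
    have h5 := hcont ((√q)⁻¹ • ξ) η ?_ ?_ ?_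
    · have e : ∑ i, ∑ j, c i j * η i * ((√q)⁻¹ • ξ) j = (√q)⁻¹ * η ⬝ᵥ c.mulVec ξ := by
        simp only [dotProduct, Matrix.mulVec, Finset.mul_sum, Pi.smul_apply, smul_eq_mul]
        exact Finset.sum_congr rfl fun i _ => Finset.sum_congr rfl fun j _ => by ring
      rw [e] at h5
      exact (mul_eq_zero.1 h5).resolve_left (inv_ne_zero (Real.sqrt_pos.2 hq).ne')
    · rw [← hsq]
      simp only [hqdef, innerG, Finset.mul_sum, Pi.smul_apply, smul_eq_mul]
      exact Finset.sum_congr rfl fun i _ => Finset.sum_congr rfl fun j _ => by ring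
    · have e : innerG G z η ((√q)⁻¹ • ξ) = (√q)⁻¹ * η ⬝ᵥ (G z).mulVec ξ := by
        simp only [innerG, dotProduct, Matrix.mulVec, Finset.mul_sum, Pi.smul_apply, smul_eq_mul]
        exact Finset.sum_congr rfl fun i _ => Finset.sum_congr rfl fun j _ => by ring
      rw [e, hηξ, mul_zero]
    · rw [map_smul, fderiv_eq_sum, smul_eq_mul]
      have : ∑ i, ξ i * 𝜕 ρ i z = n ⬝ᵥ ξ := Finset.sum_congr rfl fun i _ => mul_comm _ _
      rw [this, hξn, mul_zero]
  exact congrFun (congrFun hc0 i) j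

/-- Boundary determination: a trace-free tensor field with zero mixed ray transform, whose
contraction with the normal is flat at the boundary, is flat at the boundary. -/
theorem vanishesOn_of_mixedRayTransform (hM : UniqueDiffOn ℝ M) (hMc : IsClosed M)
    (hG : ∀ i j, ContDiff ℝ ∞ fun x => G x i j) (hgG : EqOn g G M)
    (hpos : ∀ x ∈ M, (G x).PosDef)
    (hρs : ContDiff ℝ ∞ ρ) (hρ : ∀ x ∈ frontier M, IsDefiningFunction ∞ M x O ρ)
    (hconv : StrictlyConvexBoundary M g) (hW : IsOpen W) (hMW : M ⊆ W)
    (hA : ∀ i j, ∀ x ∈ W, ContDiffAt ℝ ∞ (fun x => A x i j) x)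
    (hLA : MixedRayTransformVanishes M g A)
    (htr : ∀ x ∈ M, trace G A x = 0)
    (hAn : ∀ k i, VanishesOn (frontier M) k fun x => normalPart G ρ A x i) (k : ℕ) (i j : Fin 3) :
    VanishesOn (frontier M) k fun x => A x i j := by
  induction k generalizing i j with
  | zero => exact VanishesOn.zero_order
  | succ k ih =>
    intro n hn z hz
    obtain ⟨N, hN⟩ : ∃ N, 0 < fderiv ℝ ρ z N := by
      obtain ⟨N, hN⟩ : ∃ N, fderiv ℝ ρ z N ≠ 0 := by
        by_contra! h
        exact (hρ z hz).fderiv_ne (ContinuousLinearMap.ext h)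
      rcases lt_or_gt_of_ne hN with h | h
      · exact ⟨-N, by simpa using h⟩
      · exact ⟨N, h⟩
    have hfd : Continuous (fderiv ℝ ρ) := hρs.continuous_fderiv (by simp)
    have hfN : Continuous fun x => fderiv ℝ ρ x N := by fun_prop
    refine VanishesOn.succ_of_iteratedFDeriv (S := frontier M ∩ {x | 0 < fderiv ℝ ρ x N})
      (ρ := ρ) (u := N) (fun x _ => hρs.contDiffAt) (fun x hx => ⟨(hρ x hx.1).eq_zero,
        (hρ x hx.1).fderiv_ne, ?_⟩) (fun x hx => ne_of_gt hx.2)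
      (fun x hx => hA i j x (hMW (hMc.frontier_subset hx.1))) ((ih i j).mono_set inter_subset_left)
      (fun x hx => leading_term_eq_zero hM hMc hG hgG hpos hρs hρ hconv hW hMW hA hLA htr hAn ih
        hx.1 hx.2 i j) n hn z ⟨hz, hN⟩
    filter_upwards [(hρ x hx.1).isOpen.mem_nhds (hρ x hx.1).mem,
      hfd.continuousAt.eventually_ne (hρ x hx.1).fderiv_ne,
      hfN.continuousAt.eventually_const_lt hx.2] with y h1 h2 h3 h4
    exact ⟨(hρ x hx.1).mem_frontier_of_eq_zero h1 h4 h2, h3⟩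

end determination

/-- A symmetric smooth extension of the metric. -/
theorem exists_symmetric_extension {M : Set R3} {g : TensorField}
    (hg : ∀ i j, SmoothUpTo M (fun x => g x i j)) (hpos : ∀ x ∈ M, (g x).PosDef) :
    ∃ G : TensorField, (∀ i j, ContDiff ℝ ∞ fun x => G x i j) ∧ (∀ x i j, G x i j = G x j i) ∧
      EqOn g G M := by
  choose H hH hgH using hg
  refine ⟨fun x => Matrix.of fun i j => (H i j x + H j i x) / 2, fun i j => ?_, fun x i j => ?_,
    fun x hx => ?_⟩
  · have h1 := hH i j
    have h2 := hH j i
    simp only [Matrix.of_apply]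
    fun_prop
  · simp only [Matrix.of_apply, add_comm]
  · ext i j
    have hs : g x j i = g x i j := by
      have := (hpos x hx).isHermitian.apply i j
      simpa using this
    simp only [Matrix.of_apply, ← hgH i j hx, ← hgH j i hx, hs]
    ring

theorem trace_sub_dB {G F : TensorField} {v : CovectorField} {x : R3} (hpos : (G x).PosDef)
    (hF : trace G F x = 0) : trace G (fun x i j => F x i j - dB univ G v x i j) x = 0 := by
  have e : trace G (fun x i j => F x i j - dB univ G v x i j) x = trace G F x
      - (trace G (covDeriv univ G v) x
        - 1 / 3 * trace G (covDeriv univ G v) x * ∑ i, ∑ j, G x i j * (G x)⁻¹ i j) := by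
    simp only [trace, dB, traceFreePart, Fin.sum_univ_three]
    ring
  rw [e, hF, sum_mul_inv_entries hpos]
  ring

/-- The gauge construction followed by boundary determination: there are global smooth
representatives `G`, `F` of `g`, `f` and a smooth `v` vanishing on the boundary such that
`F - d^𝓑 v` is flat there. -/
theorem exists_flat_gauge {M : Set R3} {g f : TensorField} (hM : IsSimple M g)
    (hf : ∀ i j, SmoothUpTo M (fun x => f x i j)) (hf_trace : ∀ x ∈ M, trace g f x = 0)
    (hLf : MixedRayTransformVanishes M g f) :
    ∃ (G F : TensorField) (v : CovectorField), (∀ i j, ContDiff ℝ ∞ fun x => G x i j) ∧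
      (∀ i j, ContDiff ℝ ∞ fun x => F x i j) ∧ EqOn g G M ∧ EqOn f F M ∧
      (∀ i, ContDiff ℝ ∞ fun x => v x i) ∧ (∀ x ∈ frontier M, v x = 0) ∧
      ∀ k i j, VanishesOn (frontier M) k fun x => F x i j - dB univ G v x i j := by
  have hMc := hM.compact.isClosed
  have hU := uniqueDiffOn_of_boundary hM.boundary
  obtain ⟨G, hG, hs, hgG⟩ := exists_symmetric_extension hM.smooth hM.posDef
  choose F' hF' hfF' using hf
  set F : TensorField := fun x => Matrix.of fun i j => F' i j x with hFdef
  have hF : ∀ i j, ContDiff ℝ ∞ fun x => F x i j := hF'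
  have hfF : EqOn f F M := fun x hx => by
    ext i j
    exact hfF' i j hx
  have hpos : ∀ x ∈ M, (G x).PosDef := fun x hx => hgG hx ▸ hM.posDef x hx
  obtain ⟨O, ρ, hρs, hρ⟩ := exists_definingFunction hM.compact hM.boundary
  obtain ⟨v, hv, hv0, hvn⟩ := exists_gauge hM.compact hG hF
    (fun x hx => hpos x (hMc.frontier_subset hx)) hρs hρ
  refine ⟨G, F, v, hG, hF, hgG, hfF, hv, hv0, fun k i j => ?_⟩
  have hdetc : Continuous fun x => (G x).det := by
    simp only [Matrix.det_fin_three]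
    have h1 : ∀ i j, Continuous fun x => G x i j := fun i j => (hG i j).continuous
    fun_prop
  refine vanishesOn_of_mixedRayTransform (W := {x | (G x).det ≠ 0})
    (A := fun x i j => F x i j - dB univ G v x i j) hU hMc hG hgG hpos hρs hρ hM.convex
    (isOpen_ne_fun hdetc continuous_const) (fun x hx => (hpos x hx).det_pos.ne')
    (fun i j x hx => (hF i j).contDiffAt.sub (contDiffAt_dB (by simp)
      (fun i j => (hG i j).contDiffAt) hx (fun i => (hv i).contDiffAt) i j))
    (mixedRayTransform_sub_dB hU hMc hG hs (fun x hx => (hpos x hx).det_pos.ne') hgG hF hfF hv hv0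
      hLf) (fun x hx => trace_sub_dB (hpos x hx) ?_) hvn k i j
  rw [← hf_trace x hx]
  simp only [trace, hgG hx, hfF hx]

theorem iteratedFDerivWithin_eq_zero_of_vanishesOn {M : Set R3} {g f G F : TensorField}
    {v : CovectorField} (hM : UniqueDiffOn ℝ M) (hMc : IsClosed M)
    (hG : ∀ i j, ContDiff ℝ ∞ fun x => G x i j) (hF : ∀ i j, ContDiff ℝ ∞ fun x => F x i j)
    (hgG : EqOn g G M) (hfF : EqOn f F M) (hv : ∀ i, ContDiff ℝ ∞ fun x => v x i)
    (hdet : ∀ x ∈ M, (G x).det ≠ 0)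
    (h : ∀ k i j, VanishesOn (frontier M) k fun x => F x i j - dB univ G v x i j) (m : ℕ)
    (i j : Fin 3) {x : R3} (hx : x ∈ frontier M) :
    iteratedFDerivWithin ℝ m (fun y => f y i j - dB M g v y i j) M x = 0 := by
  have hxM := hMc.frontier_subset hx
  have hc : ∀ y ∈ M, f y i j - dB M g v y i j = F y i j - dB univ G v y i j := fun y hy => by
    rw [hfF hy, dB_eq_of_eqOn hM isOpen_univ ⟨hy, mem_univ y⟩
      (fun i j => (hG i j).contDiffAt.differentiableAt (by simp))
      (fun i => (hv i).contDiffAt.differentiableAt (by simp)) (by simpa using hgG)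
      (fun _ _ => rfl) i j]
  rw [iteratedFDerivWithin_congr hc hxM, iteratedFDerivWithin_eq_iteratedFDeriv hM _ hxM]
  · exact h (m + 1) i j m (Nat.lt_succ_self m) x hx
  · refine ContDiffAt.of_le (n := ∞) ?_ (by exact_mod_cast le_top)
    exact (hF i j).contDiffAt.sub (contDiffAt_dB (by simp)
      (fun i j => (hG i j).contDiffAt) (hdet x hxM) (fun i => (hv i).contDiffAt) i j)

/-! ### Derivative bounds of Cauchy type -/

/-- All derivatives of `F` on `S` obey `‖D^n F‖ ≤ C A^n n! (n+k choose k)`. For `k = 0` these are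
the Cauchy estimates of a real analytic function; `k` derivatives of such a function cost `k! A^k`
and give an estimate of order `k`. -/
structure CauchyBound (S : Set R3) (A C : ℝ) (k : ℕ) (F : R3 → ℝ) : Prop where
  contDiffAt : ∀ x ∈ S, ContDiffAt ℝ ∞ F x
  bound : ∀ x ∈ S, ∀ n, ‖iteratedFDeriv ℝ n F x‖ ≤ C * A ^ n * (n.factorial * (n + k).choose k)

theorem exists_bound_of_analyticAt {F : R3 → ℝ} {z : R3} (hF : AnalyticAt ℝ F z) :
    ∃ r > 0, ∃ C A : ℝ, 0 ≤ C ∧ 0 < A ∧ ∀ x ∈ Metric.ball z r, AnalyticAt ℝ F x ∧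
      ∀ n, ‖iteratedFDeriv ℝ n F x‖ ≤ C * A ^ n * n.factorial := by
  obtain ⟨p, R, hp⟩ := hF
  obtain ⟨q, hq0, hqR⟩ := ENNReal.lt_iff_exists_nnreal_btwn.1 hp.r_pos
  set r : NNReal := q / 2 with hr
  have hq0' : 0 < q := by exact_mod_cast hq0
  have hrp : 0 < r := half_pos hq0'
  have hrr : (r + r : ENNReal) = q := by
    rw [← ENNReal.coe_add, hr, add_halves]
  have hsum := p.changeOriginSeries_summable_aux₁ (r := r) (r' := r)
    (by rw [hrr]; exact hqR.trans_le hp.r_le)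
  obtain ⟨hs1, hs2⟩ := NNReal.summable_sigma.1 hsum
  set T := ∑' k, ∑' s : Σ l : ℕ, { s : Finset (Fin (k + l)) // s.card = l },
    ‖p (k + s.1)‖₊ * r ^ s.1 * r ^ k with hT
  have hrR : (r : ENNReal) < R := lt_of_le_of_lt (by
    rw [← hrr]; exact le_add_right le_rfl) hqR
  refine ⟨r, by exact_mod_cast hrp, T, (r : ℝ)⁻¹, T.2, by positivity, fun x hx => ?_⟩
  set y := x - z with hy
  have hxy : z + y = x := by simp [hy]
  have hyr : ‖y‖₊ ≤ r := by
    rw [mem_ball_iff_norm] at hx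
    exact_mod_cast hx.le
  have hyR : (‖y‖₊ : ENNReal) < R := lt_of_le_of_lt (by exact_mod_cast hyr) hrR
  have hpx := hp.changeOrigin hyR
  rw [hxy] at hpx
  refine ⟨⟨_, _, hpx⟩, fun n => ?_⟩
  have h1 : ‖p.changeOrigin y n‖₊ * r ^ n ≤ T := by
    have hle : ∑' s : Σ l : ℕ, { s : Finset (Fin (n + l)) // s.card = l },
        ‖p (n + s.1)‖₊ * r ^ s.1 * r ^ n ≤ T := hs2.le_tsum n fun _ _ => zero_le
    refine le_trans ?_ hle
    rw [NNReal.tsum_mul_right]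
    gcongr
    refine (p.nnnorm_changeOrigin_le n (hyR.trans_le hp.r_le)).trans ?_
    refine Summable.tsum_le_tsum (fun s => by gcongr)
      (p.changeOriginSeries_summable_aux₂ (hyR.trans_le hp.r_le) n)
      (p.changeOriginSeries_summable_aux₂ (hrR.trans_le hp.r_le) n)
  have h2 : ‖p.changeOrigin y n‖ ≤ T * (r : ℝ)⁻¹ ^ n := by
    rw [inv_pow, ← div_eq_mul_inv, le_div_iff₀ (by positivity)]
    exact_mod_cast h1
  refine ContinuousMultilinearMap.opNorm_le_bound (by positivity) fun v => ?_
  rw [hpx.iteratedFDeriv_eq_sum_of_completeSpace]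
  refine (norm_sum_le _ _).trans ?_
  have h3 : ∀ σ ∈ (Finset.univ : Finset (Equiv.Perm (Fin n))),
      ‖p.changeOrigin y n fun i => v (σ i)‖ ≤ T * (r : ℝ)⁻¹ ^ n * ∏ i, ‖v i‖ := by
    intro σ _
    refine ((p.changeOrigin y n).le_opNorm _).trans ?_
    rw [Equiv.prod_comp σ fun i => ‖v i‖]
    gcongr
  refine (Finset.sum_le_card_nsmul _ _ _ h3).trans ?_
  rw [Finset.card_univ, Fintype.card_perm, Fintype.card_fin, nsmul_eq_mul]
  exact le_of_eq (by ring)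

namespace CauchyBound

variable {S S' : Set R3} {A A' C C' : ℝ} {k : ℕ} {F H : R3 → ℝ}

theorem mono_set (h : CauchyBound S A C k F) (hS : S' ⊆ S) : CauchyBound S' A C k F :=
  ⟨fun x hx => h.contDiffAt x (hS hx), fun x hx => h.bound x (hS hx)⟩

theorem mono (h : CauchyBound S A C k F) (hA : 0 ≤ A) (hAA : A ≤ A') (hC : 0 ≤ C) (hCC : C ≤ C') :
    CauchyBound S A' C' k F :=
  ⟨h.contDiffAt, fun x hx n => (h.bound x hx n).trans (by
    have := pow_le_pow_left₀ hA hAA n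
    have := pow_nonneg hA n
    have := hC.trans hCC
    gcongr)⟩

theorem of_bound (hF : ∀ x ∈ S, ContDiffAt ℝ ∞ F x)
    (h : ∀ x ∈ S, ∀ n, ‖iteratedFDeriv ℝ n F x‖ ≤ C * A ^ n * n.factorial) :
    CauchyBound S A C 0 F := ⟨hF, by simpa using h⟩

theorem bound_zero (h : CauchyBound S A C 0 F) {x : R3} (hx : x ∈ S) (n : ℕ) :
    ‖iteratedFDeriv ℝ n F x‖ ≤ C * A ^ n * n.factorial := by simpa using h.bound x hx n

theorem abs_le (h : CauchyBound S A C 0 F) {x : R3} (hx : x ∈ S) : |F x| ≤ C := by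
  simpa using h.bound x hx 0

/-- The binomial coefficient is absorbed by doubling `A`. -/
theorem order_zero (h : CauchyBound S A C k F) (hA : 0 ≤ A) (hC : 0 ≤ C) :
    CauchyBound S (2 * A) (C * 2 ^ k) 0 F := by
  refine of_bound h.contDiffAt fun x hx n => (h.bound x hx n).trans ?_
  have h1 : ((n + k).choose k : ℝ) ≤ 2 ^ (n + k) := by exact_mod_cast Nat.choose_le_two_pow _ _
  calc C * A ^ n * (n.factorial * (n + k).choose k) ≤ C * A ^ n * (n.factorial * 2 ^ (n + k)) := by
        gcongr
    _ = C * 2 ^ k * (2 * A) ^ n * n.factorial := by rw [pow_add, mul_pow]; ring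

theorem succ_order (h : CauchyBound S A C k F) (hA : 0 ≤ A) (hC : 0 ≤ C) :
    CauchyBound S A C (k + 1) F := by
  refine ⟨h.contDiffAt, fun x hx n => (h.bound x hx n).trans ?_⟩
  have h1 : ((n + k).choose k : ℝ) ≤ (n + (k + 1)).choose (k + 1) := by
    exact_mod_cast (by
      rw [← add_assoc, Nat.choose_succ_succ]
      exact Nat.le_add_right _ _ : (n + k).choose k ≤ (n + (k + 1)).choose (k + 1))
  gcongr

theorem add (h : CauchyBound S A C k F) (h' : CauchyBound S A C' k H) :
    CauchyBound S A (C + C') k (fun x => F x + H x) := by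
  refine ⟨fun x hx => (h.contDiffAt x hx).add (h'.contDiffAt x hx), fun x hx n => ?_⟩
  have hn : ((n : ℕ) : WithTop ℕ∞) ≤ ∞ := by exact_mod_cast le_top
  have e : (fun x => F x + H x) = F + H := rfl
  rw [e, iteratedFDeriv_add_apply ((h.contDiffAt x hx).of_le hn) ((h'.contDiffAt x hx).of_le hn)]
  refine (norm_add_le _ _).trans ?_
  rw [add_mul, add_mul]
  exact add_le_add (h.bound x hx n) (h'.bound x hx n)

theorem const_mul (h : CauchyBound S A C k F) (c : ℝ) :
    CauchyBound S A (|c| * C) k (fun x => c * F x) := by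
  refine ⟨fun x hx => contDiffAt_const.mul (h.contDiffAt x hx), fun x hx n => ?_⟩
  have hn : ((n : ℕ) : WithTop ℕ∞) ≤ ∞ := by exact_mod_cast le_top
  have e : (fun x => c * F x) = c • F := rfl
  rw [e, iteratedFDeriv_const_smul_apply ((h.contDiffAt x hx).of_le hn), norm_smul,
    Real.norm_eq_abs, mul_assoc, mul_assoc]
  gcongr
  simpa only [mul_assoc] using h.bound x hx n

theorem zero (hA : 0 ≤ A) (hC : 0 ≤ C) : CauchyBound S A C k (fun _ => 0) :=
  ⟨fun _ _ => contDiffAt_const, fun x _ n => by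
    rw [iteratedFDeriv_fun_zero, Pi.zero_apply, norm_zero]
    positivity⟩

theorem sum {ι : Type*} {s : Finset ι} {F : ι → R3 → ℝ} {C : ι → ℝ} (hA : 0 ≤ A)
    (h : ∀ i ∈ s, CauchyBound S A (C i) k (F i)) :
    CauchyBound S A (∑ i ∈ s, C i) k (fun x => ∑ i ∈ s, F i x) := by
  classical
  induction s using Finset.induction with
  | empty => simpa using zero hA le_rfl
  | insert a s ha ih =>
    simp only [Finset.sum_insert ha]
    exact (h a (Finset.mem_insert_self a s)).add
      (ih fun i hi => h i (Finset.mem_insert_of_mem hi))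

theorem sub (h : CauchyBound S A C k F) (h' : CauchyBound S A C' k H) :
    CauchyBound S A (C + C') k (fun x => F x - H x) := by
  simpa [sub_eq_add_neg] using h.add (h'.const_mul (-1))

/-- A partial derivative raises the order by one. -/
theorem partial_deriv (h : CauchyBound S A C k F) (i : Fin 3) :
    CauchyBound S A ((k + 1) * (A * C)) (k + 1) (𝜕 F i) := by
  refine ⟨fun x hx => contDiffAt_pd (h.contDiffAt x hx) i, fun x hx n => ?_⟩
  have hn : ((n : ℕ) : WithTop ℕ∞) ≤ ∞ := by exact_mod_cast le_top
  have hf : ContDiffAt ℝ n (fderiv ℝ F) x :=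
    ((h.contDiffAt x hx).fderiv_right (m := ∞) (by simp)).of_le hn
  have hnorm : ‖ContinuousLinearMap.apply ℝ ℝ (Pi.single i 1 : R3)‖ ≤ 1 := by
    refine ContinuousLinearMap.opNorm_le_bound _ zero_le_one fun T => ?_
    rw [ContinuousLinearMap.apply_apply, one_mul]
    refine (T.le_opNorm _).trans (mul_le_of_le_one_right (norm_nonneg _) ?_)
    rw [Pi.norm_single, norm_one]
  have h1 : ‖iteratedFDeriv ℝ n (𝜕 F i) x‖ ≤ ‖iteratedFDeriv ℝ (n + 1) F x‖ := by
    rw [pd_univ_eq_comp]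
    refine (ContinuousLinearMap.norm_iteratedFDeriv_comp_left _ hf le_rfl).trans ?_
    rw [norm_iteratedFDeriv_fderiv]
    exact mul_le_of_le_one_left (norm_nonneg _) hnorm
  refine h1.trans ((h.bound x hx (n + 1)).trans (le_of_eq ?_))
  have h2 : ((n + (k + 1)).choose (k + 1) : ℝ) * (k + 1) = (n + 1 + k).choose k * (n + 1) := by
    have := Nat.choose_succ_right_eq (n + 1 + k) k
    rw [show n + 1 + k - k = n + 1 by omega, show n + 1 + k = n + (k + 1) by ring] at this
    rw [show n + 1 + k = n + (k + 1) by ring]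
    exact_mod_cast this
  rw [Nat.factorial_succ]
  push_cast
  calc C * A ^ (n + 1) * ((n + 1) * n.factorial * (n + 1 + k).choose k)
      = C * A ^ (n + 1) * n.factorial * ((n + 1 + k).choose k * (n + 1)) := by ring
    _ = _ := by rw [← h2]; ring

/-- Multiplication by a function with smaller `A` does not change the order. -/
theorem mul {b : R3 → ℝ} {Cb : ℝ} (hS : IsOpen S) (hb : CauchyBound S (A / 2) Cb 0 b)
    (h : CauchyBound S A C k F) (hA : 0 ≤ A) (hCb : 0 ≤ Cb) (hC : 0 ≤ C) :
    CauchyBound S A (2 * Cb * C) k (fun x => b x * F x) := by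
  refine ⟨fun x hx => (hb.contDiffAt x hx).mul (h.contDiffAt x hx), fun x hx n => ?_⟩
  have hn : ((n : ℕ) : WithTop ℕ∞) ≤ ∞ := by exact_mod_cast le_top
  have hw : ∀ m (f : R3 → ℝ), iteratedFDerivWithin ℝ m f S x = iteratedFDeriv ℝ m f x := fun m f =>
    iteratedFDerivWithin_of_isOpen m hS hx
  have h1 := norm_iteratedFDerivWithin_mul_le (f := b) (g := F) (N := ∞)
    (fun y hy => (hb.contDiffAt y hy).contDiffWithinAt)
    (fun y hy => (h.contDiffAt y hy).contDiffWithinAt) hS.uniqueDiffOn hx hn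
  simp only [hw] at h1
  refine h1.trans ?_
  have h2 : ∀ i ∈ Finset.range (n + 1),
      (n.choose i : ℝ) * ‖iteratedFDeriv ℝ i b x‖ * ‖iteratedFDeriv ℝ (n - i) F x‖
        ≤ Cb * C * A ^ n * (n.factorial * (n + k).choose k) * (1 / 2) ^ i := by
    intro i hi
    have hin : i ≤ n := Nat.lt_succ_iff.1 (Finset.mem_range.1 hi)
    have h3 : ((n - i + k).choose k : ℝ) ≤ (n + k).choose k := by
      exact_mod_cast Nat.choose_le_choose k (by omega)
    have h4 : (n.choose i : ℝ) * i.factorial * (n - i).factorial = n.factorial := by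
      exact_mod_cast Nat.choose_mul_factorial_mul_factorial hin
    have h5 : A ^ i * A ^ (n - i) = A ^ n := by rw [← pow_add, Nat.add_sub_cancel' hin]
    calc (n.choose i : ℝ) * ‖iteratedFDeriv ℝ i b x‖ * ‖iteratedFDeriv ℝ (n - i) F x‖
        ≤ n.choose i * (Cb * (A / 2) ^ i * i.factorial)
          * (C * A ^ (n - i) * ((n - i).factorial * (n + k).choose k)) := by
          gcongr
          · exact hb.bound_zero hx i
          · exact (h.bound x hx (n - i)).trans (by gcongr)
      _ = Cb * C * (A ^ i * A ^ (n - i)) * ((n.choose i * i.factorial * (n - i).factorial)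
          * (n + k).choose k) * (1 / 2) ^ i := by
          rw [div_pow, one_div, inv_pow]; ring
      _ = _ := by rw [h4, h5]
  refine (Finset.sum_le_sum h2).trans ?_
  rw [← Finset.mul_sum]
  have h6 := sum_geometric_two_le (n + 1)
  calc _ ≤ Cb * C * A ^ n * (n.factorial * (n + k).choose k) * 2 := by gcongr
    _ = _ := by ring

end CauchyBound

/-- Series of functions with summable Cauchy bounds may be differentiated term by term, and the sum
has a Cauchy bound again. -/
theorem CauchyBound.tsum {S : Set R3} {A : ℝ} {C : ℕ → ℝ} {F : ℕ → R3 → ℝ} (hS : IsOpen S)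
    (hpc : IsPreconnected S) (hC : Summable C) (h : ∀ k, CauchyBound S A (C k) 0 (F k)) :
    CauchyBound S A (∑' k, C k) 0 (fun x => ∑' k, F k x) ∧
      ∀ x ∈ S, HasSum (fun k => F k x) (∑' k, F k x) ∧
        ∀ i, HasSum (fun k => 𝜕 (F k) i x) (𝜕 (fun x => ∑' k, F k x) i x) := by
  have hsum : ∀ n, Summable fun k => C k * A ^ n * n.factorial := fun n =>
    (hC.mul_right _).mul_right _
  have hsumm : ∀ n, ∀ x ∈ S, Summable fun k => iteratedFDeriv ℝ n (F k) x := fun n x hx =>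
    Summable.of_norm_bounded (hsum n) fun k => (h k).bound_zero hx n
  have hfn : ∀ n, ∀ x ∈ S, ∀ k, HasFDerivAt (iteratedFDeriv ℝ n (F k))
      (fderiv ℝ (iteratedFDeriv ℝ n (F k)) x) x := fun n x hx k =>
    (((h k).contDiffAt x hx).differentiableAt_iteratedFDeriv
      (by exact_mod_cast WithTop.coe_lt_top _)).hasFDerivAt
  have hbd : ∀ n k, ∀ x ∈ S, ‖fderiv ℝ (iteratedFDeriv ℝ n (F k)) x‖
      ≤ C k * A ^ (n + 1) * (n + 1).factorial := fun n k x hx => by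
    rw [norm_fderiv_iteratedFDeriv]
    exact (h k).bound_zero hx (n + 1)
  have hP : ∀ n, ∀ x ∈ S, HasFDerivAt (fun y => ∑' k, iteratedFDeriv ℝ n (F k) y)
      (∑' k, fderiv ℝ (iteratedFDeriv ℝ n (F k)) x) x := fun n x hx =>
    hasFDerivAt_tsum_of_isPreconnected (hsum (n + 1)) hS hpc (fun k y hy => hfn n y hy k)
      (fun k y hy => hbd n k y hy) hx (hsumm n x hx) hx
  have hsumF : ∀ x ∈ S, Summable fun k => F k x := fun x hx =>
    Summable.of_norm_bounded hC fun k => (h k).abs_le hx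
  have key : ∀ n, ∀ x ∈ S, iteratedFDeriv ℝ n (fun x => ∑' k, F k x) x
      = ∑' k, iteratedFDeriv ℝ n (F k) x := by
    intro n
    induction n with
    | zero =>
      intro x hx
      simp only [iteratedFDeriv_zero_eq_comp, Function.comp_apply]
      exact (continuousMultilinearCurryFin0 ℝ R3 ℝ).symm.toContinuousLinearEquiv.map_tsum
    | succ n ih =>
      intro x hx
      have he : iteratedFDeriv ℝ n (fun x => ∑' k, F k x)
          =ᶠ[𝓝 x] fun y => ∑' k, iteratedFDeriv ℝ n (F k) y := by
        filter_upwards [hS.mem_nhds hx] with y hy using ih y hy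
      simp only [iteratedFDeriv_succ_eq_comp_left, Function.comp_apply]
      rw [he.fderiv_eq, (hP n x hx).fderiv]
      exact ((continuousMultilinearCurryLeftEquiv ℝ (fun _ : Fin (n + 1) =>
        R3) ℝ).symm.toContinuousLinearEquiv.map_tsum)
  have hder : ∀ n, ∀ x ∈ S, DifferentiableAt ℝ (iteratedFDeriv ℝ n fun x => ∑' k, F k x) x := by
    intro n x hx
    refine (hP n x hx).differentiableAt.congr_of_eventuallyEq ?_
    filter_upwards [hS.mem_nhds hx] with y hy using key n y hy
  have hsm : ContDiffOn ℝ ∞ (fun x => ∑' k, F k x) S := by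
    refine contDiffOn_of_differentiableOn fun m _ x hx => ?_
    refine ((hder m x hx).differentiableWithinAt).congr (fun y hy => ?_) ?_
    · exact iteratedFDerivWithin_of_isOpen m hS hy
    · exact iteratedFDerivWithin_of_isOpen m hS hx
  refine ⟨of_bound (fun x hx => hsm.contDiffAt (hS.mem_nhds hx)) fun x hx n => ?_, fun x hx =>
    ⟨(hsumF x hx).hasSum, fun i => ?_⟩⟩
  · rw [key n x hx, ← tsum_mul_right, ← tsum_mul_right]
    exact tsum_of_norm_bounded (hsum n).hasSum fun k => (h k).bound_zero hx n
  · have hb1 : ∀ k, ∀ y ∈ S, ‖fderiv ℝ (F k) y‖ ≤ C k * A ^ 1 * (Nat.factorial 1) := by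
      intro k y hy
      have := (h k).bound_zero hy 1
      rwa [← norm_iteratedFDeriv_fderiv, norm_iteratedFDeriv_zero] at this
    have h1 : HasFDerivAt (fun y => ∑' k, F k y) (∑' k, fderiv ℝ (F k) x) x :=
      hasFDerivAt_tsum_of_isPreconnected (hsum 1) hS hpc
        (fun k y hy => (((h k).contDiffAt y hy).differentiableAt (by simp)).hasFDerivAt)
        (fun k y hy => hb1 k y hy) hx (hsumF x hx) hx
    have h2 : Summable fun k => fderiv ℝ (F k) x :=
      Summable.of_norm_bounded (hsum 1) fun k => hb1 k x hx
    have h3 := (ContinuousLinearMap.apply ℝ ℝ (Pi.single i 1 : R3)).hasSum h2.hasSum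
    simp only [pd_univ, h1.fderiv]
    exact h3

/-- Finitely many analytic functions have a common Cauchy bound near a point. -/
theorem exists_cauchyBound {ι : Type*} [Finite ι] {F : ι → R3 → ℝ} {z : R3}
    (hF : ∀ i, AnalyticAt ℝ (F i) z) :
    ∃ r > 0, ∃ A C : ℝ, 0 < A ∧ 0 ≤ C ∧ ∀ i, CauchyBound (Metric.ball z r) A C 0 (F i) := by
  have := Fintype.ofFinite ι
  choose r hr C A hC hA h using fun i => exists_bound_of_analyticAt (hF i)
  have hev : ∀ᶠ s in 𝓝[>] (0 : ℝ), ∀ i, s < r i :=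
    eventually_all.2 fun i => (eventually_lt_nhds (hr i)).filter_mono nhdsWithin_le_nhds
  obtain ⟨s, hs, hs0⟩ := (hev.and self_mem_nhdsWithin).exists
  have hsA : ∀ i, A i ≤ 1 + ∑ i, A i := fun i =>
    (Finset.single_le_sum (fun i _ => (hA i).le) (Finset.mem_univ i)).trans
      (le_add_of_nonneg_left zero_le_one)
  have hA0 : 0 ≤ ∑ i, A i := Finset.sum_nonneg fun i _ => (hA i).le
  refine ⟨s, hs0, 1 + ∑ i, A i, ∑ i, C i, by linarith, Finset.sum_nonneg fun i _ => hC i,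
    fun i => ?_⟩
  have h1 : CauchyBound (Metric.ball z (r i)) (A i) (C i) 0 (F i) :=
    CauchyBound.of_bound (fun x hx => (h i x hx).1.contDiffAt) fun x hx => (h i x hx).2
  exact (h1.mono_set (Metric.ball_subset_ball (hs i).le)).mono (hA i).le (hsA i) (hC i)
    (Finset.single_le_sum (fun i _ => hC i) (Finset.mem_univ i))

/-- A function vanishing at `z` has a Cauchy bound with arbitrarily small constant near `z`, at the
price of a larger `A`. -/
theorem CauchyBound.exists_small {z : R3} {r A C δ : ℝ} {ρ : R3 → ℝ} (hr : 0 < r) (hA : 0 < A)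
    (hC : 0 ≤ C) (hδ : 0 < δ) (h : CauchyBound (Metric.ball z r) A C 0 ρ) (hz : ρ z = 0) :
    ∃ r' > 0, r' ≤ r ∧ ∃ A', A ≤ A' ∧ CauchyBound (Metric.ball z r') A' δ 0 ρ := by
  have hc : ContinuousAt ρ z := (h.contDiffAt z (Metric.mem_ball_self hr)).continuousAt
  obtain ⟨s, hs, hsδ⟩ := Metric.continuousAt_iff.1 hc δ hδ
  set t := 1 + C / δ with ht
  have hCδ : 0 ≤ C / δ := by positivity
  have ht1 : 1 ≤ t := by linarith
  refine ⟨min r s, lt_min hr hs, min_le_left _ _, t * A, le_mul_of_one_le_left hA.le ht1,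
    of_bound (fun x hx => h.contDiffAt x (Metric.ball_subset_ball (min_le_left _ _) hx))
      fun x hx n => ?_⟩
  have hxr := Metric.ball_subset_ball (min_le_left r s) hx
  rcases n with _ | n
  · have := hsδ (Metric.ball_subset_ball (min_le_right r s) hx)
    rw [hz, Real.dist_eq, sub_zero] at this
    simpa using this.le
  · refine (h.bound_zero hxr (n + 1)).trans ?_
    have h1 : C ≤ δ * t ^ (n + 1) := by
      have h2 : t ≤ t ^ (n + 1) := le_self_pow₀ ht1 (Nat.succ_ne_zero n)
      have h3 : C ≤ δ * t := by
        rw [ht, mul_add, mul_div_cancel₀ _ hδ.ne']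
        linarith
      exact h3.trans (by gcongr)
    rw [mul_pow, ← mul_assoc]
    gcongr

theorem CauchyBound.pow_mul {S : Set R3} {A C δ : ℝ} {ρ F : R3 → ℝ} (hS : IsOpen S) (hA : 0 ≤ A)
    (hC : 0 ≤ C) (hδ : 0 ≤ δ) (hρ : CauchyBound S (A / 2) δ 0 ρ) (h : CauchyBound S A C 0 F)
    (m : ℕ) :
    CauchyBound S A ((2 * δ) ^ m * C) 0 (fun x => ρ x ^ m * F x) := by
  induction m with
  | zero => simpa using h
  | succ m ih =>
    have := CauchyBound.mul hS hρ ih hA hδ (by positivity)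
    convert this using 1
    · ring
    · ext x; ring

/-- A first order operator with analytic coefficients raises the order by one. -/
theorem CauchyBound.firstOrderOp {S : Set R3} {A B C : ℝ} {k : ℕ} {p : Fin 3 → Fin 3 → R3 → ℝ}
    {q : Fin 3 → R3 → ℝ} {v : CovectorField} (hS : IsOpen S) (hA : 0 ≤ A) (hB : 0 ≤ B) (hC : 0 ≤ C)
    (hp : ∀ l m, CauchyBound S (A / 2) B 0 (p l m)) (hq : ∀ l, CauchyBound S (A / 2) B 0 (q l))
    (hv : ∀ l, CauchyBound S A C k fun x => v x l) :
    CauchyBound S A ((k + 1) * (6 * B * (3 * A + 1)) * C) (k + 1) (firstOrderOp p q v) := by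
  have h1 : CauchyBound S A (∑ _l : Fin 3, ∑ _m : Fin 3, 2 * B * ((k + 1) * (A * C))) (k + 1)
      fun x => ∑ l, ∑ m, p l m x * 𝜕 (fun y => v y l) m x :=
    CauchyBound.sum hA fun l _ => CauchyBound.sum hA fun m _ =>
      CauchyBound.mul hS (hp l m) ((hv l).partial_deriv m) hA hB (by positivity)
  have h2 : CauchyBound S A (∑ _l : Fin 3, 2 * B * C) (k + 1) fun x => ∑ l, q l x * v x l :=
    CauchyBound.sum hA fun l _ => CauchyBound.mul hS (hq l) ((hv l).succ_order hA hC) hA hB hC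
  refine (h1.add h2).mono hA le_rfl (by positivity) ?_
  simp only [Finset.sum_const, Finset.card_univ, Fintype.card_fin, nsmul_eq_mul]
  push_cast
  have h3 : 0 ≤ k * (6 * B * C) := by positivity
  linarith

/-! ### The gauge near a point of an analytic boundary -/

/-- Common Cauchy bounds for everything that enters the recursion for the coefficients of the formal
solution. The bound is stated with `A / 2` to leave room for products. -/
structure GaugeBound (g f : TensorField) (ρ : R3 → ℝ) (S : Set R3) (A B : ℝ) : Prop where
  coeff : ∀ i l m, CauchyBound S (A / 2) B 0 (normalCoeff g ρ i l m)
  coeffZero : ∀ i l, CauchyBound S (A / 2) B 0 (normalCoeffZero g ρ i l)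
  inv : ∀ i l, CauchyBound S (A / 2) B 0 fun x => (symbol g ρ x)⁻¹ i l
  normal : ∀ i, CauchyBound S (A / 2) B 0 fun x => normalPart g ρ f x i
  dBCoeff : ∀ i j l m, CauchyBound S (A / 2) B 0 (MixedRay.dBCoeff g i j l m)
  dBCoeffZero : ∀ i j l, CauchyBound S (A / 2) B 0 (MixedRay.dBCoeffZero g i j l)
  tensor : ∀ i j, CauchyBound S (A / 2) B 0 fun x => f x i j
  defining : CauchyBound S (A / 2) B 0 ρ

theorem GaugeBound.mono {g f : TensorField} {ρ : R3 → ℝ} {S S' : Set R3} {A A' B : ℝ}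
    (h : GaugeBound g f ρ S A B) (hS : S' ⊆ S) (hA : 0 ≤ A) (hAA : A ≤ A') (hB : 0 ≤ B) :
    GaugeBound g f ρ S' A' B := by
  have key : ∀ {F : R3 → ℝ}, CauchyBound S (A / 2) B 0 F → CauchyBound S' (A' / 2) B 0 F := fun h =>
    (h.mono_set hS).mono (by positivity) (by linarith) hB le_rfl
  exact ⟨fun i l m => key (h.coeff i l m), fun i l => key (h.coeffZero i l),
    fun i l => key (h.inv i l), fun i => key (h.normal i), fun i j l m => key (h.dBCoeff i j l m),
    fun i j l => key (h.dBCoeffZero i j l), fun i j => key (h.tensor i j), key h.defining⟩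

theorem exists_gaugeBound {g f : TensorField} {ρ : R3 → ℝ} {O : Set R3} {z : R3}
    (h : IsGaugeDomain ω g f ρ O) (hz : z ∈ O) :
    ∃ r > 0, Metric.ball z r ⊆ O ∧ ∃ A B : ℝ, 0 < A ∧ 0 ≤ B ∧
      GaugeBound g f ρ (Metric.ball z r) A B := by
  have hω : (ω : WithTop ℕ∞) + 1 ≤ ω := le_top
  have hg := fun i j => h.metric i j z hz
  have hf := fun i j => h.tensor i j z hz
  have hρ := h.defining z hz
  have hdet := h.det_ne z hz
  obtain ⟨r₁, hr₁, A₁, B₁, hA₁, hB₁, h₁⟩ := exists_cauchyBound (z := z)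
    (F := fun q : Fin 3 × Fin 3 × Fin 3 => normalCoeff g ρ q.1 q.2.1 q.2.2)
    fun q => (contDiffAt_normalCoeff hω hg hdet hρ _ _ _).analyticAt
  obtain ⟨r₂, hr₂, A₂, B₂, hA₂, hB₂, h₂⟩ := exists_cauchyBound (z := z)
    (F := fun q : Fin 3 × Fin 3 => normalCoeffZero g ρ q.1 q.2)
    fun q => (contDiffAt_normalCoeffZero hω hg hdet hρ _ _).analyticAt
  obtain ⟨r₃, hr₃, A₃, B₃, hA₃, hB₃, h₃⟩ := exists_cauchyBound (z := z)
    (F := fun (q : Fin 3 × Fin 3) x => (symbol g ρ x)⁻¹ q.1 q.2)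
    fun q => (contDiffAt_matrix_inv (contDiffAt_symbol hω hg hdet hρ) (h.symbol_ne z hz)
      q.1 q.2).analyticAt
  obtain ⟨r₄, hr₄, A₄, B₄, hA₄, hB₄, h₄⟩ := exists_cauchyBound (z := z)
    (F := fun (i : Fin 3) x => normalPart g ρ f x i)
    fun i => (contDiffAt_normalPart hω hg hf hdet hρ i).analyticAt
  obtain ⟨r₅, hr₅, A₅, B₅, hA₅, hB₅, h₅⟩ := exists_cauchyBound (z := z)
    (F := fun q : (Fin 3 × Fin 3) × Fin 3 × Fin 3 => dBCoeff g q.1.1 q.1.2 q.2.1 q.2.2)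
    fun q => (contDiffAt_dBCoeff hg hdet _ _ _ _).analyticAt
  obtain ⟨r₆, hr₆, A₆, B₆, hA₆, hB₆, h₆⟩ := exists_cauchyBound (z := z)
    (F := fun q : (Fin 3 × Fin 3) × Fin 3 => dBCoeffZero g q.1.1 q.1.2 q.2)
    fun q => (contDiffAt_dBCoeffZero hω hg hdet _ _ _).analyticAt
  obtain ⟨r₇, hr₇, A₇, B₇, hA₇, hB₇, h₇⟩ := exists_cauchyBound (z := z)
    (F := fun (q : Fin 3 × Fin 3) x => f x q.1 q.2) fun q => (hf q.1 q.2).analyticAt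
  obtain ⟨r₈, hr₈, A₈, B₈, hA₈, hB₈, h₈⟩ := exists_cauchyBound (z := z)
    (F := fun _ : Unit => ρ) fun _ => hρ.analyticAt
  obtain ⟨r₀, hr₀, hO⟩ := Metric.isOpen_iff.1 h.isOpen z hz
  have hev : ∀ᶠ s in 𝓝[>] (0 : ℝ),
      (s < r₀ ∧ s < r₁ ∧ s < r₂ ∧ s < r₃) ∧ s < r₄ ∧ s < r₅ ∧ s < r₆ ∧ s < r₇ ∧ s < r₈ := by
    have e : ∀ t : ℝ, 0 < t → ∀ᶠ s in 𝓝[>] (0 : ℝ), s < t := fun t ht =>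
      (eventually_lt_nhds ht).filter_mono nhdsWithin_le_nhds
    filter_upwards [e _ hr₀, e _ hr₁, e _ hr₂, e _ hr₃, e _ hr₄, e _ hr₅, e _ hr₆, e _ hr₇,
      e _ hr₈] with s s0 s1 s2 s3 s4 s5 s6 s7 s8
    exact ⟨⟨s0, s1, s2, s3⟩, s4, s5, s6, s7, s8⟩
  obtain ⟨s, ⟨⟨s0, s1, s2, s3⟩, s4, s5, s6, s7, s8⟩, hs⟩ := (hev.and self_mem_nhdsWithin).exists
  refine ⟨s, hs, (Metric.ball_subset_ball s0.le).trans hO,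
    2 * (A₁ + A₂ + A₃ + A₄ + A₅ + A₆ + A₇ + A₈), B₁ + B₂ + B₃ + B₄ + B₅ + B₆ + B₇ + B₈,
    by positivity, by positivity, ?_⟩
  have key : ∀ {t a b : ℝ} {F : R3 → ℝ}, CauchyBound (Metric.ball z t) a b 0 F → s < t → 0 < a →
      0 ≤ b → a ≤ A₁ + A₂ + A₃ + A₄ + A₅ + A₆ + A₇ + A₈ →
      b ≤ B₁ + B₂ + B₃ + B₄ + B₅ + B₆ + B₇ + B₈ → CauchyBound (Metric.ball z s)
        (2 * (A₁ + A₂ + A₃ + A₄ + A₅ + A₆ + A₇ + A₈) / 2)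
        (B₁ + B₂ + B₃ + B₄ + B₅ + B₆ + B₇ + B₈) 0 F := fun h ht ha hb haa hbb =>
    (h.mono_set (Metric.ball_subset_ball ht.le)).mono ha.le
      (by rwa [mul_div_cancel_left₀ _ two_ne_zero]) hb hbb
  exact ⟨fun i l m => key (h₁ (i, l, m)) s1 hA₁ hB₁ (by linarith) (by linarith),
    fun i l => key (h₂ (i, l)) s2 hA₂ hB₂ (by linarith) (by linarith),
    fun i l => key (h₃ (i, l)) s3 hA₃ hB₃ (by linarith) (by linarith),
    fun i => key (h₄ i) s4 hA₄ hB₄ (by linarith) (by linarith),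
    fun i j l m => key (h₅ ((i, j), l, m)) s5 hA₅ hB₅ (by linarith) (by linarith),
    fun i j l => key (h₆ ((i, j), l)) s6 hA₆ hB₆ (by linarith) (by linarith),
    fun i j => key (h₇ (i, j)) s7 hA₇ hB₇ (by linarith) (by linarith),
    key (h₈ ()) s8 hA₈ hB₈ (by linarith) (by linarith)⟩

section bounds

variable {g f : TensorField} {ρ : R3 → ℝ} {S : Set R3} {A B : ℝ}

theorem cauchyBound_inv_mulVec (hS : IsOpen S) (hA : 0 ≤ A) (hB : 0 ≤ B)
    (h : GaugeBound g f ρ S A B) {C : ℝ} {k : ℕ} {a : CovectorField} (hC : 0 ≤ C)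
    (ha : ∀ i, CauchyBound S A C k fun x => a x i) (i : Fin 3) :
    CauchyBound S A (6 * B * C) k fun x => ((symbol g ρ x)⁻¹.mulVec (a x)) i := by
  have h1 : CauchyBound S A (∑ _l : Fin 3, 2 * B * C) k
      fun x => ∑ l, (symbol g ρ x)⁻¹ i l * a x l :=
    CauchyBound.sum hA fun l _ => CauchyBound.mul hS (h.inv i l) (ha l) hA hB hC
  refine h1.mono hA le_rfl (by positivity) (le_of_eq ?_)
  simp only [Finset.sum_const, Finset.card_univ, Fintype.card_fin, nsmul_eq_mul]
  push_cast
  ring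

/-- The `k`-th coefficient of the formal solution has a Cauchy bound of order `k` with geometrically
growing constant: the factor `1 / (k + 2)` of the recursion makes up for the loss `k + 1` in a first
order operator. -/
theorem cauchyBound_gaugeSeq (hS : IsOpen S) (hA : 0 ≤ A) (hB : 0 ≤ B)
    (h : GaugeBound g f ρ S A B) (k : ℕ) (i : Fin 3) :
    CauchyBound S A (6 * B * B * (6 * B * (6 * B * (3 * A + 1))) ^ k) k
      fun x => gaugeSeq g ρ f k x i := by
  induction k generalizing i with
  | zero =>
    have := cauchyBound_inv_mulVec hS hA hB h hB (a := normalPart g ρ f)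
      (fun i => (h.normal i).mono (by positivity) (by linarith) hB le_rfl) i
    simpa [gaugeSeq] using this
  | succ k ih =>
    set D := 6 * B * (3 * A + 1) with hD
    have hD0 : 0 ≤ D := by positivity
    have hCk : 0 ≤ 6 * B * B * (6 * B * D) ^ k := by positivity
    have h1 : ∀ i, CauchyBound S A ((k + 1) * D * (6 * B * B * (6 * B * D) ^ k)) (k + 1)
        fun x => normalPart g ρ (dB univ g (gaugeSeq g ρ f k)) x i := by
      intro i
      simp only [normalPart_dB]
      exact CauchyBound.firstOrderOp hS hA hB hCk (fun l m => h.coeff i l m)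
        (fun l => h.coeffZero i l) ih
    have h2 := (cauchyBound_inv_mulVec hS hA hB h (by positivity) h1 i).const_mul
      (-(1 / ((k : ℝ) + 2)))
    have hk : 0 ≤ (k : ℝ) := Nat.cast_nonneg k
    refine h2.mono hA le_rfl (by positivity) ?_
    rw [abs_neg, abs_of_nonneg (by positivity), pow_succ]
    have h3 : 1 / ((k : ℝ) + 2) * (k + 1) ≤ 1 := by
      rw [one_div, inv_mul_le_iff₀ (by positivity)]
      linarith
    calc 1 / ((k : ℝ) + 2) * (6 * B * ((k + 1) * D * (6 * B * B * (6 * B * D) ^ k)))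
        = (1 / ((k : ℝ) + 2) * (k + 1)) * (6 * B * B * ((6 * B * D) ^ k * (6 * B * D))) := by ring
      _ ≤ 1 * (6 * B * B * ((6 * B * D) ^ k * (6 * B * D))) := by gcongr
      _ = _ := one_mul _

end bounds

/-- The formal solution converges near a point of the zero set of an analytic `ρ`. -/
theorem exists_analytic_gauge {g f : TensorField} {ρ : R3 → ℝ} {O : Set R3} {z : R3}
    (h : IsGaugeDomain ω g f ρ O) (hz : z ∈ O) (hρz : ρ z = 0) :
    ∃ r > 0, Metric.ball z r ⊆ O ∧ ∃ (A C : ℝ) (v : CovectorField), 0 < A ∧ 0 ≤ C ∧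
      (∀ i, CauchyBound (Metric.ball z r) A C 0 fun x => v x i) ∧
      (∀ i j, CauchyBound (Metric.ball z r) A C 0 fun x => f x i j - dB univ g v x i j) ∧
      (∀ x ∈ Metric.ball z r, ρ x = 0 → v x = 0) ∧
      ∀ x ∈ Metric.ball z r, ∀ i,
        normalPart g ρ (fun y i j => f y i j - dB univ g v y i j) x i = 0 := by
  obtain ⟨r₀, hr₀, hrO, A₀, B, hA₀, hB, hb₀⟩ := exists_gaugeBound h hz
  obtain ⟨κ, hκ⟩ : ∃ κ, κ = 6 * B * (6 * B * (3 * A₀ + 1)) := ⟨_, rfl⟩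
  have hκ0 : 0 ≤ κ := by rw [hκ]; positivity
  have hseq : ∀ k i, CauchyBound (Metric.ball z r₀) A₀ (6 * B * B * κ ^ k) k
      fun x => gaugeSeq g ρ f k x i := fun k i => by
    rw [hκ]
    exact cauchyBound_gaugeSeq Metric.isOpen_ball hA₀.le hB hb₀ k i
  -- near `z` the powers of `ρ` have to beat the growth `κ ^ k` of the coefficients, a factor
  -- `2 ^ k` for lowering their order to zero and a factor `2 ^ k` for the products
  set δ := 1 / (8 * (κ + 1)) with hδ
  have hδ0 : 0 < δ := by positivity
  have hδκ : 4 * δ * κ ≤ 1 / 2 := by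
    rw [hδ, mul_one_div, div_mul_eq_mul_div, div_le_iff₀ (by positivity)]
    linarith
  obtain ⟨r, hr, hrr, A₁, hA₁, hρs⟩ :=
    hb₀.defining.exists_small hr₀ (half_pos hA₀) hB hδ0 hρz
  set A := 4 * A₁ with hA
  have hA0 : 0 < A := by linarith
  set S := Metric.ball z r with hS
  have hSo : IsOpen S := Metric.isOpen_ball
  have hSO : S ⊆ O := (Metric.ball_subset_ball hrr).trans hrO
  have hb := hb₀.mono (Metric.ball_subset_ball hrr) hA₀.le (by linarith : A₀ ≤ A) hB
  have hρb : CauchyBound S (A / 2) δ 0 ρ := hρs.mono (by linarith) (by linarith) hδ0.le le_rfl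
  set a : ℕ → CovectorField := gaugeSeq g ρ f with ha
  have hak : ∀ k i, CauchyBound S A₀ (6 * B * B * κ ^ k) k fun x => a k x i := fun k i =>
    (hseq k i).mono_set (Metric.ball_subset_ball hrr)
  have hak0 : ∀ k i, CauchyBound S A (6 * B * B * κ ^ k * 2 ^ k) 0 fun x => a k x i := fun k i =>
    ((hak k i).order_zero hA₀.le (by positivity)).mono (by positivity) (by linarith)
      (by positivity) le_rfl
  set F : ℕ → CovectorField := fun k x i => ρ x ^ (k + 1) * a k x i with hF
  set Ck : ℕ → ℝ := fun k => 2 * δ * (6 * B * B) * (1 / 2) ^ k with hCk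
  have hCsum : Summable Ck := summable_geometric_two.mul_left _
  have hFk : ∀ i k, CauchyBound S A (Ck k) 0 fun x => F k x i := by
    intro i k
    refine (CauchyBound.pow_mul hSo hA0.le (by positivity) hδ0.le hρb (hak0 k i) (k + 1)).mono
      hA0.le le_rfl (by positivity) ?_
    calc (2 * δ) ^ (k + 1) * (6 * B * B * κ ^ k * 2 ^ k)
        = 2 * δ * (6 * B * B) * (4 * δ * κ) ^ k := by
          rw [pow_succ, show 4 * δ * κ = 2 * δ * κ * 2 by ring, mul_pow, mul_pow]; ring
      _ ≤ 2 * δ * (6 * B * B) * (1 / 2) ^ k := by gcongr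
  set v : CovectorField := fun x i => ∑' k, F k x i with hv
  have hpc : IsPreconnected S := (convex_ball z r).isPreconnected
  have htsum := fun i => CauchyBound.tsum hSo hpc hCsum (hFk i)
  have hC0 : 0 ≤ ∑' k, Ck k := tsum_nonneg fun k => by positivity
  have hvb : ∀ i, CauchyBound S A (∑' k, Ck k) 0 fun x => v x i := fun i => (htsum i).1
  have hdBb : ∀ i j, CauchyBound S (2 * A) (B + 2 * (6 * B * (3 * A + 1) * ∑' k, Ck k)) 0
      fun x => f x i j - dB univ g v x i j := by
    intro i j
    simp only [dB_eq_firstOrderOp]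
    have h1 := (CauchyBound.firstOrderOp hSo hA0.le hB hC0 (fun l m => hb.dBCoeff i j l m)
      (fun l => hb.dBCoeffZero i j l) hvb).order_zero hA0.le (by positivity)
    have h2 := ((hb.tensor i j).mono (by positivity) (by linarith : A / 2 ≤ 2 * A) hB le_rfl).sub h1
    refine h2.mono (by positivity) le_rfl (by positivity) (le_of_eq ?_)
    simp only [Nat.cast_zero, zero_add, pow_one, one_mul]
    ring
  have hD0 : 0 ≤ 2 * (6 * B * (3 * A + 1) * ∑' k, Ck k) := by positivity
  refine ⟨r, hr, hSO, 2 * A, B + 2 * (6 * B * (3 * A + 1) * ∑' k, Ck k) + ∑' k, Ck k, v,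
    by positivity, by positivity, fun i => (hvb i).mono hA0.le (by linarith) hC0 (by linarith),
    fun i j => (hdBb i j).mono (by positivity) le_rfl (by positivity) (by linarith),
    fun x _ hx0 => ?_, fun x hx i => ?_⟩
  · ext i
    simp [hv, hF, hx0]
  · rw [normalPart_sub]
    -- the series is differentiated term by term and the result telescopes
    have h1 : HasSum (fun k => normalPart g ρ (dB univ g (F k)) x i)
        (normalPart g ρ (dB univ g v) x i) := by
      simp only [normalPart_dB, firstOrderOp]
      refine (hasSum_sum fun l _ => hasSum_sum fun m _ => ?_).add (hasSum_sum fun l _ => ?_)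
      · exact (((htsum l).2 x hx).2 m).mul_left _
      · exact ((htsum l).2 x hx).1.mul_left _
    have hterm : ∀ k, normalPart g ρ (dB univ g (F k)) x i
        = ρ x ^ k * gaugeRem g ρ f k x i - ρ x ^ (k + 1) * gaugeRem g ρ f (k + 1) x i := fun k =>
      normalPart_dB_pow_mul_gaugeSeq h le_top (by simp) k (hSO hx) i
    simp only [hterm] at h1
    have h2 := h1.tendsto_sum_nat
    simp only [Finset.sum_range_sub'] at h2
    -- the remainder of the `K`-th partial sum tends to zero
    have hrem : Tendsto (fun K => ρ x ^ K * gaugeRem g ρ f K x i) atTop (𝓝 0) := by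
      rw [← tendsto_add_atTop_iff_nat 1]
      set D := 6 * B * (3 * A₀ + 1) with hD
      have hD0 : 0 ≤ D := by positivity
      have hR : ∀ K : ℕ, |gaugeRem g ρ f (K + 1) x i| ≤ (K + 1) * D * (6 * B * B * κ ^ K) := by
        intro K
        have h3 := CauchyBound.firstOrderOp Metric.isOpen_ball hA₀.le hB
          (by positivity : 0 ≤ 6 * B * B * κ ^ K)
          (fun l m => hb₀.coeff i l m) (fun l => hb₀.coeffZero i l)
          (hseq K)
        have h4 := h3.bound x (Metric.ball_subset_ball hrr hx) 0
        simp only [norm_iteratedFDeriv_zero, Real.norm_eq_abs, pow_zero, mul_one,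
          Nat.factorial_zero, Nat.cast_one, zero_add, Nat.choose_self] at h4
        simp only [gaugeRem, abs_neg, normalPart_dB, Pi.neg_apply]
        exact h4
      have hρx : |ρ x| ≤ δ := hρb.abs_le hx
      refine squeeze_zero_norm (a := fun K : ℕ => δ * D * (6 * B * B) * ((K + 1) * (1 / 2) ^ K))
        (fun K => ?_) ?_
      · rw [Real.norm_eq_abs, abs_mul, abs_pow]
        have h5 : δ * κ ≤ 1 / 2 := by
          have : 0 ≤ δ * κ := by positivity
          linarith
        calc |ρ x| ^ (K + 1) * |gaugeRem g ρ f (K + 1) x i|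
            ≤ δ ^ (K + 1) * ((K + 1) * D * (6 * B * B * κ ^ K)) := by
              gcongr
              exact hR K
          _ = δ * D * (6 * B * B) * ((K + 1) * (δ * κ) ^ K) := by
              rw [pow_succ, mul_pow]; ring
          _ ≤ δ * D * (6 * B * B) * ((K + 1) * (1 / 2) ^ K) := by gcongr
      · have h6 : Tendsto (fun K : ℕ => ((K : ℝ) + 1) * (1 / 2) ^ K) atTop (𝓝 0) := by
          have h7 := tendsto_self_mul_const_pow_of_lt_one (r := (1 / 2 : ℝ)) (by norm_num)
            (by norm_num)
          have h8 := tendsto_pow_atTop_nhds_zero_of_lt_one (r := (1 / 2 : ℝ)) (by norm_num)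
            (by norm_num)
          simpa [add_mul] using h7.add h8
        simpa using h6.const_mul (δ * D * (6 * B * B))
    have h9 : Tendsto (fun K => ρ x ^ 0 * gaugeRem g ρ f 0 x i - ρ x ^ K * gaugeRem g ρ f K x i)
        atTop (𝓝 (normalPart g ρ f x i)) := by
      simpa [gaugeRem] using (tendsto_const_nhds (x := normalPart g ρ f x i)).sub hrem
    rw [tendsto_nhds_unique h2 h9, sub_self]

/-! ### Comparison of the analytic and the smooth gauge -/

/-- The gauge condition determines the jet along the boundary: if `v` vanishes on the boundary and
`(d^𝓑 v)(·, ∇ρ)` is flat there, then `v` is flat. Modulo tangential derivatives, which lose nothing,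
the condition reads `symbol · ∂_ν v = 0`. -/
theorem vanishesOn_of_normalPart_dB {g f : TensorField} {ρ : R3 → ℝ} {O S : Set R3}
    {w : CovectorField} (hD : IsGaugeDomain ω g f ρ O) (hSO : S ⊆ O)
    (hS : ∀ x ∈ S, ρ x = 0 ∧ fderiv ℝ ρ x ≠ 0 ∧ ∀ᶠ y in 𝓝 x, ρ y = 0 → y ∈ S)
    (hw : ∀ l, ∀ x ∈ S, ContDiffAt ℝ ∞ (fun y => w y l) x) (hw0 : ∀ x ∈ S, w x = 0)
    (h : ∀ k i, VanishesOn S k fun x => normalPart g ρ (dB univ g w) x i) (k : ℕ) (l : Fin 3) :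
    VanishesOn S k fun x => w x l := by
  have hle : (∞ : WithTop ℕ∞) ≤ ω := le_top
  have hρ : ∀ x ∈ S, ContDiffAt ℝ ∞ ρ x := fun x hx => (hD.defining x (hSO hx)).of_le hle
  have hg : ∀ x ∈ S, ∀ i j, ContDiffAt ℝ ∞ (fun y => g y i j) x := fun x hx i j =>
    (hD.metric i j x (hSO hx)).of_le hle
  have hdet : ∀ x ∈ S, (g x).det ≠ 0 := fun x hx => hD.det_ne x (hSO hx)
  have hinf : (∞ : WithTop ℕ∞) + 1 ≤ ∞ := by simp
  have hρ' : ∀ i, ∀ x ∈ S, ContDiffAt ℝ ∞ (𝜕 ρ i) x := fun i x hx => contDiffAt_pd (hρ x hx) i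
  have hw' : ∀ l m, ∀ x ∈ S, ContDiffAt ℝ ∞ (𝜕 (fun y => w y l) m) x := fun l m x hx =>
    contDiffAt_pd (hw l x hx) m
  have hp : ∀ i l m, ∀ x ∈ S, ContDiffAt ℝ ∞ (normalCoeff g ρ i l m) x := fun i l m x hx =>
    contDiffAt_normalCoeff hinf (hg x hx) (hdet x hx) (hρ x hx) i l m
  have hq : ∀ i l, ∀ x ∈ S, ContDiffAt ℝ ∞ (normalCoeffZero g ρ i l) x := fun i l x hx =>
    contDiffAt_normalCoeffZero hinf (hg x hx) (hdet x hx) (hρ x hx) i l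
  have hσ : ∀ i l, ∀ x ∈ S, ContDiffAt ℝ ∞ (fun y => symbol g ρ y i l) x := fun i l x hx =>
    contDiffAt_symbol hinf (hg x hx) (hdet x hx) (hρ x hx) i l
  have hσi : ∀ i l, ∀ x ∈ S, ContDiffAt ℝ ∞ (fun y => (symbol g ρ y)⁻¹ i l) x := fun i l x hx =>
    contDiffAt_matrix_inv (fun i l => hσ i l x hx) (hD.symbol_ne x (hSO hx)) i l
  set ν : R3 → ℝ := fun x => ∑ j, 𝜕 ρ j x * 𝜕 ρ j x with hν
  have hνs : ∀ x ∈ S, ContDiffAt ℝ ∞ ν x := fun x hx =>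
    ContDiffAt.sum fun j _ => (hρ' j x hx).mul (hρ' j x hx)
  set Nw : Fin 3 → R3 → ℝ := fun l x => ∑ j, 𝜕 ρ j x * 𝜕 (fun y => w y l) j x with hNw
  have hNws : ∀ l, ∀ x ∈ S, ContDiffAt ℝ ∞ (Nw l) x := fun l x hx =>
    ContDiffAt.sum fun j _ => (hρ' j x hx).mul (hw' l j x hx)
  set T : Fin 3 → Fin 3 → R3 → ℝ := fun l m x =>
    ∑ j, 𝜕 ρ j x * (𝜕 ρ j x * 𝜕 (fun y => w y l) m x - 𝜕 ρ m x * 𝜕 (fun y => w y l) j x) with hT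
  have hTs' : ∀ l m j, ∀ x ∈ S, ContDiffAt ℝ ∞ (fun x =>
      𝜕 ρ j x * 𝜕 (fun y => w y l) m x - 𝜕 ρ m x * 𝜕 (fun y => w y l) j x) x := fun l m j x hx =>
    ((hρ' j x hx).mul (hw' l m x hx)).sub ((hρ' m x hx).mul (hw' l j x hx))
  have hTs : ∀ l m, ∀ x ∈ S, ContDiffAt ℝ ∞ (T l m) x := fun l m x hx =>
    ContDiffAt.sum fun j _ => (hρ' j x hx).mul (hTs' l m j x hx)
  suffices hind : ∀ k l, VanishesOn S (k + 1) fun x => w x l from (hind k l).mono (Nat.le_succ k)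
  intro k
  induction k with
  | zero =>
    exact fun l => (VanishesOn.succ_iff (hw l)).2
      ⟨fun x hx => by rw [hw0 x hx]; rfl, fun i => VanishesOn.zero_order⟩
  | succ k ih =>
    have hTv : ∀ l m, VanishesOn S (k + 1) (T l m) := fun l m =>
      VanishesOn.sum (fun j _ x hx => (hρ' j x hx).mul (hTs' l m j x hx)) fun j _ =>
        VanishesOn.mul (hρ' j) (hTs' l m j) (VanishesOn.tangential hρ hS (hw l) (ih l) m j)
    have hE : ∀ i, ∀ x ∈ S,
        ContDiffAt ℝ ∞ (fun x => normalPart g ρ (dB univ g w) x i) x := fun i x hx => by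
      simp only [normalPart_dB]
      exact contDiffAt_firstOrderOp hinf (fun l m => hp i l m x hx) (fun l => hq i l x hx)
        fun l => hw l x hx
    have hqs : ∀ i, ∀ x ∈ S, ContDiffAt ℝ ∞ (fun x => ∑ l, normalCoeffZero g ρ i l x * w x l) x :=
      fun i x hx => ContDiffAt.sum fun l _ => (hq i l x hx).mul (hw l x hx)
    have hpT : ∀ i, ∀ x ∈ S, ContDiffAt ℝ ∞
        (fun x => ∑ l, ∑ m, normalCoeff g ρ i l m x * T l m x) x := fun i x hx =>
      ContDiffAt.sum fun l _ => ContDiffAt.sum fun m _ => (hp i l m x hx).mul (hTs l m x hx)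
    have hsv : ∀ i, VanishesOn S (k + 1) fun x => ∑ l, symbol g ρ x i l * Nw l x := by
      intro i
      have h1 : VanishesOn S (k + 1) fun x => ν x * (normalPart g ρ (dB univ g w) x i
          - ∑ l, normalCoeffZero g ρ i l x * w x l)
            - ∑ l, ∑ m, normalCoeff g ρ i l m x * T l m x := by
        refine VanishesOn.sub (fun x hx => (hνs x hx).mul ((hE i x hx).sub (hqs i x hx))) (hpT i)
          (VanishesOn.mul hνs (fun x hx => (hE i x hx).sub (hqs i x hx)) ?_) ?_
        · exact VanishesOn.sub (hE i) (hqs i) (h (k + 1) i) (VanishesOn.sum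
            (fun l _ x hx => (hq i l x hx).mul (hw l x hx))
            fun l _ => VanishesOn.mul (hq i l) (hw l) (ih l))
        · exact VanishesOn.sum (fun l _ x hx => ContDiffAt.sum fun m _ =>
            (hp i l m x hx).mul (hTs l m x hx)) fun l _ => VanishesOn.sum (fun m _ x hx =>
            (hp i l m x hx).mul (hTs l m x hx)) fun m _ => VanishesOn.mul (hp i l m) (hTs l m)
              (hTv l m)
      refine h1.congr fun x hx => Eventually.of_forall fun y => ?_
      simp only [normalPart_dB, firstOrderOp, symbol, Matrix.of_apply, hT, hν, hNw,
        Fin.sum_univ_three]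
      ring
    have hNv : ∀ l, VanishesOn S (k + 1) (Nw l) := by
      intro l
      have hs1 : ∀ i, ∀ x ∈ S, ContDiffAt ℝ ∞ (fun x => ∑ l, symbol g ρ x i l * Nw l x) x :=
        fun i x hx => ContDiffAt.sum fun l _ => (hσ i l x hx).mul (hNws l x hx)
      have h1 : VanishesOn S (k + 1) fun x =>
          ∑ i, (symbol g ρ x)⁻¹ l i * ∑ l, symbol g ρ x i l * Nw l x :=
        VanishesOn.sum (fun i _ x hx => (hσi l i x hx).mul (hs1 i x hx)) fun i _ =>
          VanishesOn.mul (hσi l i) (hs1 i) (hsv i)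
      refine h1.congr fun x hx => ?_
      filter_upwards [hD.isOpen.mem_nhds (hSO hx)] with y hy
      have h2 : (symbol g ρ y)⁻¹.mulVec ((symbol g ρ y).mulVec fun l => Nw l y) =
          fun l => Nw l y := by
        rw [Matrix.mulVec_mulVec, Matrix.nonsing_inv_mul _ (isUnit_iff_ne_zero.2
          (hD.symbol_ne y hy)), Matrix.one_mulVec]
      exact congrFun h2 l
    intro l
    refine VanishesOn.succ_of_transversal (N := fun l => 𝜕 ρ l) hρ hS hρ' (fun x hx h0 => ?_) (hw l)
      (ih l) (hNv l)
    refine (hS x hx).2.1 (ContinuousLinearMap.ext fun u => ?_)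
    have h3 : ∀ i, 𝜕 ρ i x = 0 := fun i => by
      have := (Finset.sum_eq_zero_iff_of_nonneg fun i _ => mul_self_nonneg (𝜕 ρ i x)).1 h0 i
        (Finset.mem_univ i)
      exact mul_self_eq_zero.1 this
    simp [fderiv_eq_sum, h3]

/-- Near a point of an analytic boundary, the convergent solution `v` of the gauge equation solves
`f = d^𝓑 v`: it has the same boundary jet as the smooth gauge `vs`, so `f - d^𝓑 v` is flat at the
boundary, and it is analytic. -/
theorem exists_local_analytic_solution {M W U : Set R3} {g f G F gω fω : TensorField}
    {vs : CovectorField} {ρ : R3 → ℝ} {z : R3} (hM : UniqueDiffOn ℝ M) (hMc : IsClosed M)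
    (hG : ∀ i j, ContDiff ℝ ∞ fun x => G x i j) (hF : ∀ i j, ContDiff ℝ ∞ fun x => F x i j)
    (hgG : EqOn g G M) (hfF : EqOn f F M) (hpos : ∀ x ∈ M, (g x).PosDef)
    (hvs : ∀ i, ContDiff ℝ ∞ fun x => vs x i) (hvs0 : ∀ x ∈ frontier M, vs x = 0)
    (hflat : ∀ k i j, VanishesOn (frontier M) k fun x => F x i j - dB univ G vs x i j)
    (hW : IsOpen W) (hgω : ∀ i j, ∀ x ∈ W, ContDiffAt ℝ ω (fun y => gω y i j) x)
    (hfω : ∀ i j, ∀ x ∈ W, ContDiffAt ℝ ω (fun y => fω y i j) x)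
    (hggω : EqOn g gω (W ∩ M)) (hffω : EqOn f fω (W ∩ M))
    (hρ : IsDefiningFunction ω M z U ρ) (hz : z ∈ frontier M) (hzW : z ∈ W) :
    ∃ r > 0, Metric.ball z r ⊆ W ∧ ∃ (A C : ℝ) (v : CovectorField), 0 < A ∧ A * r ≤ 1 ∧
      (∀ i, CauchyBound (Metric.ball z r) A C 0 fun x => v x i) ∧
      (∀ x ∈ Metric.ball z r, ∀ i j, fω x i j - dB univ gω v x i j = 0) ∧
      ∀ k i, VanishesOn (frontier M ∩ Metric.ball z r) k fun x => v x i - vs x i := by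
  have hle : (∞ : WithTop ℕ∞) ≤ ω := le_top
  have hinf : (∞ : WithTop ℕ∞) + 1 ≤ ∞ := by simp
  have hzM := hMc.frontier_subset hz
  obtain ⟨D, hDW, hD, hDmem⟩ := exists_isGaugeDomain (n := ω) le_top (hW.inter hρ.isOpen)
    (fun i j x hx => hgω i j x hx.1) (fun i j x hx => hfω i j x hx.1)
    (fun x hx => hρ.contDiffOn.contDiffAt (hρ.isOpen.mem_nhds hx.2))
  have hzD : z ∈ D := hDmem z ⟨hzW, hρ.mem⟩ (hggω ⟨hzW, hzM⟩ ▸ hpos z hzM) hρ.fderiv_ne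
  obtain ⟨r₀, hr₀, hr₀D, A, C, v, hA, hC, hvb, hAb, hv0, hvn⟩ :=
    exists_analytic_gauge hD hzD hρ.eq_zero
  have hρc : ContinuousAt (fderiv ℝ ρ) z :=
    ((hD.defining z hzD).fderiv_right (m := ω) le_top).continuousAt
  obtain ⟨r₁, hr₁, hr₁ne⟩ := Metric.eventually_nhds_iff_ball.1 (hρc.eventually_ne hρ.fderiv_ne)
  set r := min (min r₀ r₁) (1 / A) with hr
  have hrpos : 0 < r := lt_min (lt_min hr₀ hr₁) (by positivity)
  have hrr₀ : r ≤ r₀ := (min_le_left _ _).trans (min_le_left _ _)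
  have hrr₁ : r ≤ r₁ := (min_le_left _ _).trans (min_le_right _ _)
  have hAr : A * r ≤ 1 := by
    have := mul_le_mul_of_nonneg_left (min_le_right (min r₀ r₁) (1 / A)) hA.le
    rwa [mul_one_div_cancel hA.ne'] at this
  set Bz := Metric.ball z r with hBz
  have hBo : IsOpen Bz := Metric.isOpen_ball
  have hB₀ : Bz ⊆ Metric.ball z r₀ := Metric.ball_subset_ball hrr₀
  have hBD : Bz ⊆ D := hB₀.trans hr₀D
  have hBW : Bz ⊆ W := fun x hx => (hDW (hBD hx)).1
  have hBU : Bz ⊆ U := fun x hx => (hDW (hBD hx)).2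
  have hBne : ∀ x ∈ Bz, fderiv ℝ ρ x ≠ 0 := fun x hx =>
    hr₁ne x (Metric.ball_subset_ball hrr₁ hx)
  set S := frontier M ∩ Bz with hSdef
  have hzS : z ∈ S := ⟨hz, Metric.mem_ball_self hrpos⟩
  have hS0 : ∀ x ∈ S, ρ x = 0 := fun x hx => hρ.eq_zero_of_mem_frontier hMc (hBU hx.2) hx.1
  have hS : ∀ x ∈ S, ρ x = 0 ∧ fderiv ℝ ρ x ≠ 0 ∧ ∀ᶠ y in 𝓝 x, ρ y = 0 → y ∈ S := by
    intro x hx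
    refine ⟨hS0 x hx, hBne x hx.2, ?_⟩
    filter_upwards [hBo.mem_nhds hx.2] with y hy hy0
    exact ⟨hρ.mem_frontier_of_eq_zero (hBU hy) hy0 (hBne y hy), hy⟩
  have hgB : ∀ x ∈ Bz, ∀ i j, ContDiffAt ℝ ∞ (fun y => gω y i j) x := fun x hx i j =>
    (hgω i j x (hBW hx)).of_le hle
  have hfB : ∀ x ∈ Bz, ∀ i j, ContDiffAt ℝ ∞ (fun y => fω y i j) x := fun x hx i j =>
    (hfω i j x (hBW hx)).of_le hle
  have hρB : ∀ x ∈ Bz, ContDiffAt ℝ ∞ ρ x := fun x hx => (hD.defining x (hBD hx)).of_le hle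
  have hdet : ∀ x ∈ Bz, (gω x).det ≠ 0 := fun x hx => hD.det_ne x (hBD hx)
  have hvB : ∀ x ∈ Bz, ∀ i, ContDiffAt ℝ ∞ (fun y => v y i) x := fun x hx i =>
    (hvb i).contDiffAt x (hB₀ hx)
  have hdvs : ∀ x ∈ Bz, ∀ i j, ContDiffAt ℝ ∞ (fun y => dB univ gω vs y i j) x := fun x hx =>
    contDiffAt_dB hinf (hgB x hx) (hdet x hx) fun i => (hvs i).contDiffAt
  -- the analytic extensions leave the same jet at the boundary as the smooth ones
  have hsm : ∀ k i j, VanishesOn S k fun x => fω x i j - dB univ gω vs x i j := by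
    intro k i j
    have hsmooth : ∀ x ∈ M ∩ Bz, ContDiffAt ℝ ∞ (fun x => F x i j - dB univ G vs x i j) x :=
      fun x hx => (hF i j).contDiffAt.sub (contDiffAt_dB hinf (fun i j => (hG i j).contDiffAt)
        (by rw [← hgG hx.1]; exact (hpos x hx.1).det_pos.ne') (fun i => (hvs i).contDiffAt) i j)
    have hsm' : ∀ x ∈ M ∩ Bz, ContDiffAt ℝ ∞ (fun x => fω x i j - dB univ gω vs x i j) x :=
      fun x hx => (hfB x hx.2 i j).sub (hdvs x hx.2 i j)
    have h0 : ∀ x ∈ M ∩ Bz, fω x i j - dB univ gω vs x i j -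
        (F x i j - dB univ G vs x i j) = 0 := by
      intro x hx
      have hvd : ∀ i, DifferentiableAt ℝ (fun y => vs y i) x := fun i =>
        (hvs i).contDiffAt.differentiableAt (by simp)
      rw [← hffω ⟨hBW hx.2, hx.1⟩, ← hfF hx.1,
        ← dB_eq_of_eqOn hM hBo hx (fun i j => (hgB x hx.2 i j).differentiableAt (by simp)) hvd
          (fun y hy => hggω ⟨hBW hy.2, hy.1⟩) (fun _ _ => rfl) i j,
        ← dB_eq_of_eqOn hM hBo hx (fun i j => (hG i j).contDiffAt.differentiableAt (by simp)) hvd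
          (fun y hy => hgG hy.1) (fun _ _ => rfl) i j, sub_self]
    have hSM : S ⊆ M ∩ Bz := fun x hx => ⟨hMc.frontier_subset hx.1, hx.2⟩
    have h1 := (vanishesOn_of_eqOn_zero hM hBo (fun x hx => (hsm' x hx).sub (hsmooth x hx)) h0
      k).mono_set hSM
    have h2 := VanishesOn.add (fun x hx => (hsm' x (hSM hx)).sub (hsmooth x (hSM hx)))
      (fun x hx => hsmooth x (hSM hx)) h1 ((hflat k i j).mono_set inter_subset_left)
    simpa using h2
  set w : CovectorField := fun x i => v x i - vs x i with hw
  have hwB : ∀ x ∈ Bz, ∀ i, ContDiffAt ℝ ∞ (fun y => w y i) x := fun x hx i =>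
    (hvB x hx i).sub (hvs i).contDiffAt
  have hdw : ∀ x ∈ Bz, ∀ i j,
      dB univ gω w x i j = dB univ gω v x i j - dB univ gω vs x i j := fun x hx i j => by
    simp only [dB_eq_firstOrderOp]
    exact firstOrderOp_sub (fun l => (hvB x hx l).differentiableAt (by simp))
      fun l => (hvs l).contDiffAt.differentiableAt (by simp)
  have hgrad : ∀ x ∈ Bz, ∀ j, ContDiffAt ℝ ∞ (fun y => grad gω ρ y j) x := fun x hx j =>
    contDiffAt_grad hinf (hgB x hx) (hdet x hx) (hρB x hx) j
  -- both `v` and `vs` satisfy the gauge condition to infinite order at the boundary, so they have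
  -- the same jet there
  have hwn : ∀ k i, VanishesOn S k fun x => normalPart gω ρ (dB univ gω w) x i := by
    intro k i
    have h1 : VanishesOn S k fun x => ∑ j, grad gω ρ x j * (fω x i j - dB univ gω vs x i j) :=
      VanishesOn.sum (fun j _ x hx => (hgrad x hx.2 j).mul
        ((hfB x hx.2 i j).sub (hdvs x hx.2 i j))) fun j _ => VanishesOn.mul
          (fun x hx => hgrad x hx.2 j) (fun x hx => (hfB x hx.2 i j).sub (hdvs x hx.2 i j))
          (hsm k i j)
    refine h1.congr fun x hx => ?_
    filter_upwards [hBo.mem_nhds hx.2] with y hy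
    have h2 := hvn y (hB₀ hy) i
    simp only [normalPart, hdw y hy, sub_mul, Finset.sum_sub_distrib, mul_comm (grad _ _ _ _)]
      at h2 ⊢
    linarith
  have hwv : ∀ k l, VanishesOn S k fun x => w x l :=
    vanishesOn_of_normalPart_dB hD (fun x hx => hBD hx.2) hS (fun l x hx => hwB x hx.2 l)
      (fun x hx => by
        ext i
        simp [hw, hv0 x (hB₀ hx.2) (hS0 x hx), hvs0 x hx.1]) hwn
  -- hence `f - d^𝓑 v` is as flat as `f - d^𝓑 vs`
  have hfl : ∀ k i j, VanishesOn S k fun x => fω x i j - dB univ gω v x i j := by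
    intro k i j
    have hdwv : VanishesOn S k fun x => dB univ gω w x i j := by
      simp only [dB_eq_firstOrderOp]
      exact vanishesOn_firstOrderOp (fun l m x hx =>
          contDiffAt_dBCoeff (hgB x hx.2) (hdet x hx.2) _ _ _ _)
        (fun l x hx => contDiffAt_dBCoeffZero hinf (hgB x hx.2) (hdet x hx.2) _ _ _)
        (fun l x hx => hwB x hx.2 l) fun l => hwv (k + 1) l
    have h1 := VanishesOn.sub (fun x hx => (hfB x hx.2 i j).sub (hdvs x hx.2 i j))
      (fun x hx => contDiffAt_dB hinf (hgB x hx.2) (hdet x hx.2) (hwB x hx.2) i j) (hsm k i j) hdwv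
    refine h1.congr fun x hx => ?_
    filter_upwards [hBo.mem_nhds hx.2] with y hy
    rw [hdw y hy]
    ring
  refine ⟨r, hrpos, hBW, A, C, v, hA, hAr, fun i => (hvb i).mono_set hB₀, fun x hx i j => ?_, hwv⟩
  have hAB := (hAb i j).mono_set hB₀
  refine eq_zero_of_vanishesOn hA.le hAB.contDiffAt (fun x hx n => hAB.bound_zero hx n)
    (fun k => (hfl k i j).mono_set (singleton_subset_iff.2 hzS)) hx ?_
  rw [mem_ball_iff_norm] at hx
  exact (mul_lt_mul_of_pos_left hx hA).trans_le hAr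

/-- The local solutions on balls of a third of the radius agree, since they have the same boundary
jets and are analytic. -/
theorem eq_of_local_solutions {S : Set R3} {vs v v' : R3 → ℝ} {z z' x : R3} {r r' A A' C C' : ℝ}
    (hA : 0 < A) (hA' : 0 < A') (hAr : A * r ≤ 1) (hAr' : A' * r' ≤ 1) (hz' : z' ∈ S)
    (hvs : ∀ x ∈ S, ContDiffAt ℝ ∞ vs x)
    (hv : CauchyBound (Metric.ball z r) A C 0 v) (hv' : CauchyBound (Metric.ball z' r') A' C' 0 v')
    (hflat : ∀ k, VanishesOn (S ∩ Metric.ball z r) k fun x => v x - vs x)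
    (hflat' : ∀ k, VanishesOn (S ∩ Metric.ball z' r') k fun x => v' x - vs x)
    (hrr : r' ≤ r) (hx : x ∈ Metric.ball z (r / 3)) (hx' : x ∈ Metric.ball z' (r' / 3)) :
    v x = v' x := by
  rw [Metric.mem_ball] at hx hx'
  have hr' : 0 < r' := by linarith [dist_nonneg (x := x) (y := z')]
  have hzz : dist z' z < 2 * r / 3 := by
    linarith [dist_triangle_left z' z x]
  -- the smaller ball is centred within `2 r / 3` of `z`, so both solutions live on it, and on its
  -- centre, a boundary point, they have the same jet
  have hsub : Metric.ball z' (r' / 3) ⊆ Metric.ball z r := fun y hy => by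
    rw [Metric.mem_ball] at hy ⊢
    linarith [dist_triangle y z' z]
  have hsub' : Metric.ball z' (r' / 3) ⊆ Metric.ball z' r' :=
    Metric.ball_subset_ball (by linarith)
  have hC : 0 ≤ C := (abs_nonneg _).trans (hv.abs_le (hsub (Metric.mem_ball_self (by linarith))))
  have hC' : 0 ≤ C' :=
    (abs_nonneg _).trans (hv'.abs_le (hsub' (Metric.mem_ball_self (by linarith))))
  have h1 := ((hv.mono_set hsub).mono hA.le (le_max_left A A') hC le_rfl).sub
    ((hv'.mono_set hsub').mono hA'.le (le_max_right A A') hC' le_rfl)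
  have hm : z' ∈ Metric.ball z r := hsub (Metric.mem_ball_self (by linarith))
  have hm' : z' ∈ Metric.ball z' r' := Metric.mem_ball_self hr'
  have h2 : ∀ k, VanishesOn {z'} k fun x => v x - v' x := by
    intro k
    have e1 : ∀ x ∈ ({z'} : Set R3), ContDiffAt ℝ ∞ (fun x => v x - vs x) x := by
      rintro x rfl
      exact (hv.contDiffAt _ hm).sub (hvs _ hz')
    have e2 : ∀ x ∈ ({z'} : Set R3), ContDiffAt ℝ ∞ (fun x => v' x - vs x) x := by
      rintro x rfl
      exact (hv'.contDiffAt _ hm').sub (hvs _ hz')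
    have := VanishesOn.sub e1 e2 ((hflat k).mono_set (singleton_subset_iff.2 ⟨hz', hm⟩))
      ((hflat' k).mono_set (singleton_subset_iff.2 ⟨hz', hm'⟩))
    simpa using this
  have h3 : v x - v' x = 0 := by
    refine eq_zero_of_vanishesOn (hA.le.trans (le_max_left A A')) h1.contDiffAt
      (fun x hx n => h1.bound_zero hx n) h2 (Metric.mem_ball.2 hx') ?_
    rw [← dist_eq_norm]
    rcases max_cases A A' with ⟨h, -⟩ | ⟨h, -⟩ <;> rw [h]
    · have : A * dist x z' < A * r := by
        gcongr
        linarith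
      linarith
    · have : A' * dist x z' < A' * r' := by
        gcongr
        linarith
      linarith
  linarith

/-! ### Gluing the local solutions -/

/-- Finitely many components given by analytic functions near the boundary have analytic extensions
on a common open set. -/
theorem exists_analytic_extension {M : Set R3} {f : TensorField}
    (hf : ∀ i j, AnalyticNearBoundary M fun x => f x i j) :
    ∃ W, IsOpen W ∧ frontier M ⊆ W ∧ ∃ fω : TensorField,
      (∀ i j, ∀ x ∈ W, ContDiffAt ℝ ω (fun y => fω y i j) x) ∧ EqOn f fω (W ∩ M) := by
  choose W hWo hMW F hF hfF using hf
  refine ⟨⋂ i, ⋂ j, W i j, isOpen_iInter_of_finite fun i => isOpen_iInter_of_finite (hWo i),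
    subset_iInter fun i => subset_iInter (hMW i), fun x => Matrix.of fun i j => F i j x,
    fun i j x hx => ?_, fun x hx => ?_⟩
  · exact (hF i j x (mem_iInter.1 (mem_iInter.1 hx i) j)).contDiffAt
  · ext i j
    exact hfF i j ⟨mem_iInter.1 (mem_iInter.1 hx.1 i) j, hx.2⟩

/-- In the analytic case the boundary jet of the smooth gauge is that of a gauge which solves
`f = d^𝓑 v` near the boundary. -/
theorem exists_analytic_gauge_near_boundary {M : Set R3} {g f G F : TensorField}
    {vs : CovectorField} (hM : IsSimple M g)
    (hG : ∀ i j, ContDiff ℝ ∞ fun x => G x i j) (hF : ∀ i j, ContDiff ℝ ∞ fun x => F x i j)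
    (hgG : EqOn g G M) (hfF : EqOn f F M)
    (hvs : ∀ i, ContDiff ℝ ∞ fun x => vs x i) (hvs0 : ∀ x ∈ frontier M, vs x = 0)
    (hflat : ∀ k i j, VanishesOn (frontier M) k fun x => F x i j - dB univ G vs x i j)
    (hω : HasBoundaryOfClass ω M) (hg : ∀ i j, AnalyticNearBoundary M fun x => g x i j)
    (hf : ∀ i j, AnalyticNearBoundary M fun x => f x i j) :
    ∃ v : CovectorField, (∀ i, ContDiff ℝ ∞ fun x => v x i) ∧ (∀ x ∈ frontier M, v x = 0) ∧
      ∃ W : Set R3, IsOpen W ∧ frontier M ⊆ W ∧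
        ∀ x ∈ W ∩ M, ∀ i j, f x i j - dB M g v x i j = 0 := by
  have hMc := hM.compact.isClosed
  have hU := uniqueDiffOn_of_boundary hM.boundary
  obtain ⟨W₁, hW₁, hMW₁, gω, hgω, hggω⟩ := exists_analytic_extension hg
  obtain ⟨W₂, hW₂, hMW₂, fω, hfω, hffω⟩ := exists_analytic_extension hf
  have hloc : ∀ z ∈ frontier M, ∃ r > 0, Metric.ball z r ⊆ W₁ ∩ W₂ ∧
      ∃ (A C : ℝ) (v : CovectorField), 0 < A ∧ A * r ≤ 1 ∧
        (∀ i, CauchyBound (Metric.ball z r) A C 0 fun x => v x i) ∧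
        (∀ x ∈ Metric.ball z r, ∀ i j, fω x i j - dB univ gω v x i j = 0) ∧
        ∀ k i, VanishesOn (frontier M ∩ Metric.ball z r) k fun x => v x i - vs x i := by
    intro z hz
    obtain ⟨U, ρ, hρ⟩ := hω z hz
    exact exists_local_analytic_solution (W := W₁ ∩ W₂) hU hMc hG hF hgG hfF hM.posDef hvs
      hvs0 hflat (hW₁.inter hW₂)
      (fun i j x hx => hgω i j x hx.1) (fun i j x hx => hfω i j x hx.2)
      (fun x hx => hggω ⟨hx.1.1, hx.2⟩) (fun x hx => hffω ⟨hx.1.2, hx.2⟩) hρ hz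
      ⟨hMW₁ hz, hMW₂ hz⟩
  choose! r hr hrW A C u hA hAr hub hus huflat using hloc
  have hagree : ∀ z ∈ frontier M, ∀ z' ∈ frontier M, ∀ x ∈ Metric.ball z (r z / 3),
      x ∈ Metric.ball z' (r z' / 3) → u z x = u z' x := by
    have h1 : ∀ z ∈ frontier M, ∀ z' ∈ frontier M, r z' ≤ r z → ∀ x ∈ Metric.ball z (r z / 3),
        x ∈ Metric.ball z' (r z' / 3) → u z x = u z' x := by
      intro z hz z' hz' hrr x hx hx'
      ext i
      exact eq_of_local_solutions (v := fun x => u z x i) (v' := fun x => u z' x i)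
        (vs := fun x => vs x i) (hA z hz) (hA z' hz') (hAr z hz) (hAr z' hz') hz'
        (fun x _ => (hvs i).contDiffAt) (hub z hz i) (hub z' hz' i) (fun k => huflat z hz k i)
        (fun k => huflat z' hz' k i) hrr hx hx'
    intro z hz z' hz' x hx hx'
    rcases le_total (r z') (r z) with h | h
    · exact h1 z hz z' hz' h x hx hx'
    · exact (h1 z' hz' z hz h x hx' hx).symm
  set Ω : Set R3 := ⋃ z ∈ frontier M, Metric.ball z (r z / 3) with hΩ
  have hΩo : IsOpen Ω := isOpen_biUnion fun z _ => Metric.isOpen_ball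
  have hMΩ : frontier M ⊆ Ω := fun z hz =>
    mem_biUnion hz (Metric.mem_ball_self (by have := hr z hz; positivity))
  have hΩex : ∀ x ∈ Ω, ∃ z ∈ frontier M, x ∈ Metric.ball z (r z / 3) := fun x hx => by
    simpa [hΩ] using hx
  choose! c hc hcx using hΩex
  set V : CovectorField := fun x => u (c x) x with hV
  have hVeq : ∀ z ∈ frontier M, ∀ x ∈ Metric.ball z (r z / 3), V x = u z x := fun z hz x hx => by
    have hxΩ : x ∈ Ω := mem_biUnion hz hx
    exact hagree (c x) (hc x hxΩ) z hz x (hcx x hxΩ) hx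
  have hsub : ∀ z ∈ frontier M, Metric.ball z (r z / 3) ⊆ Metric.ball z (r z) := fun z hz =>
    Metric.ball_subset_ball (by linarith [hr z hz])
  have hVs : ∀ i, ∀ x ∈ Ω, ContDiffAt ℝ ∞ (fun y => V y i) x := by
    intro i x hx
    refine ((hub (c x) (hc x hx) i).contDiffAt x
      (hsub _ (hc x hx) (hcx x hx))).congr_of_eventuallyEq ?_
    filter_upwards [Metric.isOpen_ball.mem_nhds (hcx x hx)] with y hy
    rw [hVeq (c x) (hc x hx) y hy]
  obtain ⟨χ, hχ, -, hχΩ, hχ1⟩ := exists_cutoff (hM.compact.of_isClosed_subset isClosed_frontier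
    hMc.frontier_subset) hΩo hMΩ
  obtain ⟨N, hNo, hMN, hN1⟩ := eventually_nhdsSet_iff_exists.1 hχ1
  refine ⟨fun x i => χ x * V x i, fun i => contDiff_cutoff_mul hχ hχΩ (hVs i), fun x hx => ?_,
    N ∩ Ω, hNo.inter hΩo, subset_inter hMN hMΩ, fun x hx i j => ?_⟩
  · ext i
    have h0 := (huflat x hx 1 i).eq_zero (x := x) ⟨hx, Metric.mem_ball_self (hr x hx)⟩
    rw [hvs0 x hx, Pi.zero_apply, sub_zero] at h0
    have := hVeq x hx x (Metric.mem_ball_self (by have := hr x hx; positivity))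
    change χ x * V x i = 0
    rw [this, h0, mul_zero]
  · obtain ⟨⟨hxN, hxΩ⟩, hxM⟩ := hx
    have hz := hc x hxΩ
    have hxz := hcx x hxΩ
    have hxr := hsub _ hz hxz
    rw [dB_eq_of_eqOn (O := N ∩ Metric.ball (c x) (r (c x) / 3)) (G := gω) (w := u (c x)) hU
      (hNo.inter Metric.isOpen_ball) ⟨hxM, hxN, hxz⟩
      (fun i j => (hgω i j x (hrW _ hz hxr).1).differentiableAt (by simp))
      (fun i => ((hub _ hz i).contDiffAt x hxr).differentiableAt (by simp)) (fun y hy => ?_)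
      (fun y hy => ?_) i j, hffω ⟨(hrW _ hz hxr).2, hxM⟩]
    · exact hus _ hz x hxr i j
    · exact hggω ⟨(hrW _ hz (hsub _ hz hy.2.2)).1, hy.1⟩
    · ext i
      simp only [hN1 y hy.2.1, one_mul, hVeq _ hz y hy.2.2]

end MixedRay

theorem lemma5 (M : Set MixedRay.R3) (g f : MixedRay.TensorField)
    (hM : MixedRay.IsSimple M g)
    (hf : ∀ i j, MixedRay.SmoothUpTo M (fun x => f x i j))
    (hf_trace : ∀ x ∈ M, MixedRay.trace g f x = 0)
    (hLf : MixedRay.MixedRayTransformVanishes M g f) :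
    (∃ v : MixedRay.CovectorField,
      (∀ i, MixedRay.SmoothUpTo M (fun x => v x i)) ∧
      (∀ x ∈ frontier M, v x = 0) ∧
      ∀ m : ℕ, ∀ i j, ∀ x ∈ frontier M,
        iteratedFDerivWithin ℝ m (fun y => f y i j - MixedRay.dB M g v y i j) M x = 0) ∧
    (MixedRay.HasBoundaryOfClass ω M →
      (∀ i j, MixedRay.AnalyticNearBoundary M (fun x => g x i j)) →
      (∀ i j, MixedRay.AnalyticNearBoundary M (fun x => f x i j)) →
      ∃ v : MixedRay.CovectorField,
        (∀ i, MixedRay.SmoothUpTo M (fun x => v x i)) ∧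
        (∀ x ∈ frontier M, v x = 0) ∧
        ∃ W : Set MixedRay.R3, IsOpen W ∧ frontier M ⊆ W ∧
          ∀ x ∈ W ∩ M, ∀ i j, f x i j - MixedRay.dB M g v x i j = 0) := by
  obtain ⟨G, F, v, hG, hF, hgG, hfF, hv, hv0, hflat⟩ :=
    MixedRay.exists_flat_gauge hM hf hf_trace hLf
  have hMc := hM.compact.isClosed
  have hU := MixedRay.uniqueDiffOn_of_boundary hM.boundary
  have hdet : ∀ x ∈ M, (G x).det ≠ 0 := fun x hx => by
    rw [← hgG hx]
    exact (hM.posDef x hx).det_pos.ne'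
  refine ⟨⟨v, fun i => ⟨_, hv i, fun _ _ => rfl⟩, hv0, fun m i j x hx =>
    MixedRay.iteratedFDerivWithin_eq_zero_of_vanishesOn hU hMc hG hF hgG hfF hv hdet hflat m i j
      hx⟩,
    fun hω hgω hfω => ?_⟩
  obtain ⟨v', hv', hv0', W, hW, hMW, h⟩ :=
    MixedRay.exists_analytic_gauge_near_boundary hM hG hF hgG hfF hv hv0 hflat hω hgω hfω
  exact ⟨v', fun i => ⟨_, hv' i, fun _ _ => rfl⟩, hv0', W, hW, hMW, h⟩
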